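/- **Conventions.** Let $F$ be a field of characteristic $0$ and $\mathrm{Vect}$ the category of finite-dimensional $F$-vector spaces. In a strict 2-category, horizontal composites are written in diagrammatic order ($fg\colon A\to D$ for $f\colon A\to B$, $g\colon B\to D$; $\alpha\circ\beta$ for 2-morphisms), vertical composition is written $\alpha\cdot\beta$ (first $\alpha$, then $\beta$), $\mathrm{Hom}(A,B)$ is the category of 1-morphisms $A\to B$ and 2-morphisms between them, and $\mathrm{End}(A)=\mathrm{Hom}(A,A)$. In horizontal composites a 1-morphism stands for its identity 2-morphism. Objects $A,B$ are *equivalent* if there are $f\colon A\to B$, $g\colon B\to A$ with $fg\cong 1_A$ and $gf\cong 1_B$. **Semi-strict monoidal 2-category.** A strict 2-category with an object $I$ and, for every object $X$, strict 2-functors $X\otimes-$ and $-\otimes X$, which agree on objects ($X\otimes Y$ is the same for both) and are strictly associative and strictly unital with respect to $I$ (i.e. $(A\otimes B)\otimes x=A\otimes(B\otimes x)$, $(A\otimes x)\otimes B=A\otimes(x\otimes B)$, $(x\otimes A)\otimes B=x\otimes(A\otimes B)$, $I\otimes x=x=x\otimes I$ for objects, 1- and 2-morphisms $x$), together with invertible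 2-morphisms (tensorators) $\otimes_{f,g}\colon (f\otimes B)(A'\otimes g)\Rightarrow(A\otimes g)(f\otimes B')$ for $f\colon A\to A'$, $g\colon B\to B'$, natural in $f$ and $g$ with respect to 2-morphisms, such that $\otimes_{A\otimes f,g}=A\otimes\otimes_{f,g}$, $\otimes_{f\otimes A,g}=\otimes_{f,A\otimes g}$, $\otimes_{f,g\otimes A}=\otimes_{f,g}\otimes A$, $\otimes_{1_A,g}$ and $\otimes_{f,1_A}$ are identities, and $\otimes_{ff',g}$, $\otimes_{f,gg'}$ are the evident composites of $\otimes_{f,g},\otimes_{f',g}$, resp. $\otimes_{f,g},\otimes_{f,g'}$. **Duals.** Such a 2-category has *duals* if there are given $\alpha^*\colon g\Rightarrow f$ for every $\alpha\colon f\Rightarrow g$; $f^*\colon B\to A$, $i_f\colon 1_A\Rightarrow ff^*$, $e_f\colon f^*f\Rightarrow 1_B$ for every $f\colon A\to B$; and $A^*$, $i_A\colon I\to A\otimes A^*$, $e_A\colon A^*\otimes A\to I$, $T_A\colon (i_A\otimes A)(A\otimes e_A)\Rightarrow 1_A$ for every object $A$. A 2-morphism $\alpha$ is *unitary* if it is invertible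 with inverse $\alpha^*$, and for $\alpha\colon f\Rightarrow g$ put $\alpha^\dagger=(g^*\circ i_f)\cdot(g^*\circ\alpha\circ f^*)\cdot(e_g\circ f^*)$ and ${}^\dagger\alpha=(i_{f^*}\circ g^*)\cdot(f^*\circ\alpha\circ g^*)\cdot(f^*\circ e_{g^*})$, both $g^*\Rightarrow f^*$. It is required that: 1. $X^{**}=X$ for objects, 1- and 2-morphisms $X$; 2. $1_X^*=1_X$ for objects and 1-morphisms $X$; 3. $(\alpha\cdot\beta)^*=\beta^*\cdot\alpha^*$, $(\alpha\circ\beta)^*=\alpha^*\circ\beta^*$, $(fg)^*=g^*f^*$, $(A\otimes x)^*=A\otimes x^*$ and $(x\otimes A)^*=x^*\otimes A$ for 1- and 2-morphisms $x$, and $(A\otimes B)^*=B^*\otimes A^*$; 4. $\otimes_{f,g}$ is unitary; 5. $i_{A^*}=e_A^*$, $e_{A^*}=i_A^*$, $i_{f^*}=e_f^*$, $e_{f^*}=i_f^*$; 6. $T_A$ is unitary; 7. $i_{A\otimes B}=i_A(A\otimes i_B\otimes A^*)$, $e_{A\otimes B}=(B^*\otimes e_A\otimes B)e_B$, and $T_{A\otimes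 B}=\big[(i_A\otimes A\otimes B)\circ(A\otimes\otimes_{i_B,e_A}\otimes B)\circ(A\otimes B\otimes e_B)\big]\cdot\big[(T_A\otimes B)\circ(A\otimes T_B)\big]$; 8. $T_I=1_{1_I}$; 9. $i_{A\otimes f}=A\otimes i_f$, $i_{f\otimes A}=i_f\otimes A$, $e_{A\otimes f}=A\otimes e_f$, $e_{f\otimes A}=e_f\otimes A$; 10. $i_{fg}=i_f\cdot(f\circ i_g\circ f^*)$, $e_{fg}=(g^*\circ e_f\circ g)\cdot e_g$; 11. $(i_f\circ f)\cdot(f\circ e_f)=1_f$, $(f^*\circ i_f)\cdot(e_f\circ f^*)=1_{f^*}$; 12. $(\alpha^\dagger)^*=(\alpha^*)^\dagger$; 13. $\big[i_A\circ(A\otimes T_{A^*}^\dagger)\big]\cdot\big[\otimes_{i_A,i_A}\circ(A\otimes e_A\otimes A^*)\big]\cdot\big[i_A\circ(T_A\otimes A^*)\big]=1_{i_A}$. **Pivotal.** For $f\colon A\to B$ put ${}^\#f=(i_{A^*}\otimes B^*)(A^*\otimes f\otimes B^*)(A^*\otimes e_{B^*})$ and $f^\#=(B^*\otimes i_A)(B^*\otimes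 f\otimes A^*)(e_B\otimes A^*)$, both $B^*\to A^*$, and define ${}^\#\alpha,\alpha^\#$ on 2-morphisms likewise. For $f\colon X\to Y$, $g\colon Y\to Z$ there are canonical unitary 2-morphisms ${}^\#(fg)\Rightarrow{}^\#g\,{}^\#f$ and $(fg)^\#\Rightarrow g^\#f^\#$: insert $T_Y^\dagger$, resp. $T_Y^*$, between $f$ and $g$ and move the factors past each other by tensorators and their inverses. A *pivotal structure* consists of unitary 2-morphisms $\varphi_f\colon {}^\#f\Rightarrow f^\#$ with ${}^\#\alpha\cdot\varphi_g=\varphi_f\cdot\alpha^\#$ for $\alpha\colon f\Rightarrow g$, $\varphi_f^\dagger=\varphi_{f^*}$, and such that the $\varphi$'s are compatible with composition: $\varphi_{fg}$ followed by $(fg)^\#\Rightarrow g^\#f^\#$ equals ${}^\#(fg)\Rightarrow{}^\#g\,{}^\#f$ followed by $\varphi_g\circ\varphi_f$; moreover ${}^\#(\alpha^\dagger)={}^\dagger(\alpha^\#)$ and $({}^\#\alpha)^\dagger=({}^\dagger\alpha)^\#$ for all $\alpha$. **Traces, spherical.** For $f\colon A\to A$ put $\mathrm{Tr}_L(f)=i_{A^*}(A^*\otimes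 f)e_A$ and $\mathrm{Tr}_R(f)=i_A(f\otimes A^*)e_{A^*}$, both $I\to I$, and similarly for 2-morphisms. For $f\colon A\to B$, $g\colon B\to A$ let $\theta^R_{f,g}\colon\mathrm{Tr}_R(fg)\Rightarrow\mathrm{Tr}_R(gf)$ be the unitary 2-morphism obtained by inserting $T_B^\dagger\otimes A^*$ between $f$ and $g$, moving $e_{B^*}$ past $(g\otimes A^*)e_{A^*}$ by a tensorator, applying $B\otimes\varphi_g$, moving $i_A(f\otimes A^*)$ past $i_B(g\otimes B^*)$ and then $f$ past $e_A$ by tensorators, and applying $T_A\otimes B^*$; let $\theta^L_{f,g}\colon\mathrm{Tr}_L(fg)\Rightarrow\mathrm{Tr}_L(gf)$ be its mirror image under reversal of $\otimes$. For $f\colon A\to B$ define the caps $\cap^R_f=i_{h}\colon 1_I\Rightarrow\mathrm{Tr}_R(ff^*)$ with $h=i_A(f\otimes A^*)$ and $\cap^L_f=i_{h'}\colon 1_I\Rightarrow \mathrm{Tr}_L(ff^*)$ with $h'=i_{A^*}(A^*\otimes f)$, and the cups $\cup^{R}_f=(\cap^{R}_f)^*$, $\cup^{L}_f=(\cap^{L}_f)^*$.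 The pivotal 2-category is *consistent* if $\cap_f\cdot\theta_{f,f^*}=\cap_{f^*}$ and $\theta_{f,f^*}\cdot\cup_{f^*}=\cup_f$ for all $f$, both in the $R$- and the $L$-version. A *spherical* 2-category is a consistent pivotal 2-category with unitary 2-morphisms $\sigma_f\colon\mathrm{Tr}_L(f)\Rightarrow\mathrm{Tr}_R(f)$ for all $f\colon A\to A$, natural in $f$, such that $\cap^L_{1_A}\cdot\sigma_{1_A}=\cap^R_{1_A}$ and $\sigma_{1_A}\cdot\cup^R_{1_A}=\cup^L_{1_A}$ for all objects $A$. **Linearity and semi-simplicity.** A *2-vector space of rank $n$* is an $F$-linear category that is $F$-linearly equivalent to $\mathrm{Vect}^n$; its *basis* is a finite set of representatives of the isomorphism classes of its simple objects. A semi-strict monoidal 2-category is *$\mathrm{Vect}$-linear* if every $\mathrm{Hom}(A,B)$ is a 2-vector space of finite rank and composition and tensor product are $F$-bilinear. It is always assumed that $\mathrm{End}(I)$ is a 2-vector space of rank one and that $F\to\mathrm{2End}(1_I)$, $c\mapsto c\cdot 1_{1_I}$, is bijective; it is used to identify $\mathrm{2End}(1_I)$ with $F$. The 2-category is *finitely semi-simple*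 if there is a finite set $\mathcal E$ of pairwise non-equivalent objects $X$ with $\mathrm{End}(X)\neq0$ such that for all objects $A,B$ composition induces an equivalence $\bigoplus_{X\in\mathcal E}\mathrm{Hom}(A,X)\otimes\mathrm{Hom}(X,B)\simeq\mathrm{Hom}(A,B)$, where $\otimes$ is the tensor product of 2-vector spaces. For $\alpha\colon f\Rightarrow g$ and $\beta\colon g\Rightarrow f$ put $$\langle\alpha,\beta\rangle=\cap^R_f\cdot\mathrm{Tr}_R\big((\alpha\cdot\beta)\circ 1_{f^*}\big)\cdot\cup^R_f\in\mathrm{2End}(1_I)=F .$$ The 2-category is *non-degenerate* if, for all parallel 1-morphisms $f,g$, this pairing of $\mathrm{2Hom}(f,g)$ with $\mathrm{2Hom}(g,f)$ is non-degenerate (on both sides). The quantum dimensions are $\dim_q(f)=\langle 1_f,1_f\rangle$ for a 1-morphism $f$ and $\dim_q(A)=\dim_q(1_A)$ for an object $A$. An object $A$ is *simple* if $\mathrm{End}(A)$ has rank one. **Lemma 5.6.** Let $C$ be a non-degenerate, finitely semi-simple, $\mathrm{Vect}$-linear spherical 2-category over a field $F$ of characteristic $0$, satisfying the above assumption on $I$.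 Let $\mathcal E$ be a finite set of objects as in the definition of finite semi-simplicity, and for all objects $A,B$ let $\mathcal F_{A,B}$ be a basis of $\mathrm{Hom}(A,B)$. Then the number $K$ of equivalence classes of simple objects of $C$ is finite, $\dim_q(A)\neq 0$ for every simple object $A$, and for every simple object $A$ $$K=\sum_{B,D\in\mathcal E}\ \sum_{f\in\mathcal F_{A,B\otimes D}}\dim_q(A)^{-1}\dim_q(B)^{-1}\dim_q(D)^{-1}\dim_q(f)^2\qquad\text{in }F.$$ In particular, the sum on the right-hand side does not depend on the simple object $A$. -/

import Mathlib

set_option linter.checkUnivs false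
open CategoryTheory CategoryTheory.Limits
open scoped TensorProduct

universe u v w x

/-! # Strict 2-categories, presented globularly

A strict 2-category is given by its sets of objects, 1-morphisms and 2-morphisms, with sources,
targets, identities and partially defined compositions.  The compositions are total functions, but
they carry a meaning (and satisfy laws) only on composable cells.  All compositions are written in
diagrammatic order: `f ⬝₁ g` is `f` followed by `g`.  In this presentation the strict equations
between cells, such as `A ⊗ (B ⊗ α) = (A ⊗ B) ⊗ α`, are plain equations. -/

/-- The data of a globular strict 2-category. -/
structure TwoCatData where
  /-- objects -/
  Obj : Type u
  /-- 1-morphisms -/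
  Mor : Type v
  /-- 2-morphisms -/
  Cell : Type w
  /-- source object of a 1-morphism -/
  src : Mor → Obj
  /-- target object of a 1-morphism -/
  tgt : Mor → Obj
  /-- source 1-morphism of a 2-morphism -/
  dom : Cell → Mor
  /-- target 1-morphism of a 2-morphism -/
  cod : Cell → Mor
  /-- identity 1-morphism -/
  one : Obj → Mor
  /-- identity 2-morphism -/
  idc : Mor → Cell
  /-- composition of 1-morphisms -/
  comp : Mor → Mor → Mor
  /-- vertical composition of 2-morphisms -/
  vcomp : Cell → Cell → Cell
  /-- horizontal composition of 2-morphisms -/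
  hcomp : Cell → Cell → Cell

local infixr:70 " ⬝₁ " => TwoCatData.comp _
local infixr:60 " ⬝₂ " => TwoCatData.vcomp _
local infixr:70 " ∘₂ " => TwoCatData.hcomp _

/-- `f` is a 1-morphism `A → B`. -/
def TwoCatData.IsMor (C : TwoCatData.{u, v, w}) (f : C.Mor) (A B : C.Obj) : Prop :=
  C.src f = A ∧ C.tgt f = B

/-- `α` is a 2-morphism `f ⇒ g`. -/
def TwoCatData.IsCell (C : TwoCatData.{u, v, w}) (α : C.Cell) (f g : C.Mor) : Prop :=
  C.dom α = f ∧ C.cod α = g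

/-- `α` is invertible for the vertical composition. -/
def TwoCatData.IsInvertible (C : TwoCatData.{u, v, w}) (α : C.Cell) : Prop :=
  ∃ β, C.IsCell β (C.cod α) (C.dom α) ∧
    α ⬝₂ β = C.idc (C.dom α) ∧ β ⬝₂ α = C.idc (C.cod α)

/-- The axioms of `TwoCat`. -/
structure TwoCatLaws (C : TwoCatData.{u, v, w}) : Prop where
  src_dom : ∀ (α : C.Cell), C.src (C.dom α) = C.src (C.cod α)
  tgt_dom : ∀ (α : C.Cell), C.tgt (C.dom α) = C.tgt (C.cod α)
  src_one : ∀ (A : C.Obj), C.src (C.one A) = A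
  tgt_one : ∀ (A : C.Obj), C.tgt (C.one A) = A
  dom_idc : ∀ (f : C.Mor), C.dom (C.idc f) = f
  cod_idc : ∀ (f : C.Mor), C.cod (C.idc f) = f
  src_comp : ∀ (f g : C.Mor), C.tgt f = C.src g → C.src (f ⬝₁ g) = C.src f
  tgt_comp : ∀ (f g : C.Mor), C.tgt f = C.src g → C.tgt (f ⬝₁ g) = C.tgt g
  dom_vcomp : ∀ (α β : C.Cell), C.cod α = C.dom β → C.dom (α ⬝₂ β) = C.dom α
  cod_vcomp : ∀ (α β : C.Cell), C.cod α = C.dom β → C.cod (α ⬝₂ β) = C.cod β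
  dom_hcomp : ∀ (α β : C.Cell),
    C.tgt (C.dom α) = C.src (C.dom β) → C.dom (α ∘₂ β) = C.dom α ⬝₁ C.dom β
  cod_hcomp : ∀ (α β : C.Cell),
    C.tgt (C.dom α) = C.src (C.dom β) → C.cod (α ∘₂ β) = C.cod α ⬝₁ C.cod β
  one_comp : ∀ (f : C.Mor), C.one (C.src f) ⬝₁ f = f
  comp_one : ∀ (f : C.Mor), f ⬝₁ C.one (C.tgt f) = f
  comp_assoc : ∀ (f g h : C.Mor),
    C.tgt f = C.src g → C.tgt g = C.src h → (f ⬝₁ g) ⬝₁ h = f ⬝₁ (g ⬝₁ h)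
  idc_vcomp : ∀ (α : C.Cell), C.idc (C.dom α) ⬝₂ α = α
  vcomp_idc : ∀ (α : C.Cell), α ⬝₂ C.idc (C.cod α) = α
  vcomp_assoc : ∀ (α β γ : C.Cell),
    C.cod α = C.dom β → C.cod β = C.dom γ → (α ⬝₂ β) ⬝₂ γ = α ⬝₂ (β ⬝₂ γ)
  one_hcomp : ∀ (α : C.Cell), C.idc (C.one (C.src (C.dom α))) ∘₂ α = α
  hcomp_one : ∀ (α : C.Cell), α ∘₂ C.idc (C.one (C.tgt (C.dom α))) = α
  hcomp_assoc : ∀ (α β γ : C.Cell),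
    C.tgt (C.dom α) = C.src (C.dom β) → C.tgt (C.dom β) = C.src (C.dom γ) →
    (α ∘₂ β) ∘₂ γ = α ∘₂ (β ∘₂ γ)
  idc_hcomp_idc : ∀ (f g : C.Mor), C.tgt f = C.src g → C.idc f ∘₂ C.idc g = C.idc (f ⬝₁ g)
  interchange : ∀ (α α' β β' : C.Cell),
    C.cod α = C.dom α' → C.cod β = C.dom β' → C.tgt (C.dom α) = C.src (C.dom β) →
    (α ⬝₂ α') ∘₂ (β ⬝₂ β') = (α ∘₂ β) ⬝₂ (α' ∘₂ β')

/-- Strict 2-categories. -/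
structure TwoCat extends TwoCatData.{u, v, w} where
  laws : TwoCatLaws toTwoCatData

/-! # Semi-strict monoidal 2-categories -/

/-- The data of a semi-strict monoidal structure on a strict 2-category. -/
structure MonTwoCatData extends TwoCat.{u, v, w} where
  /-- the identity object `I` -/
  I : Obj
  /-- `A ⊗ B` for objects -/
  tens : Obj → Obj → Obj
  /-- `A ⊗ f` -/
  ltens : Obj → Mor → Mor
  /-- `f ⊗ A` -/
  rtens : Mor → Obj → Mor
  /-- `A ⊗ α` -/
  ltensc : Obj → Cell → Cell
  /-- `α ⊗ A` -/
  rtensc : Cell → Obj → Cell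
  /-- the tensorator `⊗_{f,g}` -/
  tor : Mor → Mor → Cell

local infixr:90 " ⊗₀ " => MonTwoCatData.tens _
local infixr:90 " ◁₁ " => MonTwoCatData.ltens _
local infixr:90 " ▷₁ " => MonTwoCatData.rtens _
local infixr:90 " ◁₂ " => MonTwoCatData.ltensc _
local infixr:90 " ▷₂ " => MonTwoCatData.rtensc _

/-- The axioms of `MonTwoCat`. -/
structure MonTwoCatLaws (C : MonTwoCatData.{u, v, w}) : Prop where
  -- `A ⊗ -` is a strict 2-functor
  src_ltens : ∀ (A : C.Obj) (f : C.Mor), C.src (A ◁₁ f) = A ⊗₀ C.src f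
  tgt_ltens : ∀ (A : C.Obj) (f : C.Mor), C.tgt (A ◁₁ f) = A ⊗₀ C.tgt f
  dom_ltensc : ∀ (A : C.Obj) (α : C.Cell), C.dom (A ◁₂ α) = A ◁₁ C.dom α
  cod_ltensc : ∀ (A : C.Obj) (α : C.Cell), C.cod (A ◁₂ α) = A ◁₁ C.cod α
  ltens_one : ∀ (A B : C.Obj), A ◁₁ C.one B = C.one (A ⊗₀ B)
  ltens_comp : ∀ (A : C.Obj) (f g : C.Mor), C.tgt f = C.src g → A ◁₁ (f ⬝₁ g) = (A ◁₁ f) ⬝₁ (A ◁₁ g)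
  ltensc_idc : ∀ (A : C.Obj) (f : C.Mor), A ◁₂ C.idc f = C.idc (A ◁₁ f)
  ltensc_vcomp : ∀ (A : C.Obj) (α β : C.Cell),
    C.cod α = C.dom β → A ◁₂ (α ⬝₂ β) = (A ◁₂ α) ⬝₂ (A ◁₂ β)
  ltensc_hcomp : ∀ (A : C.Obj) (α β : C.Cell), C.tgt (C.dom α) = C.src (C.dom β) →
    A ◁₂ (α ∘₂ β) = (A ◁₂ α) ∘₂ (A ◁₂ β)
  -- `- ⊗ A` is a strict 2-functor
  src_rtens : ∀ (f : C.Mor) (A : C.Obj), C.src (f ▷₁ A) = C.src f ⊗₀ A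
  tgt_rtens : ∀ (f : C.Mor) (A : C.Obj), C.tgt (f ▷₁ A) = C.tgt f ⊗₀ A
  dom_rtensc : ∀ (α : C.Cell) (A : C.Obj), C.dom (α ▷₂ A) = C.dom α ▷₁ A
  cod_rtensc : ∀ (α : C.Cell) (A : C.Obj), C.cod (α ▷₂ A) = C.cod α ▷₁ A
  one_rtens : ∀ (B A : C.Obj), C.one B ▷₁ A = C.one (B ⊗₀ A)
  comp_rtens : ∀ (f g : C.Mor) (A : C.Obj), C.tgt f = C.src g → (f ⬝₁ g) ▷₁ A = (f ▷₁ A) ⬝₁ (g ▷₁ A)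
  idc_rtensc : ∀ (f : C.Mor) (A : C.Obj), C.idc f ▷₂ A = C.idc (f ▷₁ A)
  vcomp_rtensc : ∀ (α β : C.Cell) (A : C.Obj),
    C.cod α = C.dom β → (α ⬝₂ β) ▷₂ A = (α ▷₂ A) ⬝₂ (β ▷₂ A)
  hcomp_rtensc : ∀ (α β : C.Cell) (A : C.Obj), C.tgt (C.dom α) = C.src (C.dom β) →
    (α ∘₂ β) ▷₂ A = (α ▷₂ A) ∘₂ (β ▷₂ A)
  -- unit laws
  I_tens : ∀ (A : C.Obj), C.I ⊗₀ A = A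
  tens_I : ∀ (A : C.Obj), A ⊗₀ C.I = A
  I_ltens : ∀ (f : C.Mor), C.I ◁₁ f = f
  rtens_I : ∀ (f : C.Mor), f ▷₁ C.I = f
  I_ltensc : ∀ (α : C.Cell), C.I ◁₂ α = α
  rtensc_I : ∀ (α : C.Cell), α ▷₂ C.I = α
  -- associativity laws
  tens_assoc : ∀ (A B X : C.Obj), (A ⊗₀ B) ⊗₀ X = A ⊗₀ (B ⊗₀ X)
  ltens_ltens : ∀ (A B : C.Obj) (f : C.Mor), (A ⊗₀ B) ◁₁ f = A ◁₁ (B ◁₁ f)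
  ltens_rtens : ∀ (A : C.Obj) (f : C.Mor) (B : C.Obj), (A ◁₁ f) ▷₁ B = A ◁₁ (f ▷₁ B)
  rtens_rtens : ∀ (f : C.Mor) (A B : C.Obj), (f ▷₁ A) ▷₁ B = f ▷₁ (A ⊗₀ B)
  ltensc_ltensc : ∀ (A B : C.Obj) (α : C.Cell), (A ⊗₀ B) ◁₂ α = A ◁₂ (B ◁₂ α)
  ltensc_rtensc : ∀ (A : C.Obj) (α : C.Cell) (B : C.Obj), (A ◁₂ α) ▷₂ B = A ◁₂ (α ▷₂ B)
  rtensc_rtensc : ∀ (α : C.Cell) (A B : C.Obj), (α ▷₂ A) ▷₂ B = α ▷₂ (A ⊗₀ B)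
  -- the tensorator
  dom_tor : ∀ (f g : C.Mor), C.dom (C.tor f g) = (f ▷₁ C.src g) ⬝₁ (C.tgt f ◁₁ g)
  cod_tor : ∀ (f g : C.Mor), C.cod (C.tor f g) = (C.src f ◁₁ g) ⬝₁ (f ▷₁ C.tgt g)
  tor_invertible : ∀ (f g : C.Mor), C.IsInvertible (C.tor f g)
  tor_natural : ∀ (α β : C.Cell),
    ((α ▷₂ C.src (C.dom β)) ∘₂ (C.tgt (C.dom α) ◁₂ β)) ⬝₂ C.tor (C.cod α) (C.cod β) =
      C.tor (C.dom α) (C.dom β) ⬝₂ ((C.src (C.dom α) ◁₂ β) ∘₂ (α ▷₂ C.tgt (C.dom β)))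
  tor_ltens : ∀ (A : C.Obj) (f g : C.Mor), C.tor (A ◁₁ f) g = A ◁₂ C.tor f g
  tor_middle : ∀ (f : C.Mor) (A : C.Obj) (g : C.Mor), C.tor (f ▷₁ A) g = C.tor f (A ◁₁ g)
  tor_rtens : ∀ (f g : C.Mor) (A : C.Obj), C.tor f (g ▷₁ A) = C.tor f g ▷₂ A
  tor_one_left : ∀ (A : C.Obj) (g : C.Mor), C.tor (C.one A) g = C.idc (A ◁₁ g)
  tor_one_right : ∀ (f : C.Mor) (A : C.Obj), C.tor f (C.one A) = C.idc (f ▷₁ A)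
  tor_comp_left : ∀ (f f' g : C.Mor), C.tgt f = C.src f' →
    C.tor (f ⬝₁ f') g =
      (C.idc (f ▷₁ C.src g) ∘₂ C.tor f' g) ⬝₂ (C.tor f g ∘₂ C.idc (f' ▷₁ C.tgt g))
  tor_comp_right : ∀ (f g g' : C.Mor), C.tgt g = C.src g' →
    C.tor f (g ⬝₁ g') =
      (C.tor f g ∘₂ C.idc (C.tgt f ◁₁ g')) ⬝₂ (C.idc (C.src f ◁₁ g) ∘₂ C.tor f g')

/-- Semi-strict monoidal 2-categories: tensoring with an object on either side is a strict
2-functor, these 2-functors are strictly associative and unital, and for `f : A → A'`, `g : B → B'`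
there is an invertible tensorator `⊗_{f,g} : (f ⊗ B)(A' ⊗ g) ⇒ (A ⊗ g)(f ⊗ B')`, natural and
compatible with the tensor product and with composition. -/
structure MonTwoCat extends MonTwoCatData.{u, v, w} where
  monLaws : MonTwoCatLaws toMonTwoCatData

/-! # Duals -/

/-- The data of duals in a semi-strict monoidal 2-category. -/
structure DualTwoCatData extends MonTwoCat.{u, v, w} where
  /-- the dual `A*` of an object -/
  dual0 : Obj → Obj
  /-- the dual `f* : B → A` of a 1-morphism `f : A → B` -/
  dual1 : Mor → Mor
  /-- the dual `α* : g ⇒ f` of a 2-morphism `α : f ⇒ g` -/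
  dual2 : Cell → Cell
  /-- the unit `i_A : I → A ⊗ A*` of an object -/
  unit0 : Obj → Mor
  /-- the counit `e_A : A* ⊗ A → I` of an object -/
  counit0 : Obj → Mor
  /-- the unit `i_f : 1_A ⇒ ff*` of a 1-morphism -/
  unit1 : Mor → Cell
  /-- the counit `e_f : f*f ⇒ 1_B` of a 1-morphism -/
  counit1 : Mor → Cell
  /-- the triangulator `T_A : (i_A ⊗ A)(A ⊗ e_A) ⇒ 1_A` -/
  triang : Obj → Cell

local postfix:max "⁎₀" => DualTwoCatData.dual0 _
local postfix:max "⁎₁" => DualTwoCatData.dual1 _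
local postfix:max "⁎₂" => DualTwoCatData.dual2 _

/-- A 2-morphism `α` is unitary if it is invertible with inverse `α*`. -/
def DualTwoCatData.IsUnitary (C : DualTwoCatData.{u, v, w}) (α : C.Cell) : Prop :=
  C.IsCell α⁎₂ (C.cod α) (C.dom α) ∧
    α ⬝₂ α⁎₂ = C.idc (C.dom α) ∧ α⁎₂ ⬝₂ α = C.idc (C.cod α)

/-- The adjoint `α† = (g* ∘ i_f) · (g* ∘ α ∘ f*) · (e_g ∘ f*) : g* ⇒ f*` of `α : f ⇒ g`. -/
def DualTwoCatData.adj (C : DualTwoCatData.{u, v, w}) (α : C.Cell) : C.Cell :=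
  (C.idc (C.cod α)⁎₁ ∘₂ C.unit1 (C.dom α)) ⬝₂
  (C.idc (C.cod α)⁎₁ ∘₂ α ∘₂ C.idc (C.dom α)⁎₁) ⬝₂
  (C.counit1 (C.cod α) ∘₂ C.idc (C.dom α)⁎₁)

/-- The left adjoint `†α = (i_{f*} ∘ g*) · (f* ∘ α ∘ g*) · (f* ∘ e_{g*}) : g* ⇒ f*` of
`α : f ⇒ g`. -/
def DualTwoCatData.ladj (C : DualTwoCatData.{u, v, w}) (α : C.Cell) : C.Cell :=
  (C.unit1 (C.dom α)⁎₁ ∘₂ C.idc (C.cod α)⁎₁) ⬝₂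
  (C.idc (C.dom α)⁎₁ ∘₂ α ∘₂ C.idc (C.cod α)⁎₁) ⬝₂
  (C.idc (C.dom α)⁎₁ ∘₂ C.counit1 (C.cod α)⁎₁)

/-- The axioms of `DualTwoCat`. -/
structure DualTwoCatLaws (C : DualTwoCatData.{u, v, w}) : Prop where
  -- sources and targets
  src_dual1 : ∀ (f : C.Mor), C.src f⁎₁ = C.tgt f
  tgt_dual1 : ∀ (f : C.Mor), C.tgt f⁎₁ = C.src f
  dom_dual2 : ∀ (α : C.Cell), C.dom α⁎₂ = C.cod α
  cod_dual2 : ∀ (α : C.Cell), C.cod α⁎₂ = C.dom α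
  src_unit0 : ∀ (A : C.Obj), C.src (C.unit0 A) = C.I
  tgt_unit0 : ∀ (A : C.Obj), C.tgt (C.unit0 A) = A ⊗₀ A⁎₀
  src_counit0 : ∀ (A : C.Obj), C.src (C.counit0 A) = A⁎₀ ⊗₀ A
  tgt_counit0 : ∀ (A : C.Obj), C.tgt (C.counit0 A) = C.I
  dom_unit1 : ∀ (f : C.Mor), C.dom (C.unit1 f) = C.one (C.src f)
  cod_unit1 : ∀ (f : C.Mor), C.cod (C.unit1 f) = f ⬝₁ f⁎₁
  dom_counit1 : ∀ (f : C.Mor), C.dom (C.counit1 f) = f⁎₁ ⬝₁ f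
  cod_counit1 : ∀ (f : C.Mor), C.cod (C.counit1 f) = C.one (C.tgt f)
  dom_triang : ∀ (A : C.Obj), C.dom (C.triang A) = (C.unit0 A ▷₁ A) ⬝₁ (A ◁₁ C.counit0 A)
  cod_triang : ∀ (A : C.Obj), C.cod (C.triang A) = C.one A
  -- 1. duality is involutive
  dual0_dual0 : ∀ (A : C.Obj), A⁎₀⁎₀ = A
  dual1_dual1 : ∀ (f : C.Mor), f⁎₁⁎₁ = f
  dual2_dual2 : ∀ (α : C.Cell), α⁎₂⁎₂ = α
  -- 2. identities
  dual1_one : ∀ (A : C.Obj), (C.one A)⁎₁ = C.one A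
  dual2_idc : ∀ (f : C.Mor), (C.idc f)⁎₂ = C.idc f
  -- 3. compatibility with compositions and tensor products
  dual2_vcomp : ∀ (α β : C.Cell), C.cod α = C.dom β → (α ⬝₂ β)⁎₂ = β⁎₂ ⬝₂ α⁎₂
  dual2_hcomp : ∀ (α β : C.Cell), C.tgt (C.dom α) = C.src (C.dom β) → (α ∘₂ β)⁎₂ = α⁎₂ ∘₂ β⁎₂
  dual1_comp : ∀ (f g : C.Mor), C.tgt f = C.src g → (f ⬝₁ g)⁎₁ = g⁎₁ ⬝₁ f⁎₁
  dual2_ltensc : ∀ (A : C.Obj) (α : C.Cell), (A ◁₂ α)⁎₂ = A ◁₂ α⁎₂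
  dual1_ltens : ∀ (A : C.Obj) (f : C.Mor), (A ◁₁ f)⁎₁ = A ◁₁ f⁎₁
  dual2_rtensc : ∀ (α : C.Cell) (A : C.Obj), (α ▷₂ A)⁎₂ = α⁎₂ ▷₂ A
  dual1_rtens : ∀ (f : C.Mor) (A : C.Obj), (f ▷₁ A)⁎₁ = f⁎₁ ▷₁ A
  dual0_tens : ∀ (A B : C.Obj), (A ⊗₀ B)⁎₀ = B⁎₀ ⊗₀ A⁎₀
  -- 4. the tensorator is unitary
  tor_unitary : ∀ (f g : C.Mor), C.IsUnitary (C.tor f g)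
  -- 5. units and counits of duals
  unit0_dual : ∀ (A : C.Obj), C.unit0 A⁎₀ = (C.counit0 A)⁎₁
  counit0_dual : ∀ (A : C.Obj), C.counit0 A⁎₀ = (C.unit0 A)⁎₁
  unit1_dual : ∀ (f : C.Mor), C.unit1 f⁎₁ = (C.counit1 f)⁎₂
  counit1_dual : ∀ (f : C.Mor), C.counit1 f⁎₁ = (C.unit1 f)⁎₂
  -- 6. the triangulator is unitary
  triang_unitary : ∀ (A : C.Obj), C.IsUnitary (C.triang A)
  -- 7. units, counits and triangulators of tensor products
  unit0_tens : ∀ (A B : C.Obj), C.unit0 (A ⊗₀ B) = C.unit0 A ⬝₁ (A ◁₁ C.unit0 B ▷₁ A⁎₀)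
  counit0_tens : ∀ (A B : C.Obj), C.counit0 (A ⊗₀ B) = (B⁎₀ ◁₁ C.counit0 A ▷₁ B) ⬝₁ C.counit0 B
  triang_tens : ∀ (A B : C.Obj), C.triang (A ⊗₀ B) =
    (C.idc (C.unit0 A ▷₁ (A ⊗₀ B)) ∘₂ (A ◁₂ C.tor (C.unit0 B) (C.counit0 A) ▷₂ B) ∘₂
      C.idc ((A ⊗₀ B) ◁₁ C.counit0 B)) ⬝₂
    ((C.triang A ▷₂ B) ∘₂ (A ◁₂ C.triang B))
  -- 8. the triangulator of the identity object
  triang_I : C.triang C.I = C.idc (C.one C.I)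
  -- 9. units and counits of tensor products of objects and 1-morphisms
  unit1_ltens : ∀ (A : C.Obj) (f : C.Mor), C.unit1 (A ◁₁ f) = A ◁₂ C.unit1 f
  unit1_rtens : ∀ (f : C.Mor) (A : C.Obj), C.unit1 (f ▷₁ A) = C.unit1 f ▷₂ A
  counit1_ltens : ∀ (A : C.Obj) (f : C.Mor), C.counit1 (A ◁₁ f) = A ◁₂ C.counit1 f
  counit1_rtens : ∀ (f : C.Mor) (A : C.Obj), C.counit1 (f ▷₁ A) = C.counit1 f ▷₂ A
  -- 10. units and counits of composites
  unit1_comp : ∀ (f g : C.Mor), C.tgt f = C.src g →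
    C.unit1 (f ⬝₁ g) = C.unit1 f ⬝₂ (C.idc f ∘₂ C.unit1 g ∘₂ C.idc f⁎₁)
  counit1_comp : ∀ (f g : C.Mor), C.tgt f = C.src g →
    C.counit1 (f ⬝₁ g) = (C.idc g⁎₁ ∘₂ C.counit1 f ∘₂ C.idc g) ⬝₂ C.counit1 g
  -- 11. the triangle identities for 1-morphisms
  zigzag : ∀ (f : C.Mor), (C.unit1 f ∘₂ C.idc f) ⬝₂ (C.idc f ∘₂ C.counit1 f) = C.idc f
  zigzag' : ∀ (f : C.Mor), (C.idc f⁎₁ ∘₂ C.unit1 f) ⬝₂ (C.counit1 f ∘₂ C.idc f⁎₁) = C.idc f⁎₁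
  -- 12. duals and adjoints commute
  dual2_adj : ∀ (α : C.Cell), (C.adj α)⁎₂ = C.adj α⁎₂
  -- 13. the coherence law of the triangulator
  swallowtail : ∀ (A : C.Obj),
    (C.idc (C.unit0 A) ∘₂ (A ◁₂ C.adj (C.triang A⁎₀))) ⬝₂
    (C.tor (C.unit0 A) (C.unit0 A) ∘₂ C.idc (A ◁₁ C.counit0 A ▷₁ A⁎₀)) ⬝₂
    (C.idc (C.unit0 A) ∘₂ (C.triang A ▷₂ A⁎₀)) = C.idc (C.unit0 A)

/-- Semi-strict monoidal 2-categories with duals. -/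
structure DualTwoCat extends DualTwoCatData.{u, v, w} where
  dualLaws : DualTwoCatLaws toDualTwoCatData

/-! # Pivotal and spherical structures

Inverses of the unitary 2-morphisms `T_A`, `⊗_{f,g}`, `φ_f` are written as duals. -/

namespace DualTwoCat

/-- `#f = (i_{A*} ⊗ B*)(A* ⊗ f ⊗ B*)(A* ⊗ e_{B*}) : B* → A*` for `f : A → B`. -/
def lsharp (C : DualTwoCat.{u, v, w}) (f : C.Mor) : C.Mor :=
  (C.unit0 (C.src f)⁎₀ ▷₁ (C.tgt f)⁎₀) ⬝₁
  ((C.src f)⁎₀ ◁₁ f ▷₁ (C.tgt f)⁎₀) ⬝₁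
  ((C.src f)⁎₀ ◁₁ C.counit0 (C.tgt f)⁎₀)

/-- `f# = (B* ⊗ i_A)(B* ⊗ f ⊗ A*)(e_B ⊗ A*) : B* → A*` for `f : A → B`. -/
def rsharp (C : DualTwoCat.{u, v, w}) (f : C.Mor) : C.Mor :=
  ((C.tgt f)⁎₀ ◁₁ C.unit0 (C.src f)) ⬝₁
  ((C.tgt f)⁎₀ ◁₁ f ▷₁ (C.src f)⁎₀) ⬝₁
  (C.counit0 (C.tgt f) ▷₁ (C.src f)⁎₀)

/-- `#α : #f ⇒ #g` for `α : f ⇒ g`. -/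
def lsharpc (C : DualTwoCat.{u, v, w}) (α : C.Cell) : C.Cell :=
  C.idc (C.unit0 (C.src (C.dom α))⁎₀ ▷₁ (C.tgt (C.dom α))⁎₀) ∘₂
  ((C.src (C.dom α))⁎₀ ◁₂ α ▷₂ (C.tgt (C.dom α))⁎₀) ∘₂
  C.idc ((C.src (C.dom α))⁎₀ ◁₁ C.counit0 (C.tgt (C.dom α))⁎₀)

/-- `α# : f# ⇒ g#` for `α : f ⇒ g`. -/
def rsharpc (C : DualTwoCat.{u, v, w}) (α : C.Cell) : C.Cell :=
  C.idc ((C.tgt (C.dom α))⁎₀ ◁₁ C.unit0 (C.src (C.dom α))) ∘₂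
  ((C.tgt (C.dom α))⁎₀ ◁₂ α ▷₂ (C.src (C.dom α))⁎₀) ∘₂
  C.idc (C.counit0 (C.tgt (C.dom α)) ▷₁ (C.src (C.dom α))⁎₀)

/-- The canonical unitary 2-morphism `#(fg) ⇒ #g #f`, for `f : X → Y` and `g : Y → Z`. -/
def lsharpComp (C : DualTwoCat.{u, v, w}) (f g : C.Mor) : C.Cell :=
  let X := C.src f
  let Y := C.src g
  let Z := C.tgt g
  (C.idc ((C.unit0 X⁎₀ ▷₁ Z⁎₀) ⬝₁ (X⁎₀ ◁₁ f ▷₁ Z⁎₀)) ∘₂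
    (X⁎₀ ◁₂ C.adj (C.triang Y) ▷₂ Z⁎₀) ∘₂
    C.idc ((X⁎₀ ◁₁ g ▷₁ Z⁎₀) ⬝₁ (X⁎₀ ◁₁ C.counit0 Z⁎₀))) ⬝₂
  (C.idc ((C.unit0 X⁎₀ ▷₁ Z⁎₀) ⬝₁ (X⁎₀ ◁₁ f ▷₁ Z⁎₀) ⬝₁
      (X⁎₀ ◁₁ Y ◁₁ C.unit0 Y⁎₀ ▷₁ Z⁎₀)) ∘₂
    (X⁎₀ ◁₂ C.tor (C.counit0 Y⁎₀) g ▷₂ Z⁎₀) ∘₂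
    C.idc (X⁎₀ ◁₁ C.counit0 Z⁎₀)) ⬝₂
  (C.tor (C.unit0 X⁎₀ ⬝₁ (X⁎₀ ◁₁ f)) ((C.unit0 Y⁎₀ ▷₁ Z⁎₀) ⬝₁ (Y⁎₀ ◁₁ g ▷₁ Z⁎₀)) ∘₂
    C.idc ((X⁎₀ ◁₁ C.counit0 Y⁎₀ ▷₁ (Z ⊗₀ Z⁎₀)) ⬝₁ (X⁎₀ ◁₁ C.counit0 Z⁎₀))) ⬝₂
  (C.idc ((C.unit0 Y⁎₀ ▷₁ Z⁎₀) ⬝₁ (Y⁎₀ ◁₁ g ▷₁ Z⁎₀)) ∘₂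
    C.tor (C.lsharp f) (C.counit0 Z⁎₀))

/-- The canonical unitary 2-morphism `(fg)# ⇒ g# f#`, for `f : X → Y` and `g : Y → Z`. -/
def rsharpComp (C : DualTwoCat.{u, v, w}) (f g : C.Mor) : C.Cell :=
  let X := C.src f
  let Y := C.src g
  let Z := C.tgt g
  (C.idc ((Z⁎₀ ◁₁ C.unit0 X) ⬝₁ (Z⁎₀ ◁₁ f ▷₁ X⁎₀)) ∘₂
    (Z⁎₀ ◁₂ (C.triang Y)⁎₂ ▷₂ X⁎₀) ∘₂
    C.idc ((Z⁎₀ ◁₁ g ▷₁ X⁎₀) ⬝₁ (C.counit0 Z ▷₁ X⁎₀))) ⬝₂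
  (C.idc ((Z⁎₀ ◁₁ C.unit0 X) ⬝₁ (Z⁎₀ ◁₁ f ▷₁ X⁎₀) ⬝₁
      (Z⁎₀ ◁₁ C.unit0 Y ▷₁ (Y ⊗₀ X⁎₀))) ∘₂
    (Z⁎₀ ◁₂ (C.tor g (C.counit0 Y))⁎₂ ▷₂ X⁎₀) ∘₂
    C.idc (C.counit0 Z ▷₁ X⁎₀)) ⬝₂
  ((C.tor ((Z⁎₀ ◁₁ C.unit0 Y) ⬝₁ (Z⁎₀ ◁₁ g ▷₁ Y⁎₀)) (C.unit0 X ⬝₁ (f ▷₁ X⁎₀)))⁎₂ ∘₂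
    C.idc ((Z⁎₀ ◁₁ Z ◁₁ C.counit0 Y ▷₁ X⁎₀) ⬝₁ (C.counit0 Z ▷₁ X⁎₀))) ⬝₂
  (C.idc ((Z⁎₀ ◁₁ C.unit0 Y) ⬝₁ (Z⁎₀ ◁₁ g ▷₁ Y⁎₀)) ∘₂
    (C.tor (C.counit0 Z) (C.rsharp f))⁎₂)

/-- The left trace `Tr_L(f) = i_{A*}(A* ⊗ f)e_A : I → I` of `f : A → A`. -/
def trL (C : DualTwoCat.{u, v, w}) (f : C.Mor) : C.Mor :=
  C.unit0 (C.src f)⁎₀ ⬝₁ ((C.src f)⁎₀ ◁₁ f) ⬝₁ C.counit0 (C.src f)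

/-- The right trace `Tr_R(f) = i_A(f ⊗ A*)e_{A*} : I → I` of `f : A → A`. -/
def trR (C : DualTwoCat.{u, v, w}) (f : C.Mor) : C.Mor :=
  C.unit0 (C.src f) ⬝₁ (f ▷₁ (C.src f)⁎₀) ⬝₁ C.counit0 (C.src f)⁎₀

/-- The left trace functor on 2-morphisms. -/
def trLc (C : DualTwoCat.{u, v, w}) (α : C.Cell) : C.Cell :=
  C.idc (C.unit0 (C.src (C.dom α))⁎₀) ∘₂ ((C.src (C.dom α))⁎₀ ◁₂ α) ∘₂
    C.idc (C.counit0 (C.src (C.dom α)))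

/-- The right trace functor on 2-morphisms. -/
def trRc (C : DualTwoCat.{u, v, w}) (α : C.Cell) : C.Cell :=
  C.idc (C.unit0 (C.src (C.dom α))) ∘₂ (α ▷₂ (C.src (C.dom α))⁎₀) ∘₂
    C.idc (C.counit0 (C.src (C.dom α))⁎₀)

/-- The right cap `1_I ⇒ Tr_R(ff*)`, for `f : A → B`. -/
def capR (C : DualTwoCat.{u, v, w}) (f : C.Mor) : C.Cell :=
  C.unit1 (C.unit0 (C.src f) ⬝₁ (f ▷₁ (C.src f)⁎₀))

/-- The right cup `Tr_R(ff*) ⇒ 1_I`, for `f : A → B`. -/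
def cupR (C : DualTwoCat.{u, v, w}) (f : C.Mor) : C.Cell := (C.capR f)⁎₂

/-- The left cap `1_I ⇒ Tr_L(ff*)`, for `f : A → B`. -/
def capL (C : DualTwoCat.{u, v, w}) (f : C.Mor) : C.Cell :=
  C.unit1 (C.unit0 (C.src f)⁎₀ ⬝₁ ((C.src f)⁎₀ ◁₁ f))

/-- The left cup `Tr_L(ff*) ⇒ 1_I`, for `f : A → B`. -/
def cupL (C : DualTwoCat.{u, v, w}) (f : C.Mor) : C.Cell := (C.capL f)⁎₂

end DualTwoCat

/-- The data of a pivotal structure: 2-morphisms `φ_f : #f ⇒ f#`. -/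
structure PivotalTwoCatData extends DualTwoCat.{u, v, w} where
  /-- the pivotal 2-morphisms -/
  piv : Mor → Cell

/-- The axioms of `PivotalTwoCat`. -/
structure PivotalTwoCatLaws (C : PivotalTwoCatData.{u, v, w}) : Prop where
  dom_piv : ∀ (f : C.Mor), C.dom (C.piv f) = C.lsharp f
  cod_piv : ∀ (f : C.Mor), C.cod (C.piv f) = C.rsharp f
  piv_unitary : ∀ (f : C.Mor), C.IsUnitary (C.piv f)
  piv_natural : ∀ (α : C.Cell),
    C.lsharpc α ⬝₂ C.piv (C.cod α) = C.piv (C.dom α) ⬝₂ C.rsharpc α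
  piv_adj : ∀ (f : C.Mor), C.adj (C.piv f) = C.piv f⁎₁
  piv_comp : ∀ (f g : C.Mor), C.tgt f = C.src g →
    C.piv (f ⬝₁ g) ⬝₂ C.rsharpComp f g =
      C.lsharpComp f g ⬝₂ (C.piv g ∘₂ C.piv f)
  lsharpc_adj : ∀ (α : C.Cell), C.lsharpc (C.adj α) = C.ladj (C.rsharpc α)
  rsharpc_ladj : ∀ (α : C.Cell), C.adj (C.lsharpc α) = C.rsharpc (C.ladj α)

/-- Semi-strict pivotal 2-categories: unitary `φ_f : #f ⇒ f#` for all 1-morphisms `f`, natural,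
compatible with adjoints and with composition. -/
structure PivotalTwoCat extends PivotalTwoCatData.{u, v, w} where
  pivLaws : PivotalTwoCatLaws toPivotalTwoCatData

namespace PivotalTwoCat

/-- The unitary 2-morphism `θ^R_{f,g} : Tr_R(fg) ⇒ Tr_R(gf)`, for `f : A → B` and `g : B → A`. -/
def thetaR (C : PivotalTwoCat.{u, v, w}) (f g : C.Mor) : C.Cell :=
  let A := C.src f
  let B := C.src g
  (C.idc (C.unit0 A ⬝₁ (f ▷₁ A⁎₀)) ∘₂ (C.adj (C.triang B) ▷₂ A⁎₀) ∘₂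
    C.idc ((g ▷₁ A⁎₀) ⬝₁ C.counit0 A⁎₀)) ⬝₂
  (C.idc (C.unit0 A ⬝₁ (f ▷₁ A⁎₀) ⬝₁ (B ◁₁ C.unit0 B⁎₀ ▷₁ A⁎₀)) ∘₂
    C.tor (C.counit0 B⁎₀) ((g ▷₁ A⁎₀) ⬝₁ C.counit0 A⁎₀)) ⬝₂
  (C.idc (C.unit0 A ⬝₁ (f ▷₁ A⁎₀)) ∘₂ (B ◁₂ C.piv g) ∘₂ C.idc (C.counit0 B⁎₀)) ⬝₂
  (C.tor (C.unit0 A ⬝₁ (f ▷₁ A⁎₀)) (C.unit0 B ⬝₁ (g ▷₁ B⁎₀)) ∘₂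
    C.idc ((B ◁₁ C.counit0 A ▷₁ B⁎₀) ⬝₁ C.counit0 B⁎₀)) ⬝₂
  (C.idc (C.unit0 B ⬝₁ (g ▷₁ B⁎₀) ⬝₁ (C.unit0 A ▷₁ (A ⊗₀ B⁎₀))) ∘₂
    (C.tor f (C.counit0 A) ▷₂ B⁎₀) ∘₂ C.idc (C.counit0 B⁎₀)) ⬝₂
  (C.idc (C.unit0 B ⬝₁ (g ▷₁ B⁎₀)) ∘₂ (C.triang A ▷₂ B⁎₀) ∘₂
    C.idc ((f ▷₁ B⁎₀) ⬝₁ C.counit0 B⁎₀))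

/-- The unitary 2-morphism `θ^L_{f,g} : Tr_L(fg) ⇒ Tr_L(gf)`, for `f : A → B` and `g : B → A`:
the mirror image of `θ^R` under reversal of the tensor product. -/
def thetaL (C : PivotalTwoCat.{u, v, w}) (f g : C.Mor) : C.Cell :=
  let A := C.src f
  let B := C.src g
  (C.idc (C.unit0 A⁎₀ ⬝₁ (A⁎₀ ◁₁ f)) ∘₂ (A⁎₀ ◁₂ (C.triang B)⁎₂) ∘₂
    C.idc ((A⁎₀ ◁₁ g) ⬝₁ C.counit0 A)) ⬝₂
  (C.idc (C.unit0 A⁎₀ ⬝₁ (A⁎₀ ◁₁ f) ⬝₁ (A⁎₀ ◁₁ C.unit0 B ▷₁ B)) ∘₂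
    (C.tor ((A⁎₀ ◁₁ g) ⬝₁ C.counit0 A) (C.counit0 B))⁎₂) ⬝₂
  (C.idc (C.unit0 A⁎₀ ⬝₁ (A⁎₀ ◁₁ f)) ∘₂ ((C.piv g)⁎₂ ▷₂ B) ∘₂ C.idc (C.counit0 B)) ⬝₂
  ((C.tor (C.unit0 B⁎₀ ⬝₁ (B⁎₀ ◁₁ g)) (C.unit0 A⁎₀ ⬝₁ (A⁎₀ ◁₁ f)))⁎₂ ∘₂
    C.idc ((B⁎₀ ◁₁ C.counit0 A⁎₀ ▷₁ B) ⬝₁ C.counit0 B)) ⬝₂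
  (C.idc (C.unit0 B⁎₀ ⬝₁ (B⁎₀ ◁₁ g) ⬝₁ (B⁎₀ ◁₁ A ◁₁ C.unit0 A⁎₀)) ∘₂
    (B⁎₀ ◁₂ (C.tor (C.counit0 A⁎₀) f)⁎₂) ∘₂ C.idc (C.counit0 B)) ⬝₂
  (C.idc (C.unit0 B⁎₀ ⬝₁ (B⁎₀ ◁₁ g)) ∘₂ (B⁎₀ ◁₂ (C.adj (C.triang A))⁎₂) ∘₂
    C.idc ((B⁎₀ ◁₁ f) ⬝₁ C.counit0 B))

/-- Consistency of a pivotal 2-category: `θ` is compatible with caps and cups. -/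
structure Consistent (C : PivotalTwoCat.{u, v, w}) : Prop where
  capR_thetaR : ∀ f, C.capR f ⬝₂ C.thetaR f f⁎₁ = C.capR f⁎₁
  thetaR_cupR : ∀ f, C.thetaR f f⁎₁ ⬝₂ C.cupR f⁎₁ = C.cupR f
  capL_thetaL : ∀ f, C.capL f ⬝₂ C.thetaL f f⁎₁ = C.capL f⁎₁
  thetaL_cupL : ∀ f, C.thetaL f f⁎₁ ⬝₂ C.cupL f⁎₁ = C.cupL f

end PivotalTwoCat

/-- The data of a spherical structure: 2-morphisms `σ_f : Tr_L(f) ⇒ Tr_R(f)`. -/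
structure SphericalTwoCatData extends PivotalTwoCat.{u, v, w} where
  /-- the spherical 2-morphisms -/
  sph : Mor → Cell

/-- The axioms of `SphericalTwoCat`. -/
structure SphericalTwoCatLaws (C : SphericalTwoCatData.{u, v, w}) : Prop where
  consistent : C.Consistent
  dom_sph : ∀ (f : C.Mor), C.src f = C.tgt f → C.dom (C.sph f) = C.trL f
  cod_sph : ∀ (f : C.Mor), C.src f = C.tgt f → C.cod (C.sph f) = C.trR f
  sph_unitary : ∀ (f : C.Mor), C.src f = C.tgt f → C.IsUnitary (C.sph f)
  sph_natural : ∀ (α : C.Cell), C.src (C.dom α) = C.tgt (C.dom α) →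
    C.sph (C.dom α) ⬝₂ C.trRc α = C.trLc α ⬝₂ C.sph (C.cod α)
  capL_sph : ∀ (A : C.Obj), C.capL (C.one A) ⬝₂ C.sph (C.one A) = C.capR (C.one A)
  sph_cupR : ∀ (A : C.Obj), C.sph (C.one A) ⬝₂ C.cupR (C.one A) = C.cupL (C.one A)

/-- Semi-strict spherical 2-categories: consistent pivotal, with natural unitary
`σ_f : Tr_L(f) ⇒ Tr_R(f)` for endo-1-morphisms `f`, compatible with caps and cups. -/
structure SphericalTwoCat extends SphericalTwoCatData.{u, v, w} where
  sphLaws : SphericalTwoCatLaws toSphericalTwoCatData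

/-! # Hom-categories and equivalence of objects -/

namespace TwoCat

/-- The objects of the category `Hom(A, B)`: 1-morphisms from `A` to `B`. -/
@[ext] structure Hom1 (C : TwoCat.{u, v, w}) (A B : C.Obj) : Type v where
  /-- the underlying 1-morphism -/
  mor : C.Mor
  isMor : C.IsMor mor A B

/-- The morphisms of `Hom(A, B)`: 2-morphisms from `f` to `g`. -/
@[ext] structure Hom2 (C : TwoCat.{u, v, w}) {A B : C.Obj} (f g : C.Hom1 A B) : Type w where
  /-- the underlying 2-morphism -/
  cell : C.Cell
  isCell : C.IsCell cell f.mor g.mor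

/-- The category `Hom(A, B)`, under vertical composition. -/
instance (C : TwoCat.{u, v, w}) (A B : C.Obj) : Category.{w} (C.Hom1 A B) where
  Hom f g := C.Hom2 f g
  id f := ⟨C.idc f.mor, C.laws.dom_idc _, C.laws.cod_idc _⟩
  comp {f g h} α β := ⟨α.cell ⬝₂ β.cell, by
    have hh : C.cod α.cell = C.dom β.cell := α.isCell.2.trans β.isCell.1.symm
    exact ⟨(C.laws.dom_vcomp _ _ hh).trans α.isCell.1, (C.laws.cod_vcomp _ _ hh).trans β.isCell.2⟩⟩
  id_comp {f g} α := Hom2.ext (by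
    have := C.laws.idc_vcomp α.cell
    rwa [α.isCell.1] at this)
  comp_id {f g} α := Hom2.ext (by
    have := C.laws.vcomp_idc α.cell
    rwa [α.isCell.2] at this)
  assoc {f g h k} α β γ := Hom2.ext (C.laws.vcomp_assoc _ _ _
    (α.isCell.2.trans β.isCell.1.symm) (β.isCell.2.trans γ.isCell.1.symm))

/-- The underlying cell of a morphism of `Hom(A, B)`. -/
def cellOf (C : TwoCat.{u, v, w}) {A B : C.Obj} {f g : C.Hom1 A B} (α : f ⟶ g) : C.Cell :=
  Hom2.cell α

/-- The identity 1-morphism as an object of `End(A) = Hom(A, A)`. -/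
def one1 (C : TwoCat.{u, v, w}) (A : C.Obj) : C.Hom1 A A := ⟨C.one A, C.laws.src_one A, C.laws.tgt_one A⟩

/-- Composition of 1-morphisms, `Hom(A, B) × Hom(B, D) → Hom(A, D)` on objects. -/
def comp1 (C : TwoCat.{u, v, w}) {A B D : C.Obj} (f : C.Hom1 A B) (g : C.Hom1 B D) :
    C.Hom1 A D :=
  ⟨f.mor ⬝₁ g.mor, by
    have hh : C.tgt f.mor = C.src g.mor := f.isMor.2.trans g.isMor.1.symm
    exact ⟨(C.laws.src_comp _ _ hh).trans f.isMor.1, (C.laws.tgt_comp _ _ hh).trans g.isMor.2⟩⟩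

/-- Horizontal composition, `Hom(A, B) × Hom(B, D) → Hom(A, D)` on morphisms. -/
def comp2 (C : TwoCat.{u, v, w}) {A B D : C.Obj} {f f' : C.Hom1 A B} {g g' : C.Hom1 B D}
    (α : f ⟶ f') (β : g ⟶ g') : C.comp1 f g ⟶ C.comp1 f' g' :=
  Hom2.mk (C.cellOf α ∘₂ C.cellOf β) (by
    have h1 : C.IsCell (C.cellOf α) f.mor f'.mor := Hom2.isCell α
    have h2 : C.IsCell (C.cellOf β) g.mor g'.mor := Hom2.isCell β
    have hh : C.tgt (C.dom (C.cellOf α)) = C.src (C.dom (C.cellOf β)) := by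
      rw [h1.1, h2.1]; exact f.isMor.2.trans g.isMor.1.symm
    refine ⟨(C.laws.dom_hcomp _ _ hh).trans ?_, (C.laws.cod_hcomp _ _ hh).trans ?_⟩
    · rw [h1.1, h2.1]; rfl
    · rw [h1.2, h2.2]; rfl)

/-- Horizontal composition preserves identities. -/
theorem comp2_id (C : TwoCat.{u, v, w}) {A B D : C.Obj} (f : C.Hom1 A B) (g : C.Hom1 B D) :
    C.comp2 (𝟙 f) (𝟙 g) = 𝟙 (C.comp1 f g) :=
  Hom2.ext (C.laws.idc_hcomp_idc f.mor g.mor (f.isMor.2.trans g.isMor.1.symm))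

/-- Horizontal composition preserves vertical composition. -/
theorem comp2_comp (C : TwoCat.{u, v, w}) {A B D : C.Obj} {f f' f'' : C.Hom1 A B}
    {g g' g'' : C.Hom1 B D} (α : f ⟶ f') (α' : f' ⟶ f'') (β : g ⟶ g') (β' : g' ⟶ g'') :
    C.comp2 (α ≫ α') (β ≫ β') = C.comp2 α β ≫ C.comp2 α' β' :=
  Hom2.ext (C.laws.interchange _ _ _ _
    ((Hom2.isCell α).2.trans (Hom2.isCell α').1.symm)
    ((Hom2.isCell β).2.trans (Hom2.isCell β').1.symm)
    (by rw [(Hom2.isCell α).1, (Hom2.isCell β).1]; exact f.isMor.2.trans g.isMor.1.symm))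

/-- Objects `A` and `B` are equivalent: there are `f : A → B` and `g : B → A` with
`fg ≅ 1_A` and `gf ≅ 1_B`. -/
def Equivalent (C : TwoCat.{u, v, w}) (A B : C.Obj) : Prop :=
  ∃ (f : C.Hom1 A B) (g : C.Hom1 B A),
    Nonempty (C.comp1 f g ≅ C.one1 A) ∧ Nonempty (C.comp1 g f ≅ C.one1 B)

/-- A non-zero object: `End(A)` is not the zero category. -/
def IsNonzeroObj (C : TwoCat.{u, v, w}) (A : C.Obj) : Prop :=
  ∃ f : C.Hom1 A A, ¬ IsZero f

end TwoCat

namespace MonTwoCat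

/-- `X ⊗ f` as an object of `Hom(X ⊗ A, X ⊗ B)`. -/
def ltens1 (C : MonTwoCat.{u, v, w}) (X : C.Obj) {A B : C.Obj} (f : C.Hom1 A B) :
    C.Hom1 (X ⊗₀ A) (X ⊗₀ B) :=
  ⟨X ◁₁ f.mor, by rw [TwoCatData.IsMor, C.monLaws.src_ltens, C.monLaws.tgt_ltens, f.isMor.1, f.isMor.2]; simp⟩

/-- `f ⊗ X` as an object of `Hom(A ⊗ X, B ⊗ X)`. -/
def rtens1 (C : MonTwoCat.{u, v, w}) {A B : C.Obj} (f : C.Hom1 A B) (X : C.Obj) :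
    C.Hom1 (A ⊗₀ X) (B ⊗₀ X) :=
  ⟨f.mor ▷₁ X, by rw [TwoCatData.IsMor, C.monLaws.src_rtens, C.monLaws.tgt_rtens, f.isMor.1, f.isMor.2]; simp⟩

/-- `X ⊗ α` as a morphism of `Hom(X ⊗ A, X ⊗ B)`. -/
def ltens2 (C : MonTwoCat.{u, v, w}) (X : C.Obj) {A B : C.Obj} {f g : C.Hom1 A B} (α : f ⟶ g) :
    C.ltens1 X f ⟶ C.ltens1 X g :=
  TwoCat.Hom2.mk (X ◁₂ C.cellOf α) ⟨(C.monLaws.dom_ltensc _ _).trans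
      (congrArg (C.ltens X) (TwoCat.Hom2.isCell α).1),
    (C.monLaws.cod_ltensc _ _).trans (congrArg (C.ltens X) (TwoCat.Hom2.isCell α).2)⟩

/-- `α ⊗ X` as a morphism of `Hom(A ⊗ X, B ⊗ X)`. -/
def rtens2 (C : MonTwoCat.{u, v, w}) {A B : C.Obj} {f g : C.Hom1 A B} (α : f ⟶ g) (X : C.Obj) :
    C.rtens1 f X ⟶ C.rtens1 g X :=
  TwoCat.Hom2.mk (C.cellOf α ▷₂ X) ⟨(C.monLaws.dom_rtensc _ _).trans
      (congrArg (fun m => C.rtens m X) (TwoCat.Hom2.isCell α).1),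
    (C.monLaws.cod_rtensc _ _).trans (congrArg (fun m => C.rtens m X) (TwoCat.Hom2.isCell α).2)⟩

end MonTwoCat

/-! # 2-vector spaces and Vect-linear 2-categories -/

/-- An `F`-linear category is a 2-vector space of rank `n` if it is `F`-linearly equivalent to
`Vectⁿ`, where `Vect` is the category of finite dimensional `F`-vector spaces. -/
def IsTwoVect (F : Type x) [Field F] (V : Type v) [Category.{w} V] [Preadditive V] [Linear F V]
    (n : ℕ) : Prop :=
  ∃ e : V ≌ (Fin n → FGModuleCat.{x} F), ∀ i,
    (e.functor ⋙ Pi.eval (fun _ : Fin n => FGModuleCat.{x} F) i).Additive ∧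
    (e.functor ⋙ Pi.eval (fun _ : Fin n => FGModuleCat.{x} F) i).Linear F

/-- A 2-vector space has finite biproducts. -/
theorem IsTwoVect.hasFiniteBiproducts {F : Type x} [Field F] {V : Type v} [Category.{w} V]
    [Preadditive V] [Linear F V] {n : ℕ} (h : IsTwoVect F V n) : HasFiniteBiproducts V := by
  obtain ⟨e, -⟩ := h
  have h1 : HasFiniteProducts V := by
    refine ⟨fun k => ?_⟩
    have h2 : HasLimitsOfShape (Discrete (Fin k)) (Fin n → FGModuleCat.{x} F) := by
      have h3 : ∀ X : Fin k → (Fin n → FGModuleCat.{x} F), HasProduct X := fun X =>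
        ⟨⟨⟨Fan.mk (fun i => ∏ᶜ fun j => X j i) (fun j i => Pi.π (fun j => X j i) j),
          Fan.IsLimit.mk _ (fun s i => Pi.lift fun j => s.proj j i)
            (fun s j => by
              funext i
              exact Pi.lift_π (fun j => s.proj j i) j)
            (fun s m hm => by
              funext i
              refine Pi.hom_ext _ _ fun j => ?_
              exact (congrFun (hm j) i).trans (Pi.lift_π (fun j => s.proj j i) j).symm)⟩⟩⟩
      exact ⟨fun G => hasLimit_of_iso (Discrete.natIsoFunctor (F := G)).symm⟩
    exact Adjunction.hasLimitsOfShape_of_equivalence e.functor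
  exact HasFiniteBiproducts.of_hasFiniteProducts

/-- A basis of a 2-vector space: a finite set of simple objects containing exactly one object of
every isomorphism class of simple objects. -/
def IsTwoVectBasis {V : Type v} [Category.{w} V] [Preadditive V] (S : Finset V) : Prop :=
  (∀ f ∈ S, Simple f) ∧ ∀ g : V, Simple g → ∃! f, f ∈ S ∧ Nonempty (f ≅ g)

/-- `Vect`-linear semi-strict monoidal 2-categories over the field `F`: every `Hom(A, B)` is a
2-vector space of finite rank, and composition and tensor product are bilinear. -/
class VectLinear (F : Type x) [Field F] (C : MonTwoCat.{u, v, w})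
    [∀ A B, Preadditive (C.Hom1 A B)] [∀ A B, Linear F (C.Hom1 A B)] : Prop where
  twoVect : ∀ A B, ∃ n, IsTwoVect F (C.Hom1 A B) n
  add_comp2 : ∀ {A B D : C.Obj} {f f' : C.Hom1 A B} {g g' : C.Hom1 B D} (α α' : f ⟶ f')
    (β : g ⟶ g'), C.comp2 (α + α') β = C.comp2 α β + C.comp2 α' β
  comp2_add : ∀ {A B D : C.Obj} {f f' : C.Hom1 A B} {g g' : C.Hom1 B D} (α : f ⟶ f')
    (β β' : g ⟶ g'), C.comp2 α (β + β') = C.comp2 α β + C.comp2 α β'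
  smul_comp2 : ∀ {A B D : C.Obj} {f f' : C.Hom1 A B} {g g' : C.Hom1 B D} (c : F) (α : f ⟶ f')
    (β : g ⟶ g'), C.comp2 (c • α) β = c • C.comp2 α β
  comp2_smul : ∀ {A B D : C.Obj} {f f' : C.Hom1 A B} {g g' : C.Hom1 B D} (c : F) (α : f ⟶ f')
    (β : g ⟶ g'), C.comp2 α (c • β) = c • C.comp2 α β
  ltens2_add : ∀ (X : C.Obj) {A B : C.Obj} {f g : C.Hom1 A B} (α β : f ⟶ g),
    C.ltens2 X (α + β) = C.ltens2 X α + C.ltens2 X β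
  ltens2_smul : ∀ (X : C.Obj) {A B : C.Obj} {f g : C.Hom1 A B} (c : F) (α : f ⟶ g),
    C.ltens2 X (c • α) = c • C.ltens2 X α
  rtens2_add : ∀ (X : C.Obj) {A B : C.Obj} {f g : C.Hom1 A B} (α β : f ⟶ g),
    C.rtens2 (α + β) X = C.rtens2 α X + C.rtens2 β X
  rtens2_smul : ∀ (X : C.Obj) {A B : C.Obj} {f g : C.Hom1 A B} (c : F) (α : f ⟶ g),
    C.rtens2 (c • α) X = c • C.rtens2 α X

/-- The standing assumption on the identity object: `End(I)` is equivalent to `Vect`, and the ring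
`2End(1_I)` is the field `F`. -/
class UnitIsVect (F : Type x) [Field F] (C : MonTwoCat.{u, v, w})
    [∀ A B, Preadditive (C.Hom1 A B)] [∀ A B, Linear F (C.Hom1 A B)] : Prop where
  rank_unit : IsTwoVect F (C.Hom1 C.I C.I) 1
  scalar_bijective : Function.Bijective (fun c : F => c • 𝟙 (C.one1 C.I))

/-! # Tensor products of 2-vector spaces and finite semi-simplicity -/

/-- The objects of the `F`-linear category of formal tensor products `v ⊗ w`. -/
structure LinTensor (F : Type x) (V W : Type v) where
  /-- first factor -/
  fst : V
  /-- second factor -/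
  snd : W

namespace LinTensor

variable (F : Type x) [Field F] (V W : Type v) [Category.{w} V] [Category.{w} W]
  [Preadditive V] [Preadditive W] [Linear F V] [Linear F W]

/-- The vector space `Hom(v, v') ⊗ Hom(w, w')`. -/
abbrev HomSpace (p q : LinTensor F V W) : Type w := (p.fst ⟶ q.fst) ⊗[F] (p.snd ⟶ q.snd)

/-- Composition `(a ⊗ b) ≫ (a' ⊗ b') = (a ≫ a') ⊗ (b ≫ b')`, as a bilinear map. -/
noncomputable def compMap (p q r : LinTensor F V W) :
    HomSpace F V W p q →ₗ[F] HomSpace F V W q r →ₗ[F] HomSpace F V W p r :=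
  TensorProduct.map₂ (Linear.comp (S := F) p.fst q.fst r.fst)
    (Linear.comp (S := F) p.snd q.snd r.snd)

theorem compMap_tmul (p q r : LinTensor F V W) (a : p.fst ⟶ q.fst) (b : p.snd ⟶ q.snd)
    (a' : q.fst ⟶ r.fst) (b' : q.snd ⟶ r.snd) :
    compMap F V W p q r (a ⊗ₜ[F] b) (a' ⊗ₜ[F] b') = (a ≫ a') ⊗ₜ[F] (b ≫ b') := rfl

theorem compMap_add_left (p q r : LinTensor F V W) (φ φ' : HomSpace F V W p q)
    (ψ : HomSpace F V W q r) : compMap F V W p q r (φ + φ') ψ =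
      compMap F V W p q r φ ψ + compMap F V W p q r φ' ψ :=
  LinearMap.map_add₂ _ _ _ _

theorem compMap_add_right (p q r : LinTensor F V W) (φ : HomSpace F V W p q)
    (ψ ψ' : HomSpace F V W q r) : compMap F V W p q r φ (ψ + ψ') =
      compMap F V W p q r φ ψ + compMap F V W p q r φ ψ' :=
  map_add _ _ _

/-- The category of formal tensor products. -/
noncomputable instance : Category.{w} (LinTensor F V W) where
  Hom p q := HomSpace F V W p q
  id p := 𝟙 p.fst ⊗ₜ[F] 𝟙 p.snd
  comp {p q r} φ ψ := compMap F V W p q r φ ψ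
  id_comp {p q} φ := by
    induction φ using TensorProduct.induction_on with
    | zero => simp
    | tmul a b => rw [compMap_tmul, Category.id_comp, Category.id_comp]
    | add a b ha hb => rw [map_add, ha, hb]
  comp_id {p q} φ := by
    induction φ using TensorProduct.induction_on with
    | zero => simp
    | tmul a b => rw [compMap_tmul, Category.comp_id, Category.comp_id]
    | add a b ha hb => rw [map_add, LinearMap.add_apply, ha, hb]
  assoc {p q r s} φ ψ χ := by
    induction φ using TensorProduct.induction_on with
    | zero => simp
    | add a b ha hb => simp only [map_add, LinearMap.add_apply, ha, hb]
    | tmul a b =>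
      induction ψ using TensorProduct.induction_on with
      | zero => simp
      | add a b ha hb => simp only [map_add, LinearMap.add_apply, ha, hb]
      | tmul a' b' =>
        induction χ using TensorProduct.induction_on with
        | zero => simp
        | add a b ha hb => simp only [map_add, ha, hb]
        | tmul a'' b'' => simp only [compMap_tmul, Category.assoc]

noncomputable instance : Preadditive (LinTensor F V W) where
  homGroup p q := inferInstanceAs (AddCommGroup (HomSpace F V W p q))
  add_comp p q r φ φ' ψ := compMap_add_left F V W p q r φ φ' ψ
  comp_add p q r φ ψ ψ' := compMap_add_right F V W p q r φ ψ ψ'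

end LinTensor

/-- The tensor product of two 2-vector spaces: formal finite direct sums of formal tensor
products `v ⊗ w`, with matrices of elements of `Hom(v, v') ⊗ Hom(w, w')` as morphisms. -/
abbrev TwoVectTensor (F : Type x) [Field F] (V W : Type v) [Category.{w} V] [Category.{w} W]
    [Preadditive V] [Preadditive W] [Linear F V] [Linear F W] :=
  Mat_ (LinTensor F V W)

namespace MonTwoCat

section

variable (F : Type x) [Field F] (C : MonTwoCat.{u, v, w})
  [∀ A B, Preadditive (C.Hom1 A B)] [∀ A B, Linear F (C.Hom1 A B)]

/-- An object `A` is simple if `End(A)` has rank one. -/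
def IsSimpleObj (A : C.Obj) : Prop := IsTwoVect F (C.Hom1 A A) 1

/-- The set of equivalence classes of simple objects. -/
def SimpleClasses : Type u :=
  Quot fun A B : {A : C.Obj // IsSimpleObj F C A} => C.Equivalent A.1 B.1

end

section


variable (F : Type x) [Field F] (C : MonTwoCat.{u, v, w})
  [∀ A B, Preadditive (C.Hom1 A B)] [∀ A B, Linear F (C.Hom1 A B)] [VectLinear F C]

/-- The `Hom`-categories have finite biproducts. -/
theorem hasFiniteBiproducts (F : Type x) [Field F] (C : MonTwoCat.{u, v, w})
    [∀ A B, Preadditive (C.Hom1 A B)] [∀ A B, Linear F (C.Hom1 A B)] [VectLinear F C]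
    (A B : C.Obj) : HasFiniteBiproducts (C.Hom1 A B) :=
  (VectLinear.twoVect (F := F) A B).choose_spec.hasFiniteBiproducts

/-- Horizontal composition as a bilinear map. -/
noncomputable def comp2Bilin {A B D : C.Obj} (f f' : C.Hom1 A B) (g g' : C.Hom1 B D) :
    (f ⟶ f') →ₗ[F] (g ⟶ g') →ₗ[F] (C.comp1 f g ⟶ C.comp1 f' g') :=
  LinearMap.mk₂ F (fun α β => C.comp2 α β) (VectLinear.add_comp2 (F := F))
    VectLinear.smul_comp2 (VectLinear.comp2_add (F := F)) VectLinear.comp2_smul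

/-- The functor `f ⊗ g ↦ fg` from formal tensor products to `Hom(A, B)`. -/
noncomputable def compFunctor (A X B : C.Obj) :
    LinTensor F (C.Hom1 A X) (C.Hom1 X B) ⥤ C.Hom1 A B where
  obj p := C.comp1 p.fst p.snd
  map {p q} φ := TensorProduct.lift (comp2Bilin F C p.fst q.fst p.snd q.snd) φ
  map_id p := (TensorProduct.lift.tmul _ _).trans (C.comp2_id _ _)
  map_comp {p q r} φ ψ := by
    change TensorProduct.lift _ (TensorProduct.map₂ _ _ φ ψ) = _
    induction φ using TensorProduct.induction_on with
    | zero => simp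
    | add a b ha hb => simp only [map_add, LinearMap.add_apply, ha, hb, Preadditive.add_comp]
    | tmul a b =>
      induction ψ using TensorProduct.induction_on with
      | zero => simp
      | add a b ha hb => simp only [map_add, ha, hb, Preadditive.comp_add]
      | tmul a' b' => exact C.comp2_comp a a' b b'

instance (A X B : C.Obj) : (compFunctor F C A X B).Additive where
  map_add {p q φ ψ} := map_add (TensorProduct.lift (comp2Bilin F C p.fst q.fst p.snd q.snd)) φ ψ

/-- The functor `⨁_{X ∈ E} Hom(A, X) ⊗ Hom(X, B) → Hom(A, B)` given by composition. -/
noncomputable def horizontalSum (E : Finset C.Obj) (A B : C.Obj) :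
    (∀ X : {X // X ∈ E}, TwoVectTensor F (C.Hom1 A X.1) (C.Hom1 X.1 B)) ⥤ C.Hom1 A B :=
  haveI := hasFiniteBiproducts F C A B
  { obj := fun M => ⨁ fun X => (Mat_.lift (compFunctor F C A X.1 B)).obj (M X)
    map := fun φ => biproduct.map fun X => (Mat_.lift (compFunctor F C A X.1 B)).map (φ X)
    map_id := fun M => by
      refine biproduct.hom_ext _ _ fun X => ?_
      rw [biproduct.map_π, Category.id_comp]
      exact (congrArg _ (CategoryTheory.Functor.map_id _ _)).trans (Category.comp_id _)
    map_comp := fun φ ψ => by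
      refine biproduct.hom_ext _ _ fun X => ?_
      rw [Category.assoc, biproduct.map_π, biproduct.map_π, biproduct.map_π_assoc]
      exact congrArg _ (Functor.map_comp _ _ _) }

/-- `E` exhibits the 2-category as finitely semi-simple: a finite set of pairwise non-equivalent
non-zero objects such that composition gives equivalences
`⨁_{X ∈ E} Hom(A, X) ⊗ Hom(X, B) ≃ Hom(A, B)` for all objects `A` and `B`. -/
def IsHorizontalBasis (E : Finset C.Obj) : Prop :=
  (∀ X ∈ E, C.IsNonzeroObj X) ∧ (∀ X ∈ E, ∀ Y ∈ E, C.Equivalent X Y → X = Y) ∧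
    ∀ A B, (horizontalSum F C E A B).IsEquivalence

end

end MonTwoCat

/-! # The pairing, quantum dimensions and non-degeneracy -/

namespace DualTwoCat

/-- The 2-morphism `cap_f · Tr_R((α · β) ∘ 1_{f*}) · cup_f : 1_I ⇒ 1_I`, for `α : f ⇒ g` and
`β : g ⇒ f`. -/
def pairCell (C : DualTwoCat.{u, v, w}) (α β : C.Cell) : C.Cell :=
  C.capR (C.dom α) ⬝₂ C.trRc ((α ⬝₂ β) ∘₂ C.idc (C.dom α)⁎₁) ⬝₂ C.cupR (C.dom α)

theorem isCell_pairCell (C : DualTwoCat.{u, v, w}) {α β : C.Cell} {f g : C.Mor}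
    (hα : C.IsCell α f g) (hβ : C.IsCell β g f) :
    C.IsCell (C.pairCell α β) (C.one C.I) (C.one C.I) := by
  obtain ⟨rfl, rfl⟩ := hα
  obtain ⟨h1, h2⟩ := hβ
  have L := C.laws
  have M := C.monLaws
  have D := C.dualLaws
  generalize hf : C.dom α = f at *
  have e1 : C.tgt (C.unit0 (C.src f)) = C.src (f ▷₁ (C.src f)⁎₀) := by
    rw [D.tgt_unit0, M.src_rtens]
  have e2 : C.tgt (f ▷₁ (C.src f)⁎₀) = C.src (f⁎₁ ▷₁ (C.src f)⁎₀) := by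
    rw [M.tgt_rtens, M.src_rtens, D.src_dual1]
  have e3 : C.tgt (f⁎₁ ▷₁ (C.src f)⁎₀) = C.src (C.counit0 (C.src f)⁎₀) := by
    rw [M.tgt_rtens, D.tgt_dual1, D.src_counit0, D.dual0_dual0]
  have e4 : C.tgt f = C.src f⁎₁ := (D.src_dual1 f).symm
  have k0 : C.tgt (C.dom (α ⬝₂ β)) = C.src (C.dom (C.idc f⁎₁)) := by
    rw [L.dom_vcomp _ _ h1.symm, L.dom_idc, hf, e4]
  have k1 : C.dom ((α ⬝₂ β) ∘₂ C.idc f⁎₁) = f ⬝₁ f⁎₁ := by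
    rw [L.dom_hcomp _ _ k0, L.dom_vcomp _ _ h1.symm, L.dom_idc, hf]
  have k2 : C.cod ((α ⬝₂ β) ∘₂ C.idc f⁎₁) = f ⬝₁ f⁎₁ := by
    rw [L.cod_hcomp _ _ k0, L.cod_vcomp _ _ h1.symm, L.cod_idc, h2]
  have k3 : C.src (f ⬝₁ f⁎₁) = C.src f := L.src_comp _ _ e4
  have k4 : (f ⬝₁ f⁎₁) ▷₁ (C.src f)⁎₀ = (f ▷₁ (C.src f)⁎₀) ⬝₁ (f⁎₁ ▷₁ (C.src f)⁎₀) :=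
    M.comp_rtens _ _ _ e4
  have m0 : C.cod (C.capR f) =
      C.unit0 (C.src f) ⬝₁ ((f ▷₁ (C.src f)⁎₀) ⬝₁ (f⁎₁ ▷₁ (C.src f)⁎₀)) ⬝₁
        C.counit0 (C.src f)⁎₀ := by
    rw [capR, D.cod_unit1, D.dual1_comp _ _ e1, D.dual1_rtens, ← D.counit0_dual,
      L.comp_assoc _ _ _ e1, ← L.comp_assoc _ _ _ e2 e3]
    rw [L.src_comp _ _ e3, e2]
  have m1 : C.tgt (C.unit0 (C.src f)) =
      C.src ((f ▷₁ (C.src f)⁎₀) ⬝₁ (f⁎₁ ▷₁ (C.src f)⁎₀)) := by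
    rw [L.src_comp _ _ e2, e1]
  have m2 : C.tgt ((f ▷₁ (C.src f)⁎₀) ⬝₁ (f⁎₁ ▷₁ (C.src f)⁎₀)) =
      C.src (C.counit0 (C.src f)⁎₀) := by
    rw [L.tgt_comp _ _ e2, e3]
  have m3 : C.dom (C.trRc ((α ⬝₂ β) ∘₂ C.idc f⁎₁)) = C.cod (C.capR f) := by
    rw [m0, trRc, k1, k3, L.dom_hcomp, L.dom_hcomp, M.dom_rtensc, k1, k4, L.dom_idc, L.dom_idc]
    · rw [M.dom_rtensc, k1, k4, L.dom_idc, m2]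
    · rw [L.dom_hcomp, M.dom_rtensc, k1, k4, L.dom_idc, L.dom_idc, L.src_comp _ _ m2, m1]
      rw [M.dom_rtensc, k1, k4, L.dom_idc, m2]
  have m4 : C.cod (C.trRc ((α ⬝₂ β) ∘₂ C.idc f⁎₁)) = C.cod (C.capR f) := by
    rw [m0, trRc, k1, k3, L.cod_hcomp, L.cod_hcomp, M.cod_rtensc, k2, k4, L.cod_idc, L.cod_idc]
    · rw [M.dom_rtensc, k1, k4, L.dom_idc, m2]
    · rw [L.dom_hcomp, M.dom_rtensc, k1, k4, L.dom_idc, L.dom_idc, L.src_comp _ _ m2, m1]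
      rw [M.dom_rtensc, k1, k4, L.dom_idc, m2]
  have m5 : C.dom (C.capR f) = C.one C.I := by
    rw [capR, D.dom_unit1, L.src_comp _ _ e1, D.src_unit0]
  have m6 : C.dom (C.cupR f) = C.cod (C.capR f) := D.dom_dual2 _
  have m7 : C.cod (C.cupR f) = C.one C.I := (D.cod_dual2 _).trans m5
  have m8 : C.cod (C.trRc ((α ⬝₂ β) ∘₂ C.idc f⁎₁)) = C.dom (C.cupR f) := m4.trans m6.symm
  have m9 : C.cod (C.capR f) = C.dom (C.trRc ((α ⬝₂ β) ∘₂ C.idc f⁎₁) ⬝₂ C.cupR f) := by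
    rw [L.dom_vcomp _ _ m8, m3]
  rw [pairCell, hf]
  exact ⟨(L.dom_vcomp _ _ m9).trans m5, by rw [L.cod_vcomp _ _ m9, L.cod_vcomp _ _ m8, m7]⟩

/-- The pairing `⟨α, β⟩ ∈ 2End(1_I)` of `α : f ⇒ g` and `β : g ⇒ f`. -/
def pairing (C : DualTwoCat.{u, v, w}) {A B : C.Obj} {f g : C.Hom1 A B} (α : f ⟶ g) (β : g ⟶ f) :
    C.one1 C.I ⟶ C.one1 C.I :=
  TwoCat.Hom2.mk (C.pairCell (C.cellOf α) (C.cellOf β))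
    (C.isCell_pairCell (TwoCat.Hom2.isCell α) (TwoCat.Hom2.isCell β))

section

variable (F : Type x) [Field F] (C : DualTwoCat.{u, v, w})
  [∀ A B, Preadditive (C.Hom1 A B)] [∀ A B, Linear F (C.Hom1 A B)] [UnitIsVect F C.toMonTwoCat]

/-- The identification of `2End(1_I)` with the field `F`: the element `c • 1` corresponds
to `c`. -/
noncomputable def scalar (z : C.one1 C.I ⟶ C.one1 C.I) : F :=
  (Equiv.ofBijective _ (UnitIsVect.scalar_bijective (F := F) (C := C.toMonTwoCat))).symm z

/-- The quantum dimension `⟨1_f, 1_f⟩` of a 1-morphism. -/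
noncomputable def qdim1 {A B : C.Obj} (f : C.Hom1 A B) : F :=
  scalar F C (C.pairing (𝟙 f) (𝟙 f))

/-- The quantum dimension `⟨1_{1_A}, 1_{1_A}⟩` of an object. -/
noncomputable def qdim (A : C.Obj) : F := qdim1 F C (C.one1 A)

end

/-- Non-degeneracy of the pairing. -/
def NonDegenerate (C : DualTwoCat.{u, v, w}) [∀ A B, Preadditive (C.Hom1 A B)] : Prop :=
  ∀ (A B : C.Obj) (f g : C.Hom1 A B),
    (∀ α : f ⟶ g, (∀ β : g ⟶ f, C.pairing α β = 0) → α = 0) ∧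
    (∀ β : g ⟶ f, (∀ α : f ⟶ g, C.pairing α β = 0) → β = 0)

end DualTwoCat

/-! # Split simple objects of 2-vector spaces -/

/-! The count rests on a dimension formula for an arbitrary object W: dim W is the sum, over X ∈ E
and over the simple 1-morphisms h : W → X up to isomorphism, of dim(X)⁻¹ dim(h)² (`qdim_eq_sum`).
Apply it to W = B* ⊗ A. Since dim W = dim B · dim A and Hom(B* ⊗ A, D) ≃ Hom(A, B ⊗ D) by an
equivalence that preserves dimensions of 1-morphisms, it becomes dim B · dim A = Σ_D Σ_f dim(D)⁻¹
dim(f)² (`qdim_mul_qdim_eq_sum`). After division by dim A · dim B every B ∈ E contributes exactly 1,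
and E represents the simple objects up to equivalence (`simpleClasses_equiv`), so the total is K.

For the dimension formula, attach to h : W → X its circle i_h · i_h*, a 2-endomorphism of 1_W.
Finite semi-simplicity says two things: 2-morphisms between composites through the same X ∈ E form a
tensor product (`comp2_lift_bijective`), and there are no non-zero ones between composites through
different elements of E (`comp1_hom_eq_zero`). Hence for simple h the composite h*h is a copy of
1_X, split off by multiples of e_h and e_h*. If the circle of h* is d · 1, then the circle of h acts
on h as d⁻¹ (`exists_smul_circHom`), and it acts as zero on simple 1-morphisms not isomorphic to h.
As a 2-endomorphism of 1_W is determined by its action on the simple 1-morphisms W → X, the identity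
of 1_W is Σ d_h · circle(h) (`id_eq_sum_circHom`). Taking traces gives dim W = Σ d_h dim h, while
d_h dim X = dim h* = dim h.

The geometric inputs are: multiplicativity of dim under ⊗, from nested circles (`qdim_tens`); dim A*
= dim A and dim(mate f) = dim f, from the equality of left and right circles that sphericality
provides (`circR_eq_circL`, `SphericalTwoCat.circR_mate`); dim f* = dim f, from consistency
(`circR_dual1`). Division is legitimate because non-degeneracy forces dim A ≠ 0 as soon as 2End(1_A)
= F (`qdim_ne_zero`). -/

section LinearCategory

variable {F : Type x} [Field F]

/-! ### Simple objects and decompositions in Vectⁿ. -/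

section FiniteVect

variable {n : ℕ}

/-- The simple objects of `Vectⁿ`. -/
noncomputable def vectSimple (F : Type x) [Field F] {n : ℕ} (i : Fin n) :
    Fin n → FGModuleCat.{x} F :=
  fun j => FGModuleCat.of F (PLift (i = j) → F)

/-- The projection of an object of `Vectⁿ` to a simple object given by a basis vector. -/
noncomputable def vectProj (M : Fin n → FGModuleCat.{x} F) (i : Fin n)
    (a : Fin (Module.finrank F (M i))) : M ⟶ vectSimple F i := fun j =>
  FGModuleCat.ofHom (LinearMap.pi fun h => by
    cases h.down
    exact (Module.finBasis F (M i)).coord a)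

/-- The inclusion of a simple object into an object of `Vectⁿ` given by a basis vector. -/
noncomputable def vectIncl (M : Fin n → FGModuleCat.{x} F) (i : Fin n)
    (a : Fin (Module.finrank F (M i))) : vectSimple F i ⟶ M := fun j =>
  if h : i = j then
    FGModuleCat.ofHom ((LinearMap.proj (R := F) (φ := fun _ : PLift (i = j) => F) ⟨h⟩).smulRight (by
      cases h
      exact Module.finBasis F (M i) a))
  else 0

/-- In coordinate j the terms with i = j are the dual-basis expansion of the identity; all others
vanish because the inclusion is zero there by definition. -/
theorem vect_decomposition (M : Fin n → FGModuleCat.{x} F) (j : Fin n) :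
    ∑ z : Σ i, Fin (Module.finrank F (M i)), (vectProj M z.1 z.2 ≫ vectIncl M z.1 z.2) j =
      𝟙 (M j) := by
  rw [Fintype.sum_sigma, Finset.sum_eq_single j]
  · apply FGModuleCat.hom_ext
    refine LinearMap.ext fun y => ?_
    have h1 : ∀ a, ((vectProj M j a ≫ vectIncl M j a) j).hom.hom =
        ((Module.finBasis F (M j)).coord a).smulRight (Module.finBasis F (M j) a) := by
      intro a
      refine LinearMap.ext fun z => ?_
      simp only [Pi.comp_apply, vectIncl, vectProj]
      simp
      rfl
    have h2 : ∀ (s : Finset (Fin (Module.finrank F (M j))))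
        (g : Fin (Module.finrank F (M j)) → (M j ⟶ M j)),
        (∑ a ∈ s, g a).hom.hom = ∑ a ∈ s, (g a).hom.hom := by
      intro s g
      induction s using Finset.cons_induction with
      | empty => rfl
      | cons a s ha ih => rw [Finset.sum_cons, Finset.sum_cons, ← ih]; rfl
    rw [h2, LinearMap.sum_apply]
    simp only [h1]
    exact (Module.finBasis F (M j)).sum_repr y
  · intro i _ hi
    refine Finset.sum_eq_zero fun a _ => ?_
    have h0 : vectIncl M i a j = 0 := dif_neg hi
    rw [Pi.comp_apply, h0, comp_zero]
  · simp

theorem vectSimple_end (i : Fin n) (φ : vectSimple F i ⟶ vectSimple F i) :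
    ∃ c : F, ∀ j, φ j = c • 𝟙 (vectSimple F i j) := by
  let ψ : ∀ j, (PLift (i = j) → F) →ₗ[F] (PLift (i = j) → F) := fun j => (φ j).hom.hom
  refine ⟨ψ i 1 ⟨rfl⟩, fun j => FGModuleCat.hom_ext ?_⟩
  change ψ j = ψ i 1 ⟨rfl⟩ • LinearMap.id
  refine LinearMap.ext fun y => ?_
  by_cases h : i = j
  · subst h
    have hy : y = y ⟨rfl⟩ • (1 : PLift (i = i) → F) := by
      funext ⟨_⟩; simp
    rw [hy, map_smul, map_smul]
    congr 1
    funext ⟨_⟩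
    simp
  · have h0 : y = 0 := funext fun z => absurd z.down h
    rw [h0, map_zero, map_zero]

theorem vectSimple_hom (i j : Fin n) (hij : i ≠ j) (φ : vectSimple F i ⟶ vectSimple F j)
    (k : Fin n) : φ k = 0 := by
  let ψ : (PLift (i = k) → F) →ₗ[F] (PLift (j = k) → F) := (φ k).hom.hom
  refine FGModuleCat.hom_ext ?_
  change ψ = 0
  refine LinearMap.ext fun y => ?_
  by_cases h : i = k
  · subst h
    exact funext fun z => absurd z.down.symm hij
  · have h0 : y = 0 := funext fun z => absurd z.down h
    rw [h0, map_zero, map_zero]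

end FiniteVect

/-! ### Split simple objects of an abstract 2-vector space. -/

variable {V : Type v} [Category.{w} V] [Preadditive V] [Linear F V]

/-- An object is split simple if its endomorphism ring is the ground field. -/
def IsSplit (F : Type x) [Field F] {V : Type v} [Category.{w} V] [Preadditive V] [Linear F V]
    (s : V) : Prop :=
  Function.Bijective fun c : F => c • 𝟙 s

theorem IsSplit.exists_smul {s : V} (h : IsSplit F s) (φ : s ⟶ s) : ∃ c : F, φ = c • 𝟙 s := by
  obtain ⟨c, hc⟩ := h.2 φ
  exact ⟨c, hc.symm⟩

theorem IsSplit.id_ne_zero {s : V} (h : IsSplit F s) : 𝟙 s ≠ 0 := by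
  intro h0
  have := @h.1 1 0 (by simp [h0])
  exact one_ne_zero this

/-- Over a field, `c ↦ c • 𝟙 s` is injective as soon as the identity is non-zero, so only
surjectivity has to be supplied. -/
theorem isSplit_of {s : V} (h0 : 𝟙 s ≠ 0) (h : ∀ φ : s ⟶ s, ∃ c : F, φ = c • 𝟙 s) :
    IsSplit F s := by
  refine ⟨fun c d hcd => ?_, fun φ => ?_⟩
  · have : (c - d) • 𝟙 s = 0 := by rw [sub_smul]; exact sub_eq_zero.2 hcd
    rcases smul_eq_zero.1 this with h1 | h1
    · exact sub_eq_zero.1 h1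
    · exact absurd h1 h0
  · obtain ⟨c, rfl⟩ := h φ
    exact ⟨c, rfl⟩

theorem IsSplit.of_iso {s t : V} (e : s ≅ t) (h : IsSplit F s) : IsSplit F t := by
  refine isSplit_of (fun h0 => h.id_ne_zero ?_) fun φ => ?_
  · rw [← e.hom_inv_id, ← Category.comp_id e.hom, h0, comp_zero, zero_comp]
  · obtain ⟨c, hc⟩ := h.exists_smul (e.hom ≫ φ ≫ e.inv)
    refine ⟨c, ?_⟩
    have : φ = e.inv ≫ (e.hom ≫ φ ≫ e.inv) ≫ e.hom := by simp
    rw [this, hc]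
    simp

/-- Two split simple objects with a non-zero composite of maps between them are isomorphic. -/
theorem IsSplit.iso_of_comp_ne_zero {s t : V} (hs : IsSplit F s) (ht : IsSplit F t)
    (p : s ⟶ t) (q : t ⟶ s) (h : p ≫ q ≠ 0) : Nonempty (s ≅ t) := by
  obtain ⟨c, hc⟩ := hs.exists_smul (p ≫ q)
  obtain ⟨d, hd⟩ := ht.exists_smul (q ≫ p)
  have hc0 : c ≠ 0 := by rintro rfl; exact h (by simpa using hc)
  have hp : p ≠ 0 := by rintro rfl; simp at h
  -- Bracket `p ≫ q ≫ p` in both ways; the two scalars must then agree, and one rescaling of `q`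
  -- inverts `p` on both sides.
  have h1 : c • p = d • p := by
    have h2 : (p ≫ q) ≫ p = p ≫ q ≫ p := Category.assoc _ _ _
    rw [hc, hd] at h2
    simpa using h2
  have hcd : c = d := by
    have : (c - d) • p = 0 := by rw [sub_smul, h1, sub_self]
    rcases smul_eq_zero.1 this with h3 | h3
    · exact sub_eq_zero.1 h3
    · exact absurd h3 hp
  subst hcd
  refine ⟨⟨p, c⁻¹ • q, ?_, ?_⟩⟩
  · rw [Linear.comp_smul, hc, smul_smul, inv_mul_cancel₀ hc0, one_smul]
  · rw [Linear.smul_comp, hd, smul_smul, inv_mul_cancel₀ hc0, one_smul]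

/-- A complete family of pairwise orthogonal split simple objects. -/
structure IsSplitFamily (F : Type x) [Field F] {V : Type v} [Category.{w} V] [Preadditive V]
    [Linear F V] {n : ℕ} (S : Fin n → V) : Prop where
  split : ∀ i, IsSplit F (S i)
  hom_eq_zero : ∀ i j, i ≠ j → ∀ φ : S i ⟶ S j, φ = 0
  decomposition : ∀ v : V, ∃ (ι : Type) (_ : Fintype ι) (k : ι → Fin n) (p : ∀ a, v ⟶ S (k a))
    (q : ∀ a, S (k a) ⟶ v), ∑ a, p a ≫ q a = 𝟙 v

/-- The simple objects and the dual-basis decomposition of Vectⁿ are carried back along the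
equivalence. Linearity is given for each coordinate of the functor, so equations are checked
coordinatewise and lifted by faithfulness. -/
theorem IsTwoVect.exists_splitFamily {n : ℕ} (h : IsTwoVect F V n) :
    ∃ S : Fin n → V, IsSplitFamily F S := by
  obtain ⟨e, he⟩ := h
  have hadd : ∀ {v v' : V} (f g : v ⟶ v') (j),
      e.functor.map (f + g) j = e.functor.map f j + e.functor.map g j := fun f g j =>
    haveI := (he j).1
    (e.functor ⋙ Pi.eval (fun _ : Fin n => FGModuleCat.{x} F) j).map_add
  have hsmul : ∀ {v v' : V} (c : F) (f : v ⟶ v') (j),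
      e.functor.map (c • f) j = c • e.functor.map f j := fun c f j =>
    haveI := (he j).1
    haveI := (he j).2
    (e.functor ⋙ Pi.eval (fun _ : Fin n => FGModuleCat.{x} F) j).map_smul c f
  have hzero : ∀ {v v' : V} (j), e.functor.map (0 : v ⟶ v') j = 0 := fun {v v'} j => by
    have := hsmul 0 (0 : v ⟶ v') j
    rwa [zero_smul, zero_smul] at this
  have hfaith : ∀ {v v' : V} (f g : v ⟶ v'), (∀ j, e.functor.map f j = e.functor.map g j) →
      f = g := fun f g hfg => e.functor.map_injective (funext hfg)
  let c : ∀ i, e.functor.obj (e.inverse.obj (vectSimple F i)) ≅ vectSimple F i :=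
    fun i => e.counitIso.app (vectSimple F i)
  have hc : ∀ {i j} (φ : e.inverse.obj (vectSimple F i) ⟶ e.inverse.obj (vectSimple F j)) (k),
      e.functor.map φ k = (c i).hom k ≫ ((c i).inv ≫ e.functor.map φ ≫ (c j).hom) k ≫
        (c j).inv k := by
    intro i j φ k
    have h1 : e.functor.map φ = (c i).hom ≫ ((c i).inv ≫ e.functor.map φ ≫ (c j).hom) ≫
      (c j).inv := by simp
    exact congrFun h1 k
  refine ⟨fun i => e.inverse.obj (vectSimple F i), ⟨fun i => isSplit_of ?_ fun φ => ?_,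
    fun i j hij φ => ?_, fun v => ?_⟩⟩
  · intro h0
    have h2 : 𝟙 (vectSimple F i i) = 0 := by
      have h3 : 𝟙 (vectSimple F i) = (c i).inv ≫ e.functor.map (𝟙 _) ≫ (c i).hom := by simp
      have h4 : 𝟙 (vectSimple F i i) = (c i).inv i ≫ e.functor.map (𝟙 _) i ≫ (c i).hom i :=
        congrFun h3 i
      rw [h4, h0, hzero, zero_comp, comp_zero]
    have h5 : (1 : PLift (i = i) → F) = 0 :=
      LinearMap.congr_fun (congrArg (fun t => t.hom.hom) h2) (1 : PLift (i = i) → F)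
    exact one_ne_zero (congrFun h5 ⟨rfl⟩)
  · obtain ⟨d, hd⟩ := vectSimple_end i ((c i).inv ≫ e.functor.map φ ≫ (c i).hom)
    refine ⟨d, hfaith _ _ fun j => ?_⟩
    have h1 : (c i).hom j ≫ (c i).inv j = e.functor.map (𝟙 _) j := by
      rw [CategoryTheory.Functor.map_id]
      exact congrFun (c i).hom_inv_id j
    rw [hc, hd, Linear.smul_comp, Category.id_comp, Linear.comp_smul, h1, hsmul]
  · refine hfaith _ _ fun k => ?_
    rw [hc, vectSimple_hom i j hij ((c i).inv ≫ e.functor.map φ ≫ (c j).hom), hzero, zero_comp,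
      comp_zero]
  · let M : Fin n → FGModuleCat.{x} F := e.functor.obj v
    let f : (Σ i, Fin (Module.finrank F (M i))) → (v ⟶ v) := fun z =>
      e.functor.preimage (vectProj M z.1 z.2 ≫ (c z.1).inv) ≫
        e.functor.preimage ((c z.1).hom ≫ vectIncl M z.1 z.2)
    have h1 : ∀ z, e.functor.map (f z) = vectProj M z.1 z.2 ≫ vectIncl M z.1 z.2 := by
      intro z
      rw [Functor.map_comp, Functor.map_preimage, Functor.map_preimage, Category.assoc,
        Iso.inv_hom_id_assoc]
    have h2 : ∀ (s : Finset (Σ i, Fin (Module.finrank F (M i)))) (j),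
        e.functor.map (∑ z ∈ s, f z) j = ∑ z ∈ s, e.functor.map (f z) j := by
      intro s j
      induction s using Finset.cons_induction with
      | empty => exact hzero j
      | cons a s ha ih => rw [Finset.sum_cons, Finset.sum_cons, ← ih, hadd]
    refine ⟨Σ i, Fin (Module.finrank F (M i)), inferInstance, fun z => z.1,
      fun z => e.functor.preimage (vectProj M z.1 z.2 ≫ (c z.1).inv),
      fun z => e.functor.preimage ((c z.1).hom ≫ vectIncl M z.1 z.2), hfaith _ _ fun j => ?_⟩
    refine (h2 _ j).trans ?_
    simp only [h1]
    rw [CategoryTheory.Functor.map_id]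
    exact vect_decomposition M j

theorem exists_ne_zero_of_sum_ne_zero {s : V} {ι : Type} [Fintype ι] {φ : ι → (s ⟶ s)}
    (h : ∑ a, φ a ≠ 0) : ∃ a, φ a ≠ 0 := by
  by_contra! h0
  exact h (Finset.sum_eq_zero fun a _ => h0 a)

namespace IsSplitFamily

variable {n : ℕ} {S : Fin n → V}

/-- Decomposing `t`, some summand maps non-trivially to `S i`. Orthogonality makes that summand `S
i` itself, and the resulting scalar can be inverted. -/
theorem exists_retraction (hS : IsSplitFamily F S) {i : Fin n} {t : V} (f : t ⟶ S i) (hf : f ≠ 0) :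
    ∃ y : S i ⟶ t, y ≫ f = 𝟙 (S i) := by
  obtain ⟨ι, _, k, p, q, hpq⟩ := hS.decomposition t
  have h1 : ∃ a, q a ≫ f ≠ 0 := by
    by_contra! h0
    apply hf
    rw [← Category.id_comp f, ← hpq, Preadditive.sum_comp]
    exact Finset.sum_eq_zero fun a _ => by rw [Category.assoc, h0, comp_zero]
  obtain ⟨a, ha⟩ := h1
  have hk : k a = i := by
    by_contra hne
    exact ha (hS.hom_eq_zero _ _ hne _)
  obtain ⟨g, hg⟩ : ∃ g : S i ⟶ t, g ≫ f ≠ 0 := ⟨eqToHom (by rw [hk]) ≫ q a, fun h0 => ha (by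
    rw [Category.assoc] at h0
    exact (cancel_epi (eqToHom (by rw [hk]))).1 (h0.trans comp_zero.symm))⟩
  obtain ⟨c, hc⟩ := (hS.split i).exists_smul (g ≫ f)
  have hc0 : c ≠ 0 := by rintro rfl; exact hg (by simpa using hc)
  exact ⟨c⁻¹ • g, by rw [Linear.smul_comp, hc, smul_smul, inv_mul_cancel₀ hc0, one_smul]⟩

theorem simple (hS : IsSplitFamily F S) (i : Fin n) : Simple (S i) := by
  refine ⟨fun {t} f _ => ⟨fun _ h0 => (hS.split i).id_ne_zero ?_, fun hf => ?_⟩⟩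
  · exact (IsIso.inv_hom_id f).symm.trans ((congrArg (inv f ≫ ·) h0).trans comp_zero)
  · obtain ⟨y, hy⟩ := hS.exists_retraction f hf
    exact ⟨y, by rw [← cancel_mono f, Category.assoc, hy, Category.comp_id, Category.id_comp], hy⟩

theorem exists_iso_of_simple (hS : IsSplitFamily F S) (s : V) [Simple s] :
    ∃ i, Nonempty (S i ≅ s) := by
  obtain ⟨ι, _, k, p, q, hpq⟩ := hS.decomposition s
  obtain ⟨a, ha⟩ := exists_ne_zero_of_sum_ne_zero (hpq ▸ id_nonzero s)
  have hq : q a ≠ 0 := by intro h0; exact ha (by rw [h0, comp_zero])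
  -- A non-zero `g` with `g ≫ q a = 0` would have a section by `exists_retraction`, forcing `q a =
  -- 0`. A non-zero mono into a simple object is an isomorphism.
  have : Mono (q a) := by
    refine Preadditive.mono_of_cancel_zero _ fun g hg => ?_
    by_contra hne
    obtain ⟨y, hy⟩ := hS.exists_retraction g hne
    exact hq (by rw [← Category.id_comp (q a), ← hy, Category.assoc, hg, comp_zero])
  have := isIso_of_mono_of_nonzero hq
  exact ⟨k a, ⟨asIso (q a)⟩⟩

theorem exists_iso_of_isSplit (hS : IsSplitFamily F S) {s : V} (hs : IsSplit F s) :
    ∃ i, Nonempty (S i ≅ s) := by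
  obtain ⟨ι, _, k, p, q, hpq⟩ := hS.decomposition s
  obtain ⟨a, ha⟩ := exists_ne_zero_of_sum_ne_zero (hpq ▸ hs.id_ne_zero)
  obtain ⟨e⟩ := hs.iso_of_comp_ne_zero (hS.split _) _ _ ha
  exact ⟨k a, ⟨e.symm⟩⟩

/-- Bases are defined through categorical simplicity, but the scalar computations need endomorphism
ring F. Over a general field these notions differ; here both single out the objects isomorphic to a
member of the family. -/
theorem simple_iff_isSplit (hS : IsSplitFamily F S) (s : V) : Simple s ↔ IsSplit F s := by
  constructor
  · intro _
    obtain ⟨i, ⟨e⟩⟩ := hS.exists_iso_of_simple s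
    exact (hS.split i).of_iso e
  · intro hs
    obtain ⟨i, ⟨e⟩⟩ := hS.exists_iso_of_isSplit hs
    have := hS.simple i
    exact Simple.of_iso e.symm

/-- A non-zero map between split simple objects forces them to be isomorphic. -/
theorem iso_of_ne_zero (hS : IsSplitFamily F S) {s t : V} (hs : IsSplit F s)
    (ht : IsSplit F t) (f : s ⟶ t) (hf : f ≠ 0) :
    Nonempty (s ≅ t) := by
  obtain ⟨i, ⟨e⟩⟩ := hS.exists_iso_of_isSplit hs
  obtain ⟨j, ⟨e'⟩⟩ := hS.exists_iso_of_isSplit ht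
  by_cases hij : i = j
  · subst hij
    exact ⟨e.symm ≪≫ e'⟩
  · have := hS.hom_eq_zero i j hij (e.hom ≫ f ≫ e'.inv)
    exact absurd (by simpa using this) hf

end IsSplitFamily

/-- In a category of rank one with commutative `End(s)`, a non-zero object `s` is split simple. -/
theorem IsTwoVect.isSplit_of_commutative (h : IsTwoVect F V 1) {s : V} (h0 : 𝟙 s ≠ 0)
    (hcomm : ∀ φ ψ : s ⟶ s, φ ≫ ψ = ψ ≫ φ) : IsSplit F s := by
  obtain ⟨S, hS⟩ := h.exists_splitFamily
  obtain ⟨ι, _, k, p, q, hpq⟩ := hS.decomposition s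
  have hk : ∀ a, k a = 0 := fun a => Subsingleton.elim _ _
  obtain rfl : k = fun _ => 0 := funext hk
  obtain ⟨b, hb⟩ := exists_ne_zero_of_sum_ne_zero (hpq ▸ h0)
  have hp : p b ≠ 0 := by intro h1; exact hb (by rw [h1, zero_comp])
  obtain ⟨y, hy⟩ := hS.exists_retraction (p b) hp
  -- Since `y ≫ p b = 𝟙`, one has `p' ≫ q' = (p' ≫ y) ≫ (p b ≫ q')`. Commuting the two endomorphisms
  -- brings `q' ≫ p'`, a scalar, into the middle.
  have key : ∀ (p' : s ⟶ S 0) (q' : S 0 ⟶ s), ∃ c : F, p' ≫ q' = c • (p b ≫ y) := by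
    intro p' q'
    obtain ⟨c, hc⟩ := (hS.split 0).exists_smul (q' ≫ p')
    refine ⟨c, ?_⟩
    have h1 := hcomm (p' ≫ y) (p b ≫ q')
    simp only [Category.assoc] at h1
    rw [reassoc_of% hy, reassoc_of% hc] at h1
    rw [h1]
    simp
  have hall : ∀ φ : s ⟶ s, ∃ c : F, φ = c • (p b ≫ y) := by
    intro φ
    choose c hc using fun a => key (p a) (q a ≫ φ)
    refine ⟨∑ a, c a, ?_⟩
    rw [Finset.sum_smul, ← Category.id_comp φ, ← hpq, Preadditive.sum_comp]
    exact Finset.sum_congr rfl fun a _ => by rw [← hc a, Category.assoc]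
  -- The identity is itself a non-zero multiple of `p b ≫ y`, so multiples of one are multiples of
  -- the other.
  obtain ⟨d, hd⟩ := hall (𝟙 s)
  have hd0 : d ≠ 0 := by rintro rfl; exact h0 (by simpa using hd)
  refine isSplit_of h0 fun φ => ?_
  obtain ⟨c, rfl⟩ := hall φ
  exact ⟨c * d⁻¹, by rw [hd, smul_smul, mul_assoc, inv_mul_cancel₀ hd0, mul_one]⟩

/-- A 2-vector space with exactly one isomorphism class of split simple objects has rank one. -/
theorem IsTwoVect.rank_one {n : ℕ} (h : IsTwoVect F V n) {s : V} (hs : IsSplit F s)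
    (hiso : ∀ t : V, IsSplit F t → Nonempty (t ≅ s)) : IsTwoVect F V 1 := by
  obtain ⟨S, hS⟩ := h.exists_splitFamily
  obtain ⟨i, ⟨e⟩⟩ := hS.exists_iso_of_isSplit hs
  have huniq : ∀ j, j = i := by
    intro j
    by_contra hne
    obtain ⟨e'⟩ := hiso _ (hS.split j)
    have h0 := hS.hom_eq_zero j i hne (e'.hom ≫ e.inv)
    apply (hS.split j).id_ne_zero
    rw [← (e' ≪≫ e.symm).hom_inv_id]
    simp [h0]
  have hn : n = 1 := by
    have hc : Fintype.card (Fin n) = 1 := Fintype.card_eq_one_iff.2 ⟨i, huniq⟩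
    simpa using hc
  subst hn
  exact h

end LinearCategory

/-! # Consequences of finite semi-simplicity -/

section BiproductSum

variable {J : Type*} [Finite J] {T : J → Type*} [∀ j, Category.{w} (T j)]
  {D : Type*} [Category* D] [Preadditive D] [HasFiniteBiproducts D]
  (L : ∀ j, T j ⥤ D)

/-- The direct sum of a finite family of functors with a common target. -/
noncomputable def biproductSum : (∀ j, T j) ⥤ D where
  obj M := ⨁ fun j => (L j).obj (M j)
  map φ := biproduct.map fun j => (L j).map (φ j)
  map_id M := by
    refine biproduct.hom_ext _ _ fun j => ?_
    rw [biproduct.map_π, Category.id_comp]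
    exact (congrArg _ ((L j).map_id _)).trans (Category.comp_id _)
  map_comp φ ψ := by
    refine biproduct.hom_ext _ _ fun j => ?_
    rw [Category.assoc, biproduct.map_π, biproduct.map_π, biproduct.map_π_assoc]
    exact congrArg _ ((L j).map_comp _ _)

/-- A morphism of one factor is extended by zero to a morphism of the product category. Arbitrary
objects fill the other coordinates, which is why each factor must be non-empty. -/
theorem biproductSum_map_injective [∀ j, Preadditive (T j)]
    (hT : ∀ j, Nonempty (T j)) (hL : (biproductSum L).Faithful) (j : J) {P Q : T j} :
    Function.Injective ((L j).map : (P ⟶ Q) → _) := by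
  classical
  intro φ ψ h
  obtain ⟨M, rfl⟩ : ∃ M : ∀ j, T j, M j = P :=
    ⟨Function.update (fun j => (hT j).some) j P, Function.update_self ..⟩
  obtain ⟨N, rfl⟩ : ∃ N : ∀ j, T j, N j = Q :=
    ⟨Function.update (fun j => (hT j).some) j Q, Function.update_self ..⟩
  have h0 : ∀ k, (L k).map ((Function.update (fun _ => 0) j φ : M ⟶ N) k) =
      (L k).map ((Function.update (fun _ => 0) j ψ : M ⟶ N) k) := by
    intro k
    by_cases hk : k = j
    · subst hk
      rw [Function.update_self, Function.update_self, h]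
    · rw [Function.update_of_ne hk, Function.update_of_ne hk]
  have h1 : (Function.update (fun _ => 0) j φ : M ⟶ N) = Function.update (fun _ => 0) j ψ :=
    (biproductSum L).map_injective (congrArg (fun t : ∀ k, (L k).obj (M k) ⟶ (L k).obj (N k) =>
      biproduct.map t) (funext h0))
  have h2 := congrFun h1 j
  rwa [Function.update_self, Function.update_self] at h2

/-- Place `γ` as a matrix with a single entry at (j, j); the j-th coordinate of a preimage then maps
to `γ`. -/
theorem biproductSum_map_surjective (hT : ∀ j, Nonempty (T j)) (hL : (biproductSum L).Full)
    (j : J) {P Q : T j} :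
    Function.Surjective ((L j).map : (P ⟶ Q) → _) := by
  classical
  intro γ
  obtain ⟨M, rfl⟩ : ∃ M : ∀ j, T j, M j = P :=
    ⟨Function.update (fun j => (hT j).some) j P, Function.update_self ..⟩
  obtain ⟨N, rfl⟩ : ∃ N : ∀ j, T j, N j = Q :=
    ⟨Function.update (fun j => (hT j).some) j Q, Function.update_self ..⟩
  obtain ⟨φ, hφ⟩ := (biproductSum L).map_surjective
    (X := M) (Y := N) (biproduct.π (fun j => (L j).obj (M j)) j ≫ γ ≫
      biproduct.ι (fun j => (L j).obj (N j)) j)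
  refine ⟨φ j, ?_⟩
  have h1 : biproduct.map (fun j => (L j).map (φ j)) = biproduct.π (fun j => (L j).obj (M j)) j ≫
    γ ≫ biproduct.ι (fun j => (L j).obj (N j)) j := hφ
  have h2 := congrArg (fun t => biproduct.ι (fun j => (L j).obj (M j)) j ≫ t ≫
    biproduct.π (fun j => (L j).obj (N j)) j) h1
  simpa using h2

/-- The image of the functor consists of diagonal matrices. By fullness the matrix with only entry
`γ`, off the diagonal, is such an image, so `γ` vanishes. -/
theorem biproductSum_hom_eq_zero (hT : ∀ j, Nonempty (T j)) (hL : (biproductSum L).Full)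
    {j k : J} (hjk : j ≠ k) {P : T j}
    {Q : T k} (γ : (L j).obj P ⟶ (L k).obj Q) : γ = 0 := by
  classical
  obtain ⟨M, rfl, rfl⟩ : ∃ M : ∀ j, T j, M j = P ∧ M k = Q :=
    ⟨Function.update (Function.update (fun j => (hT j).some) j P) k Q,
      by rw [Function.update_of_ne hjk, Function.update_self], Function.update_self ..⟩
  obtain ⟨φ, hφ⟩ := (biproductSum L).map_surjective
    (X := M) (Y := M) (biproduct.π (fun j => (L j).obj (M j)) j ≫ γ ≫
      biproduct.ι (fun j => (L j).obj (M j)) k)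
  have h1 : biproduct.map (fun j => (L j).map (φ j)) = biproduct.π (fun j => (L j).obj (M j)) j ≫
    γ ≫ biproduct.ι (fun j => (L j).obj (M j)) k := hφ
  have h2 := congrArg (fun t => biproduct.ι (fun j => (L j).obj (M j)) j ≫ t ≫
    biproduct.π (fun j => (L j).obj (M j)) k) h1
  simpa [biproduct.ι_π_ne_assoc _ hjk] using h2.symm

end BiproductSum

theorem biproduct_total {V : Type*} [Category* V] [Preadditive V] {J : Type*} [Fintype J]
    (f : J → V) [HasBiproduct f] :
    ∑ j, biproduct.π f j ≫ biproduct.ι f j = 𝟙 (⨁ f) := by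
  classical
  refine biproduct.hom_ext _ _ fun k => ?_
  rw [Preadditive.sum_comp, Finset.sum_eq_single k, Category.assoc, biproduct.ι_π_self]
  · simp
  · intro j _ hj
    rw [Category.assoc, biproduct.ι_π_ne _ hj, comp_zero]
  · simp

theorem retract_biproduct_trans {V : Type v} [Category.{w} V] [Preadditive V] {J : Type*}
    [Fintype J] {h : V} {f : J → V} [HasBiproduct f] (p : h ⟶ ⨁ f) (q : ⨁ f ⟶ h)
    (hpq : p ≫ q = 𝟙 h) :
    ∑ j, (p ≫ biproduct.π f j) ≫ biproduct.ι f j ≫ q = 𝟙 h := by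
  have h1 : ∀ j, (p ≫ biproduct.π f j) ≫ biproduct.ι f j ≫ q =
      p ≫ (biproduct.π f j ≫ biproduct.ι f j) ≫ q := fun j => by simp
  simp only [h1]
  rw [← Preadditive.comp_sum, ← Preadditive.sum_comp, biproduct_total, Category.id_comp, hpq]

/-! ### 2-morphisms between composites through the horizontal basis. -/

namespace MonTwoCat

section HorizontalSum

variable {F : Type x} [Field F] {C : MonTwoCat.{u, v, w}}
  [∀ A B, Preadditive (C.Hom1 A B)] [∀ A B, Linear F (C.Hom1 A B)] {E : Finset C.Obj}

theorem nonempty_twoVectTensor (A B : C.Obj) (X : {X // X ∈ E}) :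
    Nonempty (TwoVectTensor F (C.Hom1 A X.1) (C.Hom1 X.1 B)) := ⟨⟨PEmpty, PEmpty.elim⟩⟩

variable [VectLinear F C]

/-- The summand of `horizontalSum` at `X`. -/
noncomputable abbrev horizontalSummand (F : Type x) [Field F] (C : MonTwoCat.{u, v, w})
    [∀ A B, Preadditive (C.Hom1 A B)] [∀ A B, Linear F (C.Hom1 A B)] [VectLinear F C]
    (A X B : C.Obj) : TwoVectTensor F (C.Hom1 A X) (C.Hom1 X B) ⥤ C.Hom1 A B :=
  haveI := hasFiniteBiproducts F C A B
  Mat_.lift (compFunctor F C A X B)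

/-- The image of a formal tensor product under `horizontalSummand` is the composite. -/
noncomputable def horizontalSummandIso (A X B : C.Obj) :
    Mat_.embedding _ ⋙ horizontalSummand F C A X B ≅ compFunctor F C A X B :=
  haveI := hasFiniteBiproducts F C A B
  Mat_.embeddingLiftIso _

theorem isEquivalence_of_isHorizontalBasis (hE : C.IsHorizontalBasis F E) (A B : C.Obj)
    [HasFiniteBiproducts (C.Hom1 A B)] :
    (biproductSum fun X : {X // X ∈ E} => horizontalSummand F C A X.1 B).IsEquivalence :=
  hE.2.2 A B

/-- Horizontal composition is an isomorphism on tensor products of spaces of 2-morphisms, for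
1-morphisms factoring through an object of the horizontal basis. -/
theorem comp2_lift_bijective (hE : C.IsHorizontalBasis F E) {X : C.Obj} (hX : X ∈ E) {A B : C.Obj}
    (f f' : C.Hom1 A X) (g g' : C.Hom1 X B) :
    Function.Bijective (TensorProduct.lift (comp2Bilin F C f f' g g')) := by
  have := hasFiniteBiproducts F C A B
  have hE' := isEquivalence_of_isHorizontalBasis hE A B
  let Φ := fun X : {X // X ∈ E} => horizontalSummand F C A X.1 B
  let G := compFunctor F C A X B
  let L := Mat_.embedding _ ⋙ horizontalSummand F C A X B
  let e : L ≅ G := horizontalSummandIso A X B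
  have h1 : Function.Bijective (L.map : (LinTensor.mk f g ⟶ LinTensor.mk f' g') → _) := by
    have h2 : Function.Bijective ((horizontalSummand F C A X B).map :
        ((Mat_.embedding _).obj (LinTensor.mk f g) ⟶ (Mat_.embedding _).obj (LinTensor.mk f' g')) →
          _) :=
      ⟨biproductSum_map_injective Φ (nonempty_twoVectTensor A B) inferInstance ⟨X, hX⟩,
        biproductSum_map_surjective Φ (nonempty_twoVectTensor A B) inferInstance ⟨X, hX⟩⟩
    exact h2.comp ⟨Functor.map_injective _, Functor.map_surjective _⟩
  have h3 : Function.Bijective (G.map : (LinTensor.mk f g ⟶ LinTensor.mk f' g') → _) := by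
    have h4 : (G.map : (LinTensor.mk f g ⟶ LinTensor.mk f' g') → _) =
        fun φ => (e.app _).inv ≫ L.map φ ≫ (e.app _).hom := by
      funext φ
      rw [Iso.eq_inv_comp]
      exact (e.hom.naturality φ).symm
    rw [h4]
    exact ((e.app _).homCongr (e.app _)).bijective.comp h1
  exact h3

/-- Composites through X and through Y come from different summands of a full direct sum of
functors. -/
theorem comp1_hom_eq_zero (hE : C.IsHorizontalBasis F E) {X Y : C.Obj} (hX : X ∈ E) (hY : Y ∈ E)
    (hXY : X ≠ Y) {A B : C.Obj} (f : C.Hom1 A X) (g : C.Hom1 X B) (f' : C.Hom1 A Y)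
    (g' : C.Hom1 Y B) (γ : C.comp1 f g ⟶ C.comp1 f' g') : γ = 0 := by
  have := hasFiniteBiproducts F C A B
  have hE' := isEquivalence_of_isHorizontalBasis hE A B
  let e : _ ≅ C.comp1 f g := (horizontalSummandIso (F := F) A X B).app (LinTensor.mk f g)
  let e' : _ ≅ C.comp1 f' g' := (horizontalSummandIso (F := F) A Y B).app (LinTensor.mk f' g')
  have h1 : e.hom ≫ γ ≫ e'.inv = 0 :=
    biproductSum_hom_eq_zero (fun X : {X // X ∈ E} => horizontalSummand F C A X.1 B)
      (nonempty_twoVectTensor A B) inferInstance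
      (j := ⟨X, hX⟩) (k := ⟨Y, hY⟩) (fun h => hXY (congrArg Subtype.val h)) _
  rw [← cancel_epi e.hom, ← cancel_mono e'.inv, Category.assoc, h1, comp_zero, zero_comp]

/-- Every 1-morphism is a retract of a finite sum of 1-morphisms factoring through the horizontal
basis. -/
theorem exists_decomposition (hE : C.IsHorizontalBasis F E) {A B : C.Obj} (h : C.Hom1 A B) :
    ∃ (ι : Type u) (_ : Fintype ι) (X : ι → C.Obj) (_ : ∀ i, X i ∈ E) (f : ∀ i, C.Hom1 A (X i))
      (g : ∀ i, C.Hom1 (X i) B) (a : ∀ i, h ⟶ C.comp1 (f i) (g i))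
      (b : ∀ i, C.comp1 (f i) (g i) ⟶ h), ∑ i, a i ≫ b i = 𝟙 h := by
  have := hasFiniteBiproducts F C A B
  have hE' := isEquivalence_of_isHorizontalBasis hE A B
  let Φ := biproductSum fun X : {X // X ∈ E} => horizontalSummand F C A X.1 B
  let M := Φ.objPreimage h
  let f := fun (X : {X // X ∈ E}) (i : (M X).ι) => C.comp1 ((M X).X i).fst ((M X).X i).snd
  let e : (⨁ fun X : {X // X ∈ E} => ⨁ f X) ≅ h := Φ.objObjPreimageIso h
  have h1 := retract_biproduct_trans e.inv e.hom e.inv_hom_id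
  let κ := fun X => biproduct.ι (fun X : {X // X ∈ E} => ⨁ f X) X
  let ρ := fun X => biproduct.π (fun X : {X // X ∈ E} => ⨁ f X) X
  refine ⟨Σ X : {X // X ∈ E}, (M X).ι, inferInstance, fun z => z.1.1, fun z => z.1.2,
    fun z => ((M z.1).X z.2).fst, fun z => ((M z.1).X z.2).snd,
    fun z => e.inv ≫ ρ z.1 ≫ biproduct.π (f z.1) z.2,
    fun z => biproduct.ι (f z.1) z.2 ≫ κ z.1 ≫ e.hom, ?_⟩
  rw [Fintype.sum_sigma, ← h1]
  refine Finset.sum_congr rfl fun X _ => ?_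
  have h2 : ∀ i, (e.inv ≫ ρ X ≫ biproduct.π (f X) i) ≫ biproduct.ι (f X) i ≫ κ X ≫ e.hom =
      (e.inv ≫ ρ X) ≫ (biproduct.π (f X) i ≫ biproduct.ι (f X) i) ≫ κ X ≫ e.hom :=
    fun i => by simp only [Category.assoc]
  simp only [h2]
  rw [← Preadditive.comp_sum, ← Preadditive.sum_comp, biproduct_total, Category.id_comp]

end HorizontalSum

end MonTwoCat

/-! ### Typed 2-morphisms and the equivalence relation on objects. -/

namespace TwoCat

variable {C : TwoCat.{u, v, w}} {A B D X : C.Obj}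

theorem hom_ext {f g : C.Hom1 A B} {α β : f ⟶ g} (h : C.cellOf α = C.cellOf β) : α = β :=
  Hom2.ext h

/-- A typed 2-morphism with a given underlying cell. -/
def homMk {f g : C.Hom1 A B} (α : C.Cell) (h : C.IsCell α f.mor g.mor) : f ⟶ g := Hom2.mk α h

@[simp] theorem cellOf_id (f : C.Hom1 A B) : C.cellOf (𝟙 f) = C.idc f.mor := rfl

@[simp] theorem cellOf_comp {f g h : C.Hom1 A B} (α : f ⟶ g) (β : g ⟶ h) :
    C.cellOf (α ≫ β) = C.cellOf α ⬝₂ C.cellOf β := rfl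

theorem isCell_cellOf {f g : C.Hom1 A B} (α : f ⟶ g) : C.IsCell (C.cellOf α) f.mor g.mor :=
  Hom2.isCell α

/-- The isomorphism between 1-morphisms with equal underlying cells. -/
def isoOfEq {f g : C.Hom1 A B} (h : f.mor = g.mor) : f ≅ g := eqToIso (Hom1.ext h)

/-- Transport of 2-morphisms along equations of 1-morphisms. -/
def recast {f g f' g' : C.Hom1 A B} (hf : f.mor = f'.mor) (hg : g.mor = g'.mor) (α : f ⟶ g) :
    f' ⟶ g' :=
  homMk (C.cellOf α) ⟨(isCell_cellOf α).1.trans hf, (isCell_cellOf α).2.trans hg⟩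

@[simp] theorem cellOf_recast {f g f' g' : C.Hom1 A B} (hf : f.mor = f'.mor)
    (hg : g.mor = g'.mor) (α : f ⟶ g) : C.cellOf (recast hf hg α) = C.cellOf α := rfl

/-- Transport of 2-morphisms along equations of 1-morphisms, as a linear equivalence. -/
def recastEquiv (F : Type x) [Field F] [Preadditive (C.Hom1 A B)] [Linear F (C.Hom1 A B)]
    {f g f' g' : C.Hom1 A B} (hf : f.mor = f'.mor) (hg : g.mor = g'.mor) :
    (f ⟶ g) ≃ₗ[F] (f' ⟶ g') where
  toFun := recast hf hg
  invFun := recast hf.symm hg.symm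
  left_inv _ := rfl
  right_inv _ := rfl
  map_add' α β := by
    obtain rfl := Hom1.ext hf
    obtain rfl := Hom1.ext hg
    rfl
  map_smul' c α := by
    obtain rfl := Hom1.ext hf
    obtain rfl := Hom1.ext hg
    rfl

theorem recast_eq_zero_iff [Preadditive (C.Hom1 A B)] {f g f' g' : C.Hom1 A B}
    (hf : f.mor = f'.mor) (hg : g.mor = g'.mor) (α : f ⟶ g) : recast hf hg α = 0 ↔ α = 0 := by
  obtain rfl := Hom1.ext hf
  obtain rfl := Hom1.ext hg
  rfl

theorem one_comp1 (f : C.Hom1 A B) : (C.comp1 (C.one1 A) f).mor = f.mor := by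
  have := C.laws.one_comp f.mor
  rwa [f.isMor.1] at this

theorem comp1_one (f : C.Hom1 A B) : (C.comp1 f (C.one1 B)).mor = f.mor := by
  have := C.laws.comp_one f.mor
  rwa [f.isMor.2] at this

theorem comp1_assoc (f : C.Hom1 A B) (g : C.Hom1 B D) (h : C.Hom1 D X) :
    (C.comp1 (C.comp1 f g) h).mor = (C.comp1 f (C.comp1 g h)).mor :=
  C.laws.comp_assoc _ _ _ (f.isMor.2.trans g.isMor.1.symm) (g.isMor.2.trans h.isMor.1.symm)

theorem cellOf_one_comp2 {f g : C.Hom1 A B} (α : f ⟶ g) :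
    C.cellOf (C.comp2 (𝟙 (C.one1 A)) α) = C.cellOf α := by
  have := C.laws.one_hcomp (C.cellOf α)
  rwa [(isCell_cellOf α).1, f.isMor.1] at this

theorem cellOf_comp2_one {f g : C.Hom1 A B} (α : f ⟶ g) :
    C.cellOf (C.comp2 α (𝟙 (C.one1 B))) = C.cellOf α := by
  have := C.laws.hcomp_one (C.cellOf α)
  rwa [(isCell_cellOf α).1, f.isMor.2] at this

/-- Horizontal composition of invertible 2-morphisms. -/
def comp2Iso {f f' : C.Hom1 A B} {g g' : C.Hom1 B D} (α : f ≅ f') (β : g ≅ g') :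
    C.comp1 f g ≅ C.comp1 f' g' where
  hom := C.comp2 α.hom β.hom
  inv := C.comp2 α.inv β.inv
  hom_inv_id := by rw [← C.comp2_comp, α.hom_inv_id, β.hom_inv_id, C.comp2_id]
  inv_hom_id := by rw [← C.comp2_comp, α.inv_hom_id, β.inv_hom_id, C.comp2_id]

/-- 2-endomorphisms of an identity 1-morphism commute. -/
theorem end_one_comm (α β : C.one1 A ⟶ C.one1 A) : α ≫ β = β ≫ α := by
  -- Eckmann–Hilton: by interchange the horizontal composite equals the vertical composite in either
  -- order.
  have h : ∀ γ δ : C.one1 A ⟶ C.one1 A, C.cellOf (C.comp2 γ δ) = C.cellOf (γ ≫ δ) := by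
    intro γ δ
    have h1 : C.comp2 γ δ = C.comp2 γ (𝟙 _) ≫ C.comp2 (𝟙 _) δ := by
      rw [← C.comp2_comp, Category.comp_id, Category.id_comp]
    rw [h1, cellOf_comp, cellOf_comp2_one, cellOf_one_comp2, cellOf_comp]
  have h' : ∀ γ δ : C.one1 A ⟶ C.one1 A, C.cellOf (C.comp2 γ δ) = C.cellOf (δ ≫ γ) := by
    intro γ δ
    have h1 : C.comp2 γ δ = C.comp2 (𝟙 _) δ ≫ C.comp2 γ (𝟙 _) := by
      rw [← C.comp2_comp, Category.comp_id, Category.id_comp]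
    rw [h1, cellOf_comp, cellOf_comp2_one, cellOf_one_comp2, cellOf_comp]
  exact hom_ext ((h α β).symm.trans (h' α β))

theorem Equivalent.refl (A : C.Obj) : C.Equivalent A A :=
  ⟨C.one1 A, C.one1 A, ⟨isoOfEq (one_comp1 _)⟩, ⟨isoOfEq (one_comp1 _)⟩⟩

theorem Equivalent.symm (h : C.Equivalent A B) : C.Equivalent B A := by
  obtain ⟨f, g, h1, h2⟩ := h
  exact ⟨g, f, h2, h1⟩

/-- If `gh ≅ 1` and `fk ≅ 1`, then `(fg)(hk) ≅ 1`. -/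
def compCancelIso {f : C.Hom1 A B} {k : C.Hom1 B A} {g : C.Hom1 B D} {h : C.Hom1 D B}
    (e : C.comp1 g h ≅ C.one1 B) (e' : C.comp1 f k ≅ C.one1 A) :
    C.comp1 (C.comp1 f g) (C.comp1 h k) ≅ C.one1 A :=
  isoOfEq (comp1_assoc _ _ _) ≪≫ comp2Iso (Iso.refl f) (isoOfEq (comp1_assoc g h k).symm ≪≫
    comp2Iso e (Iso.refl k) ≪≫ isoOfEq (one_comp1 k)) ≪≫ e'

theorem Equivalent.trans (h : C.Equivalent A B) (h' : C.Equivalent B D) : C.Equivalent A D := by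
  obtain ⟨f, k, ⟨e1⟩, ⟨e2⟩⟩ := h
  obtain ⟨g, h, ⟨e3⟩, ⟨e4⟩⟩ := h'
  exact ⟨C.comp1 f g, C.comp1 h k, ⟨compCancelIso e3 e1⟩, ⟨compCancelIso e2 e4⟩⟩

end TwoCat

theorem exists_functional {F : Type x} [Field F] {V : Type w} [AddCommGroup V] [Module F V]
    {m : V} (hm : m ≠ 0) : ∃ φ : V →ₗ[F] F, φ m = 1 := by
  obtain ⟨φ, hφ⟩ : ∃ φ : Module.Dual F V, φ m ≠ 0 := by
    by_contra! h
    exact hm ((Module.forall_dual_apply_eq_zero_iff F m).1 h)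
  exact ⟨(φ m)⁻¹ • φ, inv_mul_cancel₀ hφ⟩

/-- Contract the left factor with a functional taking the value 1 on `m`. -/
theorem tmul_right_injective {F : Type x} [Field F] {V W : Type w} [AddCommGroup V] [Module F V]
    [AddCommGroup W] [Module F W] {m : V} (hm : m ≠ 0) {y y' : W}
    (h : m ⊗ₜ[F] y = m ⊗ₜ[F] y') : y = y' := by
  obtain ⟨φ, hφ⟩ := exists_functional (F := F) hm
  have := congrArg (TensorProduct.lid F W ∘ TensorProduct.map φ LinearMap.id) h
  simpa [hφ] using this

/-! ### Simple objects and the horizontal basis. -/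

namespace MonTwoCat

open TwoCat

variable {C : MonTwoCat.{u, v, w}} [∀ A B, Preadditive (C.Hom1 A B)]

theorem zero_comp2 (F : Type x) [Field F] [∀ A B, Linear F (C.Hom1 A B)] [VectLinear F C]
    {A B D : C.Obj} {f f' : C.Hom1 A B} {g g' : C.Hom1 B D} (β : g ⟶ g') :
    C.comp2 (0 : f ⟶ f') β = 0 :=
  LinearMap.map_zero₂ (comp2Bilin F C f f' g g') β

theorem comp2_zero (F : Type x) [Field F] [∀ A B, Linear F (C.Hom1 A B)] [VectLinear F C]
    {A B D : C.Obj} {f f' : C.Hom1 A B} {g g' : C.Hom1 B D} (α : f ⟶ f') :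
    C.comp2 α (0 : g ⟶ g') = 0 :=
  map_zero (comp2Bilin F C f f' g g' α)

theorem sum_comp2 (F : Type x) [Field F] [∀ A B, Linear F (C.Hom1 A B)] [VectLinear F C]
    {A B D : C.Obj} {f f' : C.Hom1 A B} {g g' : C.Hom1 B D} {ι : Type*}
    (s : Finset ι) (α : ι → (f ⟶ f')) (β : g ⟶ g') :
    C.comp2 (∑ i ∈ s, α i) β = ∑ i ∈ s, C.comp2 (α i) β :=
  LinearMap.map_sum₂ (comp2Bilin F C f f' g g') s α β

theorem comp2_sum (F : Type x) [Field F] [∀ A B, Linear F (C.Hom1 A B)] [VectLinear F C]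
    {A B D : C.Obj} {f f' : C.Hom1 A B} {g g' : C.Hom1 B D} {ι : Type*}
    (s : Finset ι) (α : f ⟶ f') (β : ι → (g ⟶ g')) :
    C.comp2 α (∑ i ∈ s, β i) = ∑ i ∈ s, C.comp2 α (β i) :=
  map_sum (comp2Bilin F C f f' g g' α) β s

/-- Every 2-morphism out of `f` is unchanged by whiskering with `1_A`; if the identity of `1_A` were
zero, that whiskering would kill the identity of `f`. -/
theorem id_ne_zero_of_id_ne_zero (F : Type x) [Field F] [∀ A B, Linear F (C.Hom1 A B)] [VectLinear F C]
    {A B : C.Obj} {f : C.Hom1 A B} (hf : 𝟙 f ≠ 0) :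
    𝟙 (C.one1 A) ≠ 0 := by
  intro h0
  refine hf ?_
  have h1 : C.comp2 (𝟙 (C.one1 A)) (𝟙 f) = 0 := by rw [h0, zero_comp2 F]
  refine (hom_ext ?_).trans ((recast_eq_zero_iff (one_comp1 f) (one_comp1 f) _).2 h1)
  rw [cellOf_recast, cellOf_one_comp2]

/-- Equality in a `Quot` yields only the generated equivalence relation, but equivalence of objects
already is one. -/
theorem equivalent_of_simpleClasses_eq {F : Type x} [Field F] [∀ A B, Linear F (C.Hom1 A B)]
    {A B : {A : C.Obj // IsSimpleObj F C A}}
    (h : (Quot.mk _ A : SimpleClasses F C) = Quot.mk _ B) : C.Equivalent A.1 B.1 := by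
  have h1 : _root_.Equivalence fun A B : {A : C.Obj // IsSimpleObj F C A} =>
      C.Equivalent A.1 B.1 := ⟨fun _ => Equivalent.refl _, Equivalent.symm, Equivalent.trans⟩
  exact h1.eqvGen_iff.1 (Quot.eqvGen_exact h)

variable {F : Type x} [Field F] [∀ A B, Linear F (C.Hom1 A B)] [VectLinear F C]

variable (F) in
theorem exists_splitFamily (A B : C.Obj) :
    ∃ (n : ℕ) (S : Fin n → C.Hom1 A B), IsSplitFamily F S := by
  obtain ⟨n, hn⟩ := VectLinear.twoVect (F := F) A B
  exact ⟨n, hn.exists_splitFamily⟩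

variable {E : Finset C.Obj}

/-- Whiskering φ with `1_X` on the left or on the right gives φ. Injectivity of composition on
tensors turns this into φ ⊗ 1 = 1 ⊗ φ, which forces φ to be a scalar. -/
theorem isSplit_one_of_mem (hE : C.IsHorizontalBasis F E) {X : C.Obj} (hX : X ∈ E) :
    IsSplit F (C.one1 X) := by
  obtain ⟨f, hf⟩ := hE.1 X hX
  have h0 : 𝟙 (C.one1 X) ≠ 0 :=
    id_ne_zero_of_id_ne_zero F fun h => hf ((IsZero.iff_id_eq_zero f).2 h)
  refine isSplit_of h0 fun φ => ?_
  have h1 : φ ⊗ₜ[F] 𝟙 (C.one1 X) = 𝟙 (C.one1 X) ⊗ₜ[F] φ := by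
    apply (comp2_lift_bijective hE hX (C.one1 X) (C.one1 X) (C.one1 X) (C.one1 X)).1
    rw [TensorProduct.lift.tmul, TensorProduct.lift.tmul]
    exact hom_ext ((cellOf_comp2_one φ).trans (cellOf_one_comp2 φ).symm)
  obtain ⟨ψ, hψ⟩ := exists_functional (F := F) h0
  refine ⟨ψ φ, ?_⟩
  have h2 := congrArg (TensorProduct.lid F _ ∘ TensorProduct.map ψ LinearMap.id) h1
  simpa [hψ] using h2.symm

/-- The identity of g, read as a 2-morphism `1_X g ⇒ g 1_X`, lies in the image of 2Hom(1_X, g) ⊗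
2Hom(g, 1_X). So the first factor is non-zero, and a non-zero map between split simple objects makes
them isomorphic. -/
theorem iso_one_of_isSplit (hE : C.IsHorizontalBasis F E) {X : C.Obj} (hX : X ∈ E)
    {g : C.Hom1 X X} (hg : IsSplit F g) : Nonempty (g ≅ C.one1 X) := by
  obtain ⟨n, S, hS⟩ := exists_splitFamily F X X
  obtain ⟨α, hα⟩ : ∃ α : C.one1 X ⟶ g, α ≠ 0 := by
    by_contra! h0
    obtain ⟨t, ht⟩ := (comp2_lift_bijective hE hX (C.one1 X) g g (C.one1 X)).2
      (recast (one_comp1 g).symm (comp1_one g).symm (𝟙 g))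
    apply hg.id_ne_zero
    rw [← recast_eq_zero_iff (one_comp1 g).symm (comp1_one g).symm, ← ht]
    clear ht
    induction t using TensorProduct.induction_on with
    | zero => simp
    | tmul a b => rw [h0 a, TensorProduct.zero_tmul, map_zero]
    | add a b ha hb => rw [map_add, ha, hb, add_zero]
  obtain ⟨e⟩ := hS.iso_of_ne_zero (isSplit_one_of_mem hE hX) hg α hα
  exact ⟨e.symm⟩

/-- Reading h once as `1_X h` and once as `h 1_Y` places it in two different summands. -/
theorem id_eq_zero_of_ne (hE : C.IsHorizontalBasis F E) {X Y : C.Obj} (hX : X ∈ E) (hY : Y ∈ E)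
    (hXY : X ≠ Y) (h : C.Hom1 X Y) : 𝟙 h = 0 := by
  rw [← recast_eq_zero_iff (one_comp1 h).symm (comp1_one h).symm]
  exact comp1_hom_eq_zero hE hX hY hXY _ _ _ _ _

theorem isSimpleObj_of_mem (hE : C.IsHorizontalBasis F E) {X : C.Obj} (hX : X ∈ E) :
    IsSimpleObj F C X := by
  obtain ⟨n, hn⟩ := VectLinear.twoVect (F := F) X X
  exact hn.rank_one (isSplit_one_of_mem hE hX) fun _ ht => iso_one_of_isSplit hE hX ht

/-- Rank one alone allows `1_A` to be a multiple of the simple object; commutativity of 2End(1_A)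
excludes multiplicity above one. -/
theorem isSplit_one_of_isSimpleObj {A : C.Obj} (hA : IsSimpleObj F C A) :
    IsSplit F (C.one1 A) := by
  obtain ⟨S, hS⟩ := hA.exists_splitFamily
  exact hA.isSplit_of_commutative (id_ne_zero_of_id_ne_zero F (hS.split 0).id_ne_zero)
    end_one_comm

/-- Endomorphisms of fg are sums of composites of endomorphisms of f and of g, all of which are
scalars. -/
theorem isSplit_comp1 (hE : C.IsHorizontalBasis F E) {X : C.Obj} (hX : X ∈ E) {A B : C.Obj}
    {f : C.Hom1 A X} {g : C.Hom1 X B} (hf : IsSplit F f) (hg : IsSplit F g) 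
    (h0 : 𝟙 (C.comp1 f g) ≠ 0) : IsSplit F (C.comp1 f g) := by
  refine isSplit_of h0 fun φ => ?_
  obtain ⟨t, rfl⟩ := (comp2_lift_bijective hE hX f f g g).2 φ
  induction t using TensorProduct.induction_on with
  | zero => exact ⟨0, by simp⟩
  | tmul a b =>
    obtain ⟨c, rfl⟩ := hf.exists_smul a
    obtain ⟨d, rfl⟩ := hg.exists_smul b
    refine ⟨c * d, ?_⟩
    rw [TensorProduct.lift.tmul]
    refine (VectLinear.smul_comp2 _ _ _).trans ?_
    rw [VectLinear.comp2_smul, C.comp2_id, smul_smul]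
  | add a b ha hb =>
    obtain ⟨c, hc⟩ := ha
    obtain ⟨d, hd⟩ := hb
    exact ⟨c + d, by rw [map_add, hc, hd, add_smul]⟩

theorem comp2_id_injective (hE : C.IsHorizontalBasis F E) {X : C.Obj} (hX : X ∈ E) {A B : C.Obj}
    {f : C.Hom1 A X} (hf : 𝟙 f ≠ 0) {g g' : C.Hom1 X B} {γ γ' : g ⟶ g'}
    (h : C.comp2 (𝟙 f) γ = C.comp2 (𝟙 f) γ') : γ = γ' :=
  tmul_right_injective (F := F) hf ((comp2_lift_bijective hE hX f f g g').1 h)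

/-- Decomposing `1_A` through E and then into simple factors yields simple f : A → X and g : X → A
with a non-zero component of `1_A` through fg. Both being split simple, fg ≅ 1_A; the other
composite is then pinned down by its action on f. -/
theorem exists_equivalent_mem (hE : C.IsHorizontalBasis F E) {A : C.Obj}
    (hA : IsSimpleObj F C A) : ∃ X ∈ E, C.Equivalent A X := by
  have hA1 := isSplit_one_of_isSimpleObj hA
  obtain ⟨ι, _, X, hX, f, g, a, b, hab⟩ := exists_decomposition hE (C.one1 A)
  obtain ⟨i, -, hi⟩ := Finset.exists_ne_zero_of_sum_ne_zero (hab ▸ hA1.id_ne_zero)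
  obtain ⟨n, S, hS⟩ := exists_splitFamily F A (X i)
  obtain ⟨n', S', hS'⟩ := exists_splitFamily F (X i) A
  obtain ⟨κ, _, k, p, q, hpq⟩ := hS.decomposition (f i)
  obtain ⟨κ', _, k', p', q', hpq'⟩ := hS'.decomposition (g i)
  have h1 : ∃ j j', (a i ≫ C.comp2 (p j) (p' j')) ≫ C.comp2 (q j) (q' j') ≫ b i ≠ 0 := by
    by_contra! h0
    apply hi
    rw [← Category.id_comp (b i), ← C.comp2_id, ← hpq, ← hpq', sum_comp2 F,
      Preadditive.sum_comp, Preadditive.comp_sum]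
    refine Finset.sum_eq_zero fun j _ => ?_
    rw [comp2_sum F, Preadditive.sum_comp, Preadditive.comp_sum]
    refine Finset.sum_eq_zero fun j' _ => ?_
    rw [C.comp2_comp, ← h0 j j']
    simp only [Category.assoc]
  obtain ⟨j, j', hjj⟩ := h1
  have hf := hS.split (k j)
  have hg := hS'.split (k' j')
  set f := S (k j)
  set g := S' (k' j')
  have hfg : IsSplit F (C.comp1 f g) := by
    refine isSplit_comp1 hE (hX i) hf hg fun h0 => hjj ?_
    rw [← Category.comp_id (a i ≫ C.comp2 (p j) (p' j')), h0, comp_zero, zero_comp]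
  obtain ⟨e⟩ := hA1.iso_of_comp_ne_zero hfg _ _ hjj
  -- Since f ≅ f(gf), whiskering with f embeds 2End(gf) into 2End(f(gf)) = F. So gf is split simple
  -- in End(X), hence isomorphic to `1_X`.
  have e' : f ≅ C.comp1 f (C.comp1 g f) := isoOfEq (one_comp1 f).symm ≪≫
    comp2Iso e (Iso.refl f) ≪≫ isoOfEq (comp1_assoc f g f)
  have hfgf := hf.of_iso e'
  have hgf : IsSplit F (C.comp1 g f) := by
    refine isSplit_of (fun h0 => hfgf.id_ne_zero ?_) fun φ => ?_
    · rw [← C.comp2_id, h0, comp2_zero F]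
    · obtain ⟨c, hc⟩ := hfgf.exists_smul (C.comp2 (𝟙 f) φ)
      refine ⟨c, comp2_id_injective hE (hX i) hf.id_ne_zero ?_⟩
      rw [hc, VectLinear.comp2_smul, C.comp2_id]
  obtain ⟨e''⟩ := iso_one_of_isSplit hE (hX i) hgf
  exact ⟨X i, hX i, f, g, ⟨e.symm⟩, ⟨e''⟩⟩

/-- The equivalence classes of simple objects are represented by the horizontal basis. -/
theorem simpleClasses_equiv (hE : C.IsHorizontalBasis F E) :
    Nonempty ({X // X ∈ E} ≃ SimpleClasses F C) := by
  refine ⟨Equiv.ofBijective (fun X => Quot.mk _ ⟨X.1, isSimpleObj_of_mem hE X.2⟩) ⟨?_, ?_⟩⟩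
  · intro X Y h
    exact Subtype.ext (hE.2.1 _ X.2 _ Y.2 (equivalent_of_simpleClasses_eq h))
  · rintro ⟨A, hA⟩
    obtain ⟨X, hX, h⟩ := exists_equivalent_mem hE hA
    exact ⟨⟨X, hX⟩, Quot.sound h.symm⟩

end MonTwoCat

/-! # Calculus of cells -/

namespace TwoCat

section Cells

variable {C : TwoCat.{u, v, w}}

@[simp] theorem src_one (A : C.Obj) : C.src (C.one A) = A := C.laws.src_one A

@[simp] theorem tgt_one (A : C.Obj) : C.tgt (C.one A) = A := C.laws.tgt_one A

@[simp] theorem dom_idc (f : C.Mor) : C.dom (C.idc f) = f := C.laws.dom_idc f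

@[simp] theorem cod_idc (f : C.Mor) : C.cod (C.idc f) = f := C.laws.cod_idc f

@[simp] theorem src_comp {f g : C.Mor} (h : C.tgt f = C.src g) : C.src (f ⬝₁ g) = C.src f :=
  C.laws.src_comp f g h

@[simp] theorem tgt_comp {f g : C.Mor} (h : C.tgt f = C.src g) : C.tgt (f ⬝₁ g) = C.tgt g :=
  C.laws.tgt_comp f g h

@[simp] theorem dom_vcomp {α β : C.Cell} (h : C.cod α = C.dom β) : C.dom (α ⬝₂ β) = C.dom α :=
  C.laws.dom_vcomp α β h

@[simp] theorem cod_vcomp {α β : C.Cell} (h : C.cod α = C.dom β) : C.cod (α ⬝₂ β) = C.cod β :=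
  C.laws.cod_vcomp α β h

@[simp] theorem dom_hcomp {α β : C.Cell} (h : C.tgt (C.dom α) = C.src (C.dom β)) :
    C.dom (α ∘₂ β) = C.dom α ⬝₁ C.dom β := C.laws.dom_hcomp α β h

@[simp] theorem cod_hcomp {α β : C.Cell} (h : C.tgt (C.dom α) = C.src (C.dom β)) :
    C.cod (α ∘₂ β) = C.cod α ⬝₁ C.cod β := C.laws.cod_hcomp α β h

@[simp] theorem one_comp {A : C.Obj} {f : C.Mor} (h : C.src f = A) : C.one A ⬝₁ f = f := by
  subst h; exact C.laws.one_comp f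

@[simp] theorem comp_one {A : C.Obj} {f : C.Mor} (h : C.tgt f = A) : f ⬝₁ C.one A = f := by
  subst h; exact C.laws.comp_one f

@[simp] theorem comp_assoc {f g h : C.Mor} (h1 : C.tgt f = C.src g) (h2 : C.tgt g = C.src h) :
    (f ⬝₁ g) ⬝₁ h = f ⬝₁ (g ⬝₁ h) := C.laws.comp_assoc f g h h1 h2

theorem idc_vcomp {f : C.Mor} {α : C.Cell} (h : C.dom α = f) : C.idc f ⬝₂ α = α := by
  subst h; exact C.laws.idc_vcomp α

theorem vcomp_idc {f : C.Mor} {α : C.Cell} (h : C.cod α = f) : α ⬝₂ C.idc f = α := by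
  subst h; exact C.laws.vcomp_idc α

theorem vcomp_assoc {α β γ : C.Cell} (h1 : C.cod α = C.dom β) (h2 : C.cod β = C.dom γ) :
    (α ⬝₂ β) ⬝₂ γ = α ⬝₂ (β ⬝₂ γ) := C.laws.vcomp_assoc α β γ h1 h2

theorem one_hcomp {A : C.Obj} {α : C.Cell} (h : C.src (C.dom α) = A) :
    C.idc (C.one A) ∘₂ α = α := by
  subst h; exact C.laws.one_hcomp α

theorem hcomp_one {A : C.Obj} {α : C.Cell} (h : C.tgt (C.dom α) = A) :
    α ∘₂ C.idc (C.one A) = α := by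
  subst h; exact C.laws.hcomp_one α

theorem hcomp_assoc {α β γ : C.Cell} (h1 : C.tgt (C.dom α) = C.src (C.dom β))
    (h2 : C.tgt (C.dom β) = C.src (C.dom γ)) : (α ∘₂ β) ∘₂ γ = α ∘₂ (β ∘₂ γ) :=
  C.laws.hcomp_assoc α β γ h1 h2

theorem idc_hcomp_idc {f g : C.Mor} (h : C.tgt f = C.src g) :
    C.idc f ∘₂ C.idc g = C.idc (f ⬝₁ g) := C.laws.idc_hcomp_idc f g h

theorem idc_hcomp_vcomp {f : C.Mor} {α β : C.Cell} (h : C.cod α = C.dom β)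
    (h' : C.tgt f = C.src (C.dom α)) :
    C.idc f ∘₂ (α ⬝₂ β) = (C.idc f ∘₂ α) ⬝₂ (C.idc f ∘₂ β) := by
  have := C.laws.interchange (C.idc f) (C.idc f) α β (by simp) h (by simpa)
  rwa [idc_vcomp (by simp)] at this

theorem vcomp_hcomp_idc {f : C.Mor} {α β : C.Cell} (h : C.cod α = C.dom β)
    (h' : C.tgt (C.dom α) = C.src f) :
    (α ⬝₂ β) ∘₂ C.idc f = (α ∘₂ C.idc f) ⬝₂ (β ∘₂ C.idc f) := by
  have := C.laws.interchange α β (C.idc f) (C.idc f) h (by simp) (by simpa)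
  rwa [idc_vcomp (by simp)] at this

theorem hcomp_eq_left_right {f g : C.Mor} {α β : C.Cell} (hα : C.cod α = f) (hβ : C.dom β = g)
    (h : C.tgt (C.dom α) = C.src g) :
    (α ∘₂ C.idc g) ⬝₂ (C.idc f ∘₂ β) = α ∘₂ β := by
  subst hα hβ
  rw [← C.laws.interchange _ _ _ _ (by simp) (by simp) (by simpa), vcomp_idc rfl, idc_vcomp rfl]

theorem hcomp_eq_right_left {f g : C.Mor} {α β : C.Cell} (hα : C.dom α = f) (hβ : C.cod β = g)
    (h : C.tgt f = C.src (C.dom β)) :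
    (C.idc f ∘₂ β) ⬝₂ (α ∘₂ C.idc g) = α ∘₂ β := by
  subst hα hβ
  rw [← C.laws.interchange _ _ _ _ (by simp) (by simp) (by simpa), vcomp_idc rfl, idc_vcomp rfl]

end Cells

end TwoCat

/-! ### The adjunction between h* and h. -/

namespace DualTwoCat

section Cells

variable {C : DualTwoCat.{u, v, w}}

open TwoCat

@[simp] theorem src_dual1 (f : C.Mor) : C.src f⁎₁ = C.tgt f := C.dualLaws.src_dual1 f

@[simp] theorem tgt_dual1 (f : C.Mor) : C.tgt f⁎₁ = C.src f := C.dualLaws.tgt_dual1 f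

@[simp] theorem dom_dual2 (α : C.Cell) : C.dom α⁎₂ = C.cod α := C.dualLaws.dom_dual2 α

@[simp] theorem cod_dual2 (α : C.Cell) : C.cod α⁎₂ = C.dom α := C.dualLaws.cod_dual2 α

@[simp] theorem dom_unit1 (f : C.Mor) : C.dom (C.unit1 f) = C.one (C.src f) :=
  C.dualLaws.dom_unit1 f

@[simp] theorem cod_unit1 (f : C.Mor) : C.cod (C.unit1 f) = f ⬝₁ f⁎₁ := C.dualLaws.cod_unit1 f

@[simp] theorem dom_counit1 (f : C.Mor) : C.dom (C.counit1 f) = f⁎₁ ⬝₁ f :=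
  C.dualLaws.dom_counit1 f

@[simp] theorem cod_counit1 (f : C.Mor) : C.cod (C.counit1 f) = C.one (C.tgt f) :=
  C.dualLaws.cod_counit1 f

@[simp] theorem dual1_dual1 (f : C.Mor) : f⁎₁⁎₁ = f := C.dualLaws.dual1_dual1 f

@[simp] theorem dual1_one (A : C.Obj) : (C.one A)⁎₁ = C.one A := C.dualLaws.dual1_one A

@[simp] theorem dual1_comp {f g : C.Mor} (h : C.tgt f = C.src g) : (f ⬝₁ g)⁎₁ = g⁎₁ ⬝₁ f⁎₁ :=
  C.dualLaws.dual1_comp f g h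

/-- One half of the bijection 2Hom(h*k, m) ≅ 2Hom(k, hm): interchange slides α past the counit,
leaving the triangle identity for h*. -/
theorem counit_transpose_unit {h k m : C.Mor} {α : C.Cell} (hk : C.src k = C.src h)
    (hm : C.src m = C.tgt h) (hα : C.IsCell α (h⁎₁ ⬝₁ k) m) :
    (C.idc h⁎₁ ∘₂ ((C.unit1 h ∘₂ C.idc k) ⬝₂ (C.idc h ∘₂ α))) ⬝₂ (C.counit1 h ∘₂ C.idc m) = α := by
  obtain ⟨h1, h2⟩ := hα
  rw [idc_hcomp_vcomp, vcomp_assoc, ← hcomp_assoc (α := C.idc h⁎₁) (β := C.idc h),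
    idc_hcomp_idc, hcomp_eq_right_left, ← hcomp_eq_left_right (f := C.one (C.tgt h)) _ h1,
    one_hcomp, ← idc_hcomp_idc, ← hcomp_assoc, ← hcomp_assoc, ← vcomp_assoc,
    ← vcomp_hcomp_idc, C.dualLaws.zigzag', idc_hcomp_idc, idc_vcomp h1]
  -- The remaining goals are composability conditions; those of nested composites depend on one
  -- another, hence the larger discharge depth.
  all_goals simp (maxDischargeDepth := 9) [*]

/-- The other half of the bijection, resting on the triangle identity for h. -/
theorem unit_transpose_counit {h k m : C.Mor} {β : C.Cell} (hk : C.src k = C.src h)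
    (hm : C.src m = C.tgt h) (hβ : C.IsCell β k (h ⬝₁ m)) :
    (C.unit1 h ∘₂ C.idc k) ⬝₂ (C.idc h ∘₂ ((C.idc h⁎₁ ∘₂ β) ⬝₂ (C.counit1 h ∘₂ C.idc m))) = β := by
  obtain ⟨h1, h2⟩ := hβ
  rw [idc_hcomp_vcomp, ← vcomp_assoc, ← hcomp_assoc (α := C.idc h) (β := C.idc h⁎₁),
    idc_hcomp_idc, hcomp_eq_left_right, ← hcomp_eq_right_left (f := C.one (C.src h)) _ h2,
    one_hcomp, ← idc_hcomp_idc, ← hcomp_assoc, ← hcomp_assoc, vcomp_assoc,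
    ← vcomp_hcomp_idc, C.dualLaws.zigzag, idc_hcomp_idc, vcomp_idc h2]
  all_goals simp (maxDischargeDepth := 9) [*]

end Cells

end DualTwoCat

/-! ### Sources, targets and strict tensor identities as rewriting rules. -/

namespace MonTwoCat

section Cells

variable {C : MonTwoCat.{u, v, w}}

@[simp] theorem src_ltens (A : C.Obj) (f : C.Mor) : C.src (A ◁₁ f) = A ⊗₀ C.src f :=
  C.monLaws.src_ltens A f

@[simp] theorem tgt_ltens (A : C.Obj) (f : C.Mor) : C.tgt (A ◁₁ f) = A ⊗₀ C.tgt f :=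
  C.monLaws.tgt_ltens A f

@[simp] theorem dom_ltensc (A : C.Obj) (α : C.Cell) : C.dom (A ◁₂ α) = A ◁₁ C.dom α :=
  C.monLaws.dom_ltensc A α

@[simp] theorem cod_ltensc (A : C.Obj) (α : C.Cell) : C.cod (A ◁₂ α) = A ◁₁ C.cod α :=
  C.monLaws.cod_ltensc A α

@[simp] theorem ltens_one (A B : C.Obj) : A ◁₁ C.one B = C.one (A ⊗₀ B) := C.monLaws.ltens_one A B

@[simp] theorem ltens_comp (A : C.Obj) {f g : C.Mor} (h : C.tgt f = C.src g) :
    A ◁₁ (f ⬝₁ g) = (A ◁₁ f) ⬝₁ (A ◁₁ g) := C.monLaws.ltens_comp A f g h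

@[simp] theorem src_rtens (f : C.Mor) (A : C.Obj) : C.src (f ▷₁ A) = C.src f ⊗₀ A :=
  C.monLaws.src_rtens f A

@[simp] theorem tgt_rtens (f : C.Mor) (A : C.Obj) : C.tgt (f ▷₁ A) = C.tgt f ⊗₀ A :=
  C.monLaws.tgt_rtens f A

@[simp] theorem dom_rtensc (α : C.Cell) (A : C.Obj) : C.dom (α ▷₂ A) = C.dom α ▷₁ A :=
  C.monLaws.dom_rtensc α A

@[simp] theorem cod_rtensc (α : C.Cell) (A : C.Obj) : C.cod (α ▷₂ A) = C.cod α ▷₁ A :=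
  C.monLaws.cod_rtensc α A

@[simp] theorem one_rtens (B A : C.Obj) : C.one B ▷₁ A = C.one (B ⊗₀ A) := C.monLaws.one_rtens B A

@[simp] theorem comp_rtens {f g : C.Mor} (A : C.Obj) (h : C.tgt f = C.src g) :
    (f ⬝₁ g) ▷₁ A = (f ▷₁ A) ⬝₁ (g ▷₁ A) := C.monLaws.comp_rtens f g A h

@[simp] theorem I_tens (A : C.Obj) : C.I ⊗₀ A = A := C.monLaws.I_tens A

@[simp] theorem tens_I (A : C.Obj) : A ⊗₀ C.I = A := C.monLaws.tens_I A

@[simp] theorem I_ltens (f : C.Mor) : C.I ◁₁ f = f := C.monLaws.I_ltens f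

@[simp] theorem rtens_I (f : C.Mor) : f ▷₁ C.I = f := C.monLaws.rtens_I f

@[simp] theorem tens_assoc (A B X : C.Obj) : (A ⊗₀ B) ⊗₀ X = A ⊗₀ (B ⊗₀ X) :=
  C.monLaws.tens_assoc A B X

@[simp] theorem ltens_ltens (A B : C.Obj) (f : C.Mor) : (A ⊗₀ B) ◁₁ f = A ◁₁ (B ◁₁ f) :=
  C.monLaws.ltens_ltens A B f

@[simp] theorem ltens_rtens (A : C.Obj) (f : C.Mor) (B : C.Obj) :
    (A ◁₁ f) ▷₁ B = A ◁₁ (f ▷₁ B) := C.monLaws.ltens_rtens A f B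

@[simp] theorem rtens_rtens (f : C.Mor) (A B : C.Obj) : (f ▷₁ A) ▷₁ B = f ▷₁ (A ⊗₀ B) :=
  C.monLaws.rtens_rtens f A B

@[simp] theorem dom_tor (f g : C.Mor) :
    C.dom (C.tor f g) = (f ▷₁ C.src g) ⬝₁ (C.tgt f ◁₁ g) := C.monLaws.dom_tor f g

@[simp] theorem cod_tor (f g : C.Mor) :
    C.cod (C.tor f g) = (C.src f ◁₁ g) ⬝₁ (f ▷₁ C.tgt g) := C.monLaws.cod_tor f g

end Cells

end MonTwoCat

namespace DualTwoCat

section Cells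

variable {C : DualTwoCat.{u, v, w}}

open TwoCat MonTwoCat

@[simp] theorem src_unit0 (A : C.Obj) : C.src (C.unit0 A) = C.I := C.dualLaws.src_unit0 A

@[simp] theorem tgt_unit0 (A : C.Obj) : C.tgt (C.unit0 A) = A ⊗₀ A⁎₀ := C.dualLaws.tgt_unit0 A

@[simp] theorem src_counit0 (A : C.Obj) : C.src (C.counit0 A) = A⁎₀ ⊗₀ A :=
  C.dualLaws.src_counit0 A

@[simp] theorem tgt_counit0 (A : C.Obj) : C.tgt (C.counit0 A) = C.I := C.dualLaws.tgt_counit0 A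

@[simp] theorem dom_triang (A : C.Obj) :
    C.dom (C.triang A) = (C.unit0 A ▷₁ A) ⬝₁ (A ◁₁ C.counit0 A) := C.dualLaws.dom_triang A

@[simp] theorem cod_triang (A : C.Obj) : C.cod (C.triang A) = C.one A := C.dualLaws.cod_triang A

@[simp] theorem dual0_dual0 (A : C.Obj) : A⁎₀⁎₀ = A := C.dualLaws.dual0_dual0 A

@[simp] theorem dual0_tens (A B : C.Obj) : (A ⊗₀ B)⁎₀ = B⁎₀ ⊗₀ A⁎₀ := C.dualLaws.dual0_tens A B

@[simp] theorem dual1_ltens (A : C.Obj) (f : C.Mor) : (A ◁₁ f)⁎₁ = A ◁₁ f⁎₁ :=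
  C.dualLaws.dual1_ltens A f

@[simp] theorem dual1_rtens (f : C.Mor) (A : C.Obj) : (f ▷₁ A)⁎₁ = f⁎₁ ▷₁ A :=
  C.dualLaws.dual1_rtens f A

@[simp] theorem dual1_unit0 (A : C.Obj) : (C.unit0 A)⁎₁ = C.counit0 A⁎₀ :=
  (C.dualLaws.counit0_dual A).symm

@[simp] theorem dual1_counit0 (A : C.Obj) : (C.counit0 A)⁎₁ = C.unit0 A⁎₀ :=
  (C.dualLaws.unit0_dual A).symm

theorem unit0_tens (A B : C.Obj) :
    C.unit0 (A ⊗₀ B) = C.unit0 A ⬝₁ (A ◁₁ C.unit0 B ▷₁ A⁎₀) := C.dualLaws.unit0_tens A B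

/-! ## Adjoints and circles -/

/-- The horizontal adjoint as a transpose. -/
theorem adj_eq {f g : C.Mor} {α : C.Cell} (hα : C.IsCell α f g) (hs : C.src f = C.src g)
    (ht : C.tgt f = C.tgt g) :
    C.adj α = (C.idc g⁎₁ ∘₂ (C.unit1 f ⬝₂ (α ∘₂ C.idc f⁎₁))) ⬝₂ (C.counit1 g ∘₂ C.idc f⁎₁) := by
  obtain ⟨h1, h2⟩ := hα
  rw [DualTwoCatData.adj, idc_hcomp_vcomp, vcomp_assoc, h1, h2]
  all_goals simp (maxDischargeDepth := 9) [*]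

/-- This characterises the adjoint: below a cap, α on the left strand may be exchanged for α† on the
right strand. -/
theorem unit1_vcomp_idc_hcomp_adj {f g : C.Mor} {α : C.Cell} (hα : C.IsCell α f g)
    (hs : C.src f = C.src g) (ht : C.tgt f = C.tgt g) :
    C.unit1 g ⬝₂ (C.idc g ∘₂ C.adj α) = C.unit1 f ⬝₂ (α ∘₂ C.idc f⁎₁) := by
  have h := unit_transpose_counit (h := g) (k := C.one (C.src f)) (m := f⁎₁)
    (β := C.unit1 f ⬝₂ (α ∘₂ C.idc f⁎₁)) (by simp [*]) (by simp [*])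
    (by obtain ⟨h1, h2⟩ := hα; constructor <;> simp (maxDischargeDepth := 9) [*])
  rw [hcomp_one (by simp [*])] at h
  rw [adj_eq hα hs ht, h]

theorem isCell_adj {f g : C.Mor} {α : C.Cell} (hα : C.IsCell α f g) (hs : C.src f = C.src g)
    (ht : C.tgt f = C.tgt g) : C.IsCell (C.adj α) g⁎₁ f⁎₁ := by
  rw [adj_eq hα hs ht]
  obtain ⟨h1, h2⟩ := hα
  constructor <;> simp (maxDischargeDepth := 9) [*]

theorem eq_of_unit1_vcomp_eq {g m : C.Mor} {β γ : C.Cell} (hβ : C.IsCell β g⁎₁ m)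
    (hγ : C.IsCell γ g⁎₁ m) (hm : C.src m = C.tgt g)
    (h : C.unit1 g ⬝₂ (C.idc g ∘₂ β) = C.unit1 g ⬝₂ (C.idc g ∘₂ γ)) : β = γ := by
  have h1 : ∀ δ, C.IsCell δ g⁎₁ m → (C.idc g⁎₁ ∘₂ (C.unit1 g ⬝₂ (C.idc g ∘₂ δ))) ⬝₂
      (C.counit1 g ∘₂ C.idc m) = δ := by
    intro δ hδ
    have h2 := counit_transpose_unit (h := g) (k := C.one (C.src g)) (m := m) (α := δ) (by simp) hm
      (by rwa [comp_one (by simp)])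
    rwa [hcomp_one (by simp)] at h2
  rw [← h1 β hβ, h, h1 γ hγ]

/-- Cells out of k* are determined by their transposes, and below the cap β and α can be slid round
one after the other. -/
theorem adj_vcomp {f g k : C.Mor} {α β : C.Cell} (hα : C.IsCell α f g) (hβ : C.IsCell β g k)
    (hs : C.src f = C.src g) (ht : C.tgt f = C.tgt g) (hs' : C.src g = C.src k)
    (ht' : C.tgt g = C.tgt k) : C.adj (α ⬝₂ β) = C.adj β ⬝₂ C.adj α := by
  have hαβ : C.IsCell (α ⬝₂ β) f k := by
    obtain ⟨h1, h2⟩ := hα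
    obtain ⟨h3, h4⟩ := hβ
    constructor <;> simp (maxDischargeDepth := 9) [*]
  have hα' := isCell_adj hα hs ht
  have hβ' := isCell_adj hβ hs' ht'
  have hc : C.IsCell (C.adj β ⬝₂ C.adj α) k⁎₁ f⁎₁ := by
    obtain ⟨h1, h2⟩ := hα'
    obtain ⟨h3, h4⟩ := hβ'
    constructor <;> simp (maxDischargeDepth := 9) [*]
  refine eq_of_unit1_vcomp_eq (isCell_adj hαβ (hs.trans hs') (ht.trans ht')) hc (by simp [*]) ?_
  have e1 := unit1_vcomp_idc_hcomp_adj hα hs ht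
  have e2 := unit1_vcomp_idc_hcomp_adj hβ hs' ht'
  rw [unit1_vcomp_idc_hcomp_adj hαβ (hs.trans hs') (ht.trans ht')]
  obtain ⟨h1, h2⟩ := hα
  obtain ⟨h3, h4⟩ := hβ
  obtain ⟨h5, h6⟩ := hα'
  obtain ⟨h7, h8⟩ := hβ'
  rw [idc_hcomp_vcomp, ← vcomp_assoc, e2, vcomp_assoc,
    hcomp_eq_left_right (f := k) h4 h5, ← hcomp_eq_right_left (f := g) h3 h6, ← vcomp_assoc, e1,
    vcomp_assoc, vcomp_hcomp_idc]
  all_goals simp (maxDischargeDepth := 9) [*]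

theorem adj_idc (f : C.Mor) : C.adj (C.idc f) = C.idc f⁎₁ := by
  have hc : C.IsCell (C.idc f) f f := ⟨by simp, by simp⟩
  refine eq_of_unit1_vcomp_eq (isCell_adj hc rfl rfl) ⟨by simp, by simp⟩ (by simp) ?_
  rw [unit1_vcomp_idc_hcomp_adj hc rfl rfl]

/-- Adjunction reverses composition and commutes with `*`, so it carries the unitarity equations of
α to those of α†. -/
theorem isUnitary_adj {f g : C.Mor} {α : C.Cell} (h : C.IsUnitary α) (hα : C.IsCell α f g)
    (hs : C.src f = C.src g) (ht : C.tgt f = C.tgt g) : C.IsUnitary (C.adj α) := by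
  have hα' : C.IsCell α⁎₂ g f := by obtain ⟨rfl, rfl⟩ := hα; exact h.1
  have h1 := isCell_adj hα hs ht
  have h2 := isCell_adj hα' hs.symm ht.symm
  refine ⟨⟨by simp, by simp⟩, ?_, ?_⟩
  · rw [C.dualLaws.dual2_adj, ← adj_vcomp hα' hα hs.symm ht.symm hs ht, h.2.2, adj_idc, h1.1, hα.2]
  · rw [C.dualLaws.dual2_adj, ← adj_vcomp hα hα' hs ht hs.symm ht.symm, h.2.1, adj_idc, h1.2, hα.1]

/-- The circle `u_f · u_f* : 1 ⇒ 1` of a 1-morphism. -/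
def circ (C : DualTwoCat.{u, v, w}) (f : C.Mor) : C.Cell := C.unit1 f ⬝₂ (C.unit1 f)⁎₂

@[simp] theorem dom_circ (f : C.Mor) : C.dom (C.circ f) = C.one (C.src f) := by
  rw [circ, dom_vcomp] <;> simp

@[simp] theorem cod_circ (f : C.Mor) : C.cod (C.circ f) = C.one (C.src f) := by
  rw [circ, cod_vcomp] <;> simp

/-- The endomorphism `x` surrounded by `f`. -/
def surround (C : DualTwoCat.{u, v, w}) (f : C.Mor) (z : C.Cell) : C.Cell :=
  C.unit1 f ⬝₂ (C.idc f ∘₂ z ∘₂ C.idc f⁎₁) ⬝₂ (C.unit1 f)⁎₂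

/-- The unit of a composite is nested, so its circle is the circle of g drawn inside that of f. -/
theorem circ_comp {f g : C.Mor} (h : C.tgt f = C.src g) :
    C.circ (f ⬝₁ g) = C.surround f (C.circ g) := by
  rw [circ, C.dualLaws.unit1_comp f g h, C.dualLaws.dual2_vcomp, C.dualLaws.dual2_hcomp,
    C.dualLaws.dual2_hcomp, C.dualLaws.dual2_idc, C.dualLaws.dual2_idc, surround, circ,
    vcomp_hcomp_idc, idc_hcomp_vcomp, vcomp_assoc, vcomp_assoc]
  all_goals simp (maxDischargeDepth := 9) [*]

/-- Multiply the sliding relation between α and α† by its `*`-dual: on one side α† meets its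
inverse, on the other α does, and only the two circles remain. -/
theorem circ_eq_of_isUnitary {f g : C.Mor} {α : C.Cell} (h : C.IsUnitary α) (hα : C.IsCell α f g)
    (hs : C.src f = C.src g) (ht : C.tgt f = C.tgt g) : C.circ f = C.circ g := by
  have hadj := isUnitary_adj h hα hs ht
  have h0 := isCell_adj hα hs ht
  have e := unit1_vcomp_idc_hcomp_adj hα hs ht
  have e' := congrArg C.dual2 e
  rw [C.dualLaws.dual2_vcomp, C.dualLaws.dual2_vcomp, C.dualLaws.dual2_hcomp,
    C.dualLaws.dual2_hcomp, C.dualLaws.dual2_idc, C.dualLaws.dual2_idc] at e'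
  · have e2 : (C.unit1 g ⬝₂ (C.idc g ∘₂ C.adj α)) ⬝₂ ((C.idc g ∘₂ (C.adj α)⁎₂) ⬝₂ (C.unit1 g)⁎₂) =
      (C.unit1 f ⬝₂ (α ∘₂ C.idc f⁎₁)) ⬝₂ ((α⁎₂ ∘₂ C.idc f⁎₁) ⬝₂ (C.unit1 f)⁎₂) := by rw [e, e']
    obtain ⟨h1, h2⟩ := hα
    obtain ⟨h3, h4⟩ := h0
    have e3 := hadj.2.1
    have e4 := h.2.1
    rw [vcomp_assoc, vcomp_assoc, ← vcomp_assoc (α := C.idc g ∘₂ C.adj α),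
      ← vcomp_assoc (α := α ∘₂ C.idc f⁎₁), ← idc_hcomp_vcomp, ← vcomp_hcomp_idc, e3, e4, h1, h3,
      idc_hcomp_idc, idc_hcomp_idc, idc_vcomp, idc_vcomp] at e2
    · exact e2.symm
    all_goals simp (maxDischargeDepth := 9) [*]
  all_goals obtain ⟨h1, h2⟩ := hα
  all_goals obtain ⟨h3, h4⟩ := h0
  all_goals simp (maxDischargeDepth := 9) [*]

theorem circ_ltens (A : C.Obj) (f : C.Mor) : C.circ (A ◁₁ f) = A ◁₂ C.circ f := by
  rw [circ, circ, C.dualLaws.unit1_ltens, C.monLaws.ltensc_vcomp _ _ _ (by simp),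
    C.dualLaws.dual2_ltensc]

theorem circ_rtens (f : C.Mor) (A : C.Obj) : C.circ (f ▷₁ A) = C.circ f ▷₂ A := by
  rw [circ, circ, C.dualLaws.unit1_rtens, C.monLaws.vcomp_rtensc _ _ _ (by simp),
    C.dualLaws.dual2_rtensc]

end Cells

end DualTwoCat

/-! ### Right and left circles, unitary 2-morphisms, mates. -/

namespace DualTwoCat

open TwoCat MonTwoCat

section Cells

variable {C : DualTwoCat.{u, v, w}}

/-- The circle computing the right quantum dimension. -/
def circR (C : DualTwoCat.{u, v, w}) (f : C.Mor) : C.Cell :=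
  C.circ (C.unit0 (C.src f) ⬝₁ (f ▷₁ (C.src f)⁎₀))

/-- The circle computing the left quantum dimension. -/
def circL (C : DualTwoCat.{u, v, w}) (f : C.Mor) : C.Cell :=
  C.circ (C.unit0 (C.src f)⁎₀ ⬝₁ ((C.src f)⁎₀ ◁₁ f))

theorem circR_eq_surround (f : C.Mor) :
    C.circR f = C.surround (C.unit0 (C.src f)) (C.circ f ▷₂ (C.src f)⁎₀) := by
  rw [circR, circ_comp (by simp), circ_rtens]

theorem circL_eq_surround (f : C.Mor) :
    C.circL f = C.surround (C.unit0 (C.src f)⁎₀) ((C.src f)⁎₀ ◁₂ C.circ f) := by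
  rw [circL, circ_comp (by simp), circ_ltens]

theorem circR_one (A : C.Obj) : C.circR (C.one A) = C.circ (C.unit0 A) := by
  rw [circR]; simp

theorem circL_one (A : C.Obj) : C.circL (C.one A) = C.circ (C.unit0 A⁎₀) := by
  rw [circL]; simp

theorem isUnitary_tor (f g : C.Mor) : C.IsUnitary (C.tor f g) := C.dualLaws.tor_unitary f g

theorem isUnitary_rtensc {α : C.Cell} (h : C.IsUnitary α) (A : C.Obj) :
    C.IsUnitary (α ▷₂ A) := by
  refine ⟨⟨by simp, by simp⟩, ?_, ?_⟩
  · rw [C.dualLaws.dual2_rtensc, ← C.monLaws.vcomp_rtensc _ _ _ (by simp), h.2.1,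
      C.monLaws.idc_rtensc, dom_rtensc]
  · rw [C.dualLaws.dual2_rtensc, ← C.monLaws.vcomp_rtensc _ _ _ (by simp), h.2.2,
      C.monLaws.idc_rtensc, cod_rtensc]

theorem isUnitary_idc (f : C.Mor) : C.IsUnitary (C.idc f) := by
  refine ⟨⟨by simp, by simp⟩, ?_, ?_⟩
  · rw [C.dualLaws.dual2_idc, idc_vcomp (by simp), dom_idc]
  · rw [C.dualLaws.dual2_idc, idc_vcomp (by simp), cod_idc]

theorem isUnitary_hcomp {α β : C.Cell} (hα : C.IsUnitary α) (hβ : C.IsUnitary β)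
    (h : C.tgt (C.dom α) = C.src (C.dom β)) : C.IsUnitary (α ∘₂ β) := by
  have h' : C.tgt (C.cod α) = C.src (C.cod β) := by
    rwa [← C.laws.tgt_dom, ← C.laws.src_dom]
  refine ⟨⟨by simp, by simp⟩, ?_, ?_⟩
  · rw [C.dualLaws.dual2_hcomp _ _ h, ← C.laws.interchange _ _ _ _ (by simp) (by simp) h, hα.2.1,
      hβ.2.1, idc_hcomp_idc h, dom_hcomp h]
  · rw [C.dualLaws.dual2_hcomp _ _ h, ← C.laws.interchange _ _ _ _ (by simp) (by simp) (by simpa),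
      hα.2.2, hβ.2.2, idc_hcomp_idc h', cod_hcomp h]

theorem isUnitary_vcomp {α β : C.Cell} (hα : C.IsUnitary α) (hβ : C.IsUnitary β)
    (h : C.cod α = C.dom β) : C.IsUnitary (α ⬝₂ β) := by
  refine ⟨⟨by simp, by simp⟩, ?_, ?_⟩
  · rw [C.dualLaws.dual2_vcomp _ _ h, vcomp_assoc h (by simp [h]),
      ← vcomp_assoc (β := β⁎₂) (by simp) (by simp [h]), hβ.2.1, ← h, idc_vcomp (by simp), hα.2.1,
      dom_vcomp h]
  · rw [C.dualLaws.dual2_vcomp _ _ h, vcomp_assoc (by simp [h]) (by simp [h]),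
      ← vcomp_assoc (α := α⁎₂) (by simp) h, hα.2.2, h, idc_vcomp (by simp), hβ.2.2, cod_vcomp h]

theorem isCell_adj_triang (A : C.Obj) :
    C.IsCell (C.adj (C.triang A)) (C.one A) ((A ◁₁ C.unit0 A⁎₀) ⬝₁ (C.counit0 A⁎₀ ▷₁ A)) := by
  have := isCell_adj (f := (C.unit0 A ▷₁ A) ⬝₁ (A ◁₁ C.counit0 A))
    (g := C.one A) (α := C.triang A) ⟨by simp, by simp⟩ (by simp) (by simp)
  simpa using this

/-- The mate `(B* ⊗ f)(e_B ⊗ D) : B* ⊗ A → D` of `f : A → B ⊗ D`. -/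
def mate (C : DualTwoCat.{u, v, w}) (B D : C.Obj) (f : C.Mor) : C.Mor :=
  (B⁎₀ ◁₁ f) ⬝₁ (C.counit0 B ▷₁ D)

/-- The mate `(i_B ⊗ A)(B ⊗ h) : A → B ⊗ D` of `h : B* ⊗ A → D`. -/
def comate (C : DualTwoCat.{u, v, w}) (B A : C.Obj) (h : C.Mor) : C.Mor :=
  (C.unit0 B ▷₁ A) ⬝₁ (B ◁₁ h)

/-- The 2-isomorphism `comate (mate f) ⇒ f`. -/
def comateMate (C : DualTwoCat.{u, v, w}) (B D : C.Obj) (f : C.Mor) : C.Cell :=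
  (C.tor (C.unit0 B) f ∘₂ C.idc (B ◁₁ C.counit0 B ▷₁ D)) ⬝₂ (C.idc f ∘₂ (C.triang B ▷₂ D))

theorem isCell_comateMate {A B D : C.Obj} {f : C.Mor} (hs : C.src f = A)
    (ht : C.tgt f = B ⊗₀ D) :
    C.IsCell (C.comateMate B D f) (C.comate B A (C.mate B D f)) f := by
  constructor <;> simp (maxDischargeDepth := 9) [comateMate, mate, comate, *]

theorem isUnitary_comateMate {B D : C.Obj} {f : C.Mor} (ht : C.tgt f = B ⊗₀ D) :
    C.IsUnitary (C.comateMate B D f) := by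
  refine isUnitary_vcomp (isUnitary_hcomp (isUnitary_tor _ _) (isUnitary_idc _) ?_)
    (isUnitary_hcomp (isUnitary_idc _) (isUnitary_rtensc (C.dualLaws.triang_unitary B) D) ?_) ?_
  all_goals simp (maxDischargeDepth := 9) [*]

/-- The left circle of the mate of a 1-morphism out of the unit object. -/
theorem circL_mate_of_src_eq_I {B D : C.Obj} {f : C.Mor} (hs : C.src f = C.I)
    (ht : C.tgt f = B ⊗₀ D) : C.circL (C.mate B D f) = C.circ f := by
  have h := circ_eq_of_isUnitary (isUnitary_comateMate ht) (isCell_comateMate hs ht)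
    (by simp (maxDischargeDepth := 9) [comate, mate, *])
    (by simp (maxDischargeDepth := 9) [comate, mate, *])
  -- As B* ⊗ I = B* and B** = B, the 1-morphism defining the left circle of the mate is exactly its
  -- `comate`, which is unitarily isomorphic to `f`.
  rw [← h, circL]
  congr 1
  simp (maxDischargeDepth := 9) [comate, mate, *]

/-- Because i_{B* ⊗ A} is i_{B*} followed by an inner i_A, bending the A-strand away changes nothing
in the circle. This reduces mates to the case of source I. -/
theorem circR_mate {A B D : C.Obj} {f : C.Mor} (hs : C.src f = A) (ht : C.tgt f = B ⊗₀ D) :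
    C.circR (C.mate B D f) = C.circR (C.mate B (D ⊗₀ A⁎₀) (C.unit0 A ⬝₁ (f ▷₁ A⁎₀))) := by
  rw [circR, circR]
  congr 1
  simp (maxDischargeDepth := 9) [mate, unit0_tens, *]

end Cells

end DualTwoCat

/-! ### Sphericality: right circles equal left circles. -/

namespace SphericalTwoCat

open TwoCat MonTwoCat DualTwoCat

variable {C : SphericalTwoCat.{u, v, w}}

/-- Naturality of σ at e moves e from the left to the right trace, and σ is absorbed by the caps and
cups of `1_A`. -/
theorem surround_rtensc_eq {A : C.Obj} {e : C.Cell} (he : C.IsCell e (C.one A) (C.one A)) :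
    C.surround (C.unit0 A) (e ▷₂ A⁎₀) = C.surround (C.unit0 A⁎₀) (A⁎₀ ◁₂ e) := by
  obtain ⟨h1, h2⟩ := he
  have hn := C.sphLaws.sph_natural e (by simp [h1])
  have hc := C.sphLaws.capL_sph A
  have hu := C.sphLaws.sph_cupR A
  have hd := C.sphLaws.dom_sph (C.one A) (by simp)
  have hd' := C.sphLaws.cod_sph (C.one A) (by simp)
  have e1 : C.surround (C.unit0 A) (e ▷₂ A⁎₀) =
      C.capR (C.one A) ⬝₂ C.trRc e ⬝₂ C.cupR (C.one A) := by
    simp [surround, capR, cupR, trRc, h1]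
  have e2 : C.surround (C.unit0 A⁎₀) (A⁎₀ ◁₂ e) =
      C.capL (C.one A) ⬝₂ C.trLc e ⬝₂ C.cupL (C.one A) := by
    simp [surround, capL, cupL, trLc, h1]
  have d1 : C.cod (C.capL (C.one A)) = C.trL (C.one A) := by simp [capL, trL]
  have d2 : C.dom (C.cupR (C.one A)) = C.trR (C.one A) := by simp [capR, cupR, trR]
  have d3 : C.dom (C.trRc e) = C.trR (C.one A) := by
    simp (maxDischargeDepth := 9) [trRc, trR, h1]
  have d4 : C.cod (C.trRc e) = C.trR (C.one A) := by
    simp (maxDischargeDepth := 9) [trRc, trR, h1, h2]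
  have d5 : C.dom (C.trLc e) = C.trL (C.one A) := by
    simp (maxDischargeDepth := 9) [trLc, trL, h1]
  have d6 : C.cod (C.trLc e) = C.trL (C.one A) := by
    simp (maxDischargeDepth := 9) [trLc, trL, h1, h2]
  rw [h1, h2] at hn
  rw [e1, e2, ← hc, ← hu, vcomp_assoc, ← vcomp_assoc (α := C.sph (C.one A)), hn, vcomp_assoc]
  all_goals simp [*]

theorem circR_eq_circL (f : C.Mor) : C.circR f = C.circL f := by
  rw [circR_eq_surround, circL_eq_surround]
  exact surround_rtensc_eq ⟨dom_circ f, cod_circ f⟩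

/-- Reduce to source I, replace the right circle by the left one, and undo the mate there; what is
left is the circle of i_A(f ⊗ A*), the right circle of f. -/
theorem circR_mate {A B D : C.Obj} {f : C.Mor} (hs : C.src f = A) (ht : C.tgt f = B ⊗₀ D) :
    C.circR (C.mate B D f) = C.circR f := by
  rw [DualTwoCat.circR_mate hs ht, circR_eq_circL, circL_mate_of_src_eq_I, circR, hs]
  all_goals simp [*]

end SphericalTwoCat

/-! ### Source and target of θ^R. -/

namespace PivotalTwoCat

open TwoCat MonTwoCat DualTwoCat

variable {C : PivotalTwoCat.{u, v, w}}

@[simp] theorem dom_piv (f : C.Mor) : C.dom (C.piv f) = C.lsharp f := C.pivLaws.dom_piv f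

@[simp] theorem cod_piv (f : C.Mor) : C.cod (C.piv f) = C.rsharp f := C.pivLaws.cod_piv f

theorem isCell_vcomp {α β : C.Cell} {f g h : C.Mor} (hα : C.IsCell α f g) (hβ : C.IsCell β g h) :
    C.IsCell (α ⬝₂ β) f h :=
  ⟨(dom_vcomp (hα.2.trans hβ.1.symm)).trans hα.1, (cod_vcomp (hα.2.trans hβ.1.symm)).trans hβ.2⟩

theorem isCell_thetaR {A B : C.Obj} {f g : C.Mor} (hf : C.src f = A) (hf' : C.tgt f = B)
    (hg : C.src g = B) (hg' : C.tgt g = A) :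
    C.IsCell (C.thetaR f g) (C.trR (f ⬝₁ g)) (C.trR (g ⬝₁ f)) := by
  obtain ⟨h1, h2⟩ := isCell_adj_triang (C := C.toDualTwoCat) B
  unfold thetaR
  simp only [hf, hg]
  -- The witnesses are the five 1-morphisms reached between the six factors of θ^R.
  refine isCell_vcomp (g := C.unit0 A ⬝₁ (f ▷₁ A⁎₀) ⬝₁ (B ◁₁ C.unit0 B⁎₀ ▷₁ A⁎₀) ⬝₁
    (C.counit0 B⁎₀ ▷₁ B ⊗₀ A⁎₀) ⬝₁ (g ▷₁ A⁎₀) ⬝₁ C.counit0 A⁎₀) ⟨?_, ?_⟩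
    (isCell_vcomp (g := C.unit0 A ⬝₁ (f ▷₁ A⁎₀) ⬝₁ (B ◁₁ C.unit0 B⁎₀ ▷₁ A⁎₀) ⬝₁
      (B ◁₁ B⁎₀ ◁₁ g ▷₁ A⁎₀) ⬝₁ (B ◁₁ B⁎₀ ◁₁ C.counit0 A⁎₀) ⬝₁ C.counit0 B⁎₀) ⟨?_, ?_⟩
    (isCell_vcomp (g := C.unit0 A ⬝₁ (f ▷₁ A⁎₀) ⬝₁ (B ◁₁ C.rsharp g) ⬝₁ C.counit0 B⁎₀)
      ⟨?_, ?_⟩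
    (isCell_vcomp (g := C.unit0 B ⬝₁ (g ▷₁ B⁎₀) ⬝₁ (C.unit0 A ▷₁ A ⊗₀ B⁎₀) ⬝₁
      (f ▷₁ A⁎₀ ⊗₀ A ⊗₀ B⁎₀) ⬝₁ (B ◁₁ C.counit0 A ▷₁ B⁎₀) ⬝₁ C.counit0 B⁎₀) ⟨?_, ?_⟩
    (isCell_vcomp (g := C.unit0 B ⬝₁ (g ▷₁ B⁎₀) ⬝₁ (C.unit0 A ▷₁ A ⊗₀ B⁎₀) ⬝₁
      (A ◁₁ C.counit0 A ▷₁ B⁎₀) ⬝₁ (f ▷₁ B⁎₀) ⬝₁ C.counit0 B⁎₀) ⟨?_, ?_⟩ ⟨?_, ?_⟩))))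
  all_goals simp (maxDischargeDepth := 12) [trR, lsharp, rsharp, *]

end PivotalTwoCat

/-! ### Consistency: circles of dual 1-morphisms. -/

namespace SphericalTwoCat

open TwoCat MonTwoCat DualTwoCat

variable {C : SphericalTwoCat.{u, v, w}}

/-- Both circles equal cap_f · θ · cup_{f*}: consistency absorbs θ either into the cap or into the
cup. -/
theorem circR_dual1 (f : C.Mor) : C.circR f⁎₁ = C.circR f := by
  have h1 := C.sphLaws.consistent.capR_thetaR f
  have h2 := C.sphLaws.consistent.thetaR_cupR f
  have e1 : ∀ g, C.circR g = C.capR g ⬝₂ C.cupR g := fun g => rfl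
  obtain ⟨h3, h4⟩ := PivotalTwoCat.isCell_thetaR (C := C.toPivotalTwoCat) (f := f) (g := f⁎₁)
    rfl rfl (by simp) (by simp)
  rw [e1, e1, ← h1, ← h2, vcomp_assoc]
  · rw [h3]; simp (maxDischargeDepth := 9) [capR, trR]
  · rw [h4]; simp (maxDischargeDepth := 9) [capR, cupR, trR]

end SphericalTwoCat

namespace DualTwoCat

open TwoCat MonTwoCat

/-! ## Typed duals -/

section Typed

variable {C : DualTwoCat.{u, v, w}} {A B D W : C.Obj}

/-- The dual of a 1-morphism. -/
def dualHom (f : C.Hom1 A B) : C.Hom1 B A :=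
  ⟨f.mor⁎₁, (src_dual1 _).trans f.isMor.2, (tgt_dual1 _).trans f.isMor.1⟩

/-- The dual of a 2-morphism. -/
def star {f g : C.Hom1 A B} (α : f ⟶ g) : g ⟶ f :=
  homMk (C.cellOf α)⁎₂ ⟨(dom_dual2 _).trans (isCell_cellOf α).2,
    (cod_dual2 _).trans (isCell_cellOf α).1⟩

/-- The unit of a 1-morphism. -/
def unitHom (f : C.Hom1 A B) : C.one1 A ⟶ C.comp1 f (dualHom f) :=
  homMk (C.unit1 f.mor) ⟨(dom_unit1 _).trans (congrArg C.one f.isMor.1), cod_unit1 _⟩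

/-- The counit of a 1-morphism. -/
def counitHom (f : C.Hom1 A B) : C.comp1 (dualHom f) f ⟶ C.one1 B :=
  homMk (C.counit1 f.mor) ⟨dom_counit1 _, (cod_counit1 _).trans (congrArg C.one f.isMor.2)⟩

/-- The circle of a 1-morphism, as an endomorphism of an identity 1-morphism. -/
def circHom (f : C.Hom1 A B) : C.one1 A ⟶ C.one1 A := unitHom f ≫ star (unitHom f)

@[simp] theorem cellOf_circHom (f : C.Hom1 A B) : C.cellOf (circHom f) = C.circ f.mor := rfl

theorem circHom_dualHom (f : C.Hom1 A B) :
    circHom (dualHom f) = star (counitHom f) ≫ counitHom f := by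
  refine hom_ext ?_
  change C.unit1 f.mor⁎₁ ⬝₂ (C.unit1 f.mor⁎₁)⁎₂ = (C.counit1 f.mor)⁎₂ ⬝₂ C.counit1 f.mor
  rw [C.dualLaws.unit1_dual, C.dualLaws.dual2_dual2]

variable {F : Type x} [Field F]
  [∀ A B, Preadditive (C.Hom1 A B)] [∀ A B, Linear F (C.Hom1 A B)] [VectLinear F C.toMonTwoCat]

theorem smul_comp2 (c : F) {f f' : C.Hom1 A B} {g g' : C.Hom1 B D} (α : f ⟶ f') (β : g ⟶ g') :
    C.comp2 (c • α) β = c • C.comp2 α β :=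
  VectLinear.smul_comp2 (C := C.toMonTwoCat) c α β

theorem comp2_smul (c : F) {f f' : C.Hom1 A B} {g g' : C.Hom1 B D} (α : f ⟶ f') (β : g ⟶ g') :
    C.comp2 α (c • β) = c • C.comp2 α β :=
  VectLinear.comp2_smul (C := C.toMonTwoCat) c α β

variable (F) in
/-- Transposition `2Hom(h* k, m) → 2Hom(k, h m)`. -/
def transpose (h : C.Hom1 A B) (k : C.Hom1 A D) (m : C.Hom1 B D) :
    (C.comp1 (dualHom h) k ⟶ m) →ₗ[F] (k ⟶ C.comp1 h m) where
  toFun α := recast (one_comp1 k) (comp1_assoc h (dualHom h) k) (C.comp2 (unitHom h) (𝟙 k)) ≫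
    C.comp2 (𝟙 h) α
  map_add' α β := by
    rw [VectLinear.comp2_add (F := F) (C := C.toMonTwoCat), Preadditive.comp_add]
  map_smul' c α := by
    rw [comp2_smul, Linear.comp_smul, RingHom.id_apply]

theorem transpose_injective (h : C.Hom1 A B) (k : C.Hom1 A D) (m : C.Hom1 B D) :
    Function.Injective (transpose F h k m) := by
  intro α β hαβ
  have h1 : ∀ γ : C.comp1 (dualHom h) k ⟶ m, (C.idc h.mor⁎₁ ∘₂ C.cellOf (transpose F h k m γ)) ⬝₂
      (C.counit1 h.mor ∘₂ C.idc m.mor) = C.cellOf γ := fun γ =>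
    counit_transpose_unit (k.isMor.1.trans h.isMor.1.symm) (m.isMor.1.trans h.isMor.2.symm)
      (isCell_cellOf γ)
  exact hom_ext (by rw [← h1 α, hαβ, h1 β])

variable (F) in
/-- Transposition `2Hom(k, h m) → 2Hom(h* k, m)`. -/
def cotranspose (h : C.Hom1 A B) (k : C.Hom1 A D) (m : C.Hom1 B D) :
    (k ⟶ C.comp1 h m) →ₗ[F] (C.comp1 (dualHom h) k ⟶ m) where
  toFun β := C.comp2 (𝟙 (dualHom h)) β ≫
    recast (comp1_assoc (dualHom h) h m) (one_comp1 m) (C.comp2 (counitHom h) (𝟙 m))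
  map_add' α β := by
    rw [VectLinear.comp2_add (F := F) (C := C.toMonTwoCat), Preadditive.add_comp]
  map_smul' c α := by
    rw [comp2_smul, Linear.smul_comp, RingHom.id_apply]

theorem cotranspose_injective (h : C.Hom1 A B) (k : C.Hom1 A D) (m : C.Hom1 B D) :
    Function.Injective (cotranspose F h k m) := by
  intro α β hαβ
  have h1 : ∀ γ : k ⟶ C.comp1 h m, (C.unit1 h.mor ∘₂ C.idc k.mor) ⬝₂
      (C.idc h.mor ∘₂ C.cellOf (cotranspose F h k m γ)) = C.cellOf γ := fun γ =>
    unit_transpose_counit (k.isMor.1.trans h.isMor.1.symm) (m.isMor.1.trans h.isMor.2.symm)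
      (isCell_cellOf γ)
  exact hom_ext (by rw [← h1 α, hαβ, h1 β])

/-- The zigzag identity, typed. -/
theorem transpose_counitHom (h : C.Hom1 A B) :
    recast rfl (comp1_one h) (transpose F h h (C.one1 B) (counitHom h)) = 𝟙 h :=
  hom_ext (C.dualLaws.zigzag h.mor)

/-- Transposition embeds 2Hom(h*h, 1) into 2End(h) = F and sends the counit to the identity. -/
theorem exists_eq_smul_counitHom {h : C.Hom1 A B} (hh : IsSplit F h)
    (α : C.comp1 (dualHom h) h ⟶ C.one1 B) : ∃ c : F, α = c • counitHom h := by
  obtain ⟨c, hc⟩ := hh.exists_smul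
    (recastEquiv F rfl (comp1_one h) (transpose F h h (C.one1 B) α))
  refine ⟨c, transpose_injective (F := F) _ _ _
    ((recastEquiv F (rfl : h.mor = h.mor) (comp1_one h)).injective ?_)⟩
  rw [hc, map_smul, map_smul]
  exact congrArg (c • ·) (transpose_counitHom (F := F) h).symm

theorem cotranspose_star_counitHom (h : C.Hom1 A B) :
    recast (f' := h) (g' := h)
      ((comp1_one _).trans (dual1_dual1 h.mor)) rfl
      (cotranspose F (dualHom h) (C.one1 B) h (star (counitHom h))) = 𝟙 h := by
  refine hom_ext ?_
  change (C.idc h.mor⁎₁⁎₁ ∘₂ (C.counit1 h.mor)⁎₂) ⬝₂ (C.counit1 h.mor⁎₁ ∘₂ C.idc h.mor) =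
    C.idc h.mor
  have := C.dualLaws.zigzag' h.mor⁎₁
  rw [C.dualLaws.unit1_dual, dual1_dual1] at this
  rwa [dual1_dual1]

theorem exists_eq_smul_star_counitHom {h : C.Hom1 A B} (hh : IsSplit F h)
    (β : C.one1 B ⟶ C.comp1 (dualHom h) h) : ∃ c : F, β = c • star (counitHom h) := by
  have e : (C.comp1 (dualHom (dualHom h)) (C.one1 B)).mor = h.mor :=
    (comp1_one _).trans (dual1_dual1 h.mor)
  obtain ⟨c, hc⟩ := hh.exists_smul
    (recastEquiv F e rfl (cotranspose F (dualHom h) (C.one1 B) h β))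
  refine ⟨c, cotranspose_injective (F := F) _ _ _
    ((recastEquiv F e (rfl : h.mor = h.mor)).injective ?_)⟩
  rw [hc, map_smul, map_smul]
  exact congrArg (c • ·) (cotranspose_star_counitHom (F := F) h).symm

/-! ## Resolution of the identity -/

variable {E : Finset C.Obj}

/-- For `X` in the horizontal basis, identities in `End(X)` factor through copies of `1_X`. -/
theorem exists_end_decomposition (hE : C.toMonTwoCat.IsHorizontalBasis F E) {X : C.Obj}
    (hX : X ∈ E) (g : C.Hom1 X X) :
    ∃ (ι : Type) (_ : Fintype ι) (p : ι → (g ⟶ C.one1 X)) (q : ι → (C.one1 X ⟶ g)),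
      ∑ a, p a ≫ q a = 𝟙 g := by
  obtain ⟨n, S, hS⟩ := exists_splitFamily F (C := C.toMonTwoCat) X X
  obtain ⟨ι, hι, k, p, q, hpq⟩ := hS.decomposition g
  have e : ∀ a, S (k a) ≅ C.one1 X := fun a => (iso_one_of_isSplit hE hX (hS.split (k a))).some
  exact ⟨ι, hι, fun a => p a ≫ (e a).hom, fun a => (e a).inv ≫ q a, by simpa using hpq⟩

/-- Inserting e_h · e_h* inside the circle of h next to an h-strand cuts it into a triangle identity
and its `*`-dual, giving the identity of h. If that insertion is the scalar d, the circle itself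
must act as the inverse of d. -/
theorem id_eq_recast_transpose (h : C.Hom1 A B) (d : F)
    (hd : counitHom h ≫ star (counitHom h) = d • 𝟙 (C.comp1 (dualHom h) h)) :
    d • C.comp2 (circHom h) (𝟙 h) = 𝟙 (C.comp1 (C.one1 A) h) := by
  have e := one_comp1 h
  let u := recast e (comp1_assoc h (dualHom h) h) (C.comp2 (unitHom h) (𝟙 h))
  let u' := recast (comp1_assoc h (dualHom h) h) e (C.comp2 (star (unitHom h)) (𝟙 h))
  have h1 : u ≫ C.comp2 (𝟙 h) (counitHom h ≫ star (counitHom h)) ≫ u' = 𝟙 h := by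
    refine hom_ext ?_
    change (C.unit1 h.mor ∘₂ C.idc h.mor) ⬝₂ (C.idc h.mor ∘₂ (C.counit1 h.mor ⬝₂
      (C.counit1 h.mor)⁎₂)) ⬝₂ ((C.unit1 h.mor)⁎₂ ∘₂ C.idc h.mor) = C.idc h.mor
    have z := C.dualLaws.zigzag h.mor
    have z' := congrArg C.dual2 z
    rw [C.dualLaws.dual2_vcomp, C.dualLaws.dual2_hcomp, C.dualLaws.dual2_hcomp,
      C.dualLaws.dual2_idc] at z'
    · rw [idc_hcomp_vcomp, vcomp_assoc, z', vcomp_idc, z]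
      all_goals simp (maxDischargeDepth := 9)
    all_goals simp (maxDischargeDepth := 9)
  have h2 : C.comp2 (circHom h) (𝟙 h) = recast e.symm e.symm (u ≫ u') := by
    have h3 : C.comp2 (circHom h) (𝟙 h) = C.comp2 (unitHom h) (𝟙 h) ≫
        C.comp2 (star (unitHom h)) (𝟙 h) := by
      rw [← C.comp2_comp, Category.comp_id]
      rfl
    rw [h3]
    rfl
  rw [hd, comp2_smul, C.comp2_id, Linear.smul_comp, Linear.comp_smul, Category.id_comp] at h1
  have h4 := congrArg (recastEquiv F e.symm e.symm) h1
  rw [map_smul] at h4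
  rw [h2]
  exact h4.trans (hom_ext (congrArg C.idc e.symm))

theorem id_ne_zero_comp1_dualHom {h : C.Hom1 A B} (hh : IsSplit F h) :
    𝟙 (C.comp1 (dualHom h) h) ≠ 0 := by
  intro h0
  have h1 : counitHom h = 0 := by rw [← Category.id_comp (counitHom h), h0, zero_comp]
  apply hh.id_ne_zero
  rw [← transpose_counitHom (F := F), h1, map_zero, recast_eq_zero_iff]

/-- The circles on the two sides of a split simple 1-morphism are inverse to each other. -/
theorem exists_smul_circHom (hE : C.toMonTwoCat.IsHorizontalBasis F E) (hB : B ∈ E)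
    {h : C.Hom1 A B} (hh : IsSplit F h) :
    ∃ d : F, circHom (dualHom h) = d • 𝟙 (C.one1 B) ∧
      d • C.comp2 (circHom h) (𝟙 h) = 𝟙 (C.comp1 (C.one1 A) h) := by
  have hB1 : IsSplit F (C.one1 B) := isSplit_one_of_mem hE hB
  obtain ⟨d, hd⟩ := hB1.exists_smul (star (counitHom h) ≫ counitHom h)
  obtain ⟨ι, _, p, q, hpq⟩ := exists_end_decomposition hE hB (C.comp1 (dualHom h) h)
  choose c hc using fun a => exists_eq_smul_counitHom hh (p a)
  choose c' hc' using fun a => exists_eq_smul_star_counitHom hh (q a)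
  -- The identity of h*h factors through copies of `1_B`, and all maps to and from these are
  -- multiples of e_h and e_h*.
  have h1 : (∑ a, c a * c' a) • (counitHom h ≫ star (counitHom h)) =
      𝟙 (C.comp1 (dualHom h) h) := by
    rw [← hpq, Finset.sum_smul]
    refine Finset.sum_congr rfl fun a _ => ?_
    rw [hc, hc', Linear.smul_comp, Linear.comp_smul, smul_smul]
  set s := ∑ a, c a * c' a
  have hs : star (counitHom h) ≠ 0 := by
    intro h0
    apply id_ne_zero_comp1_dualHom hh
    rw [← h1, h0, comp_zero, smul_zero]
  -- Compose the previous relation with e_h* on the left; e_h* · e_h = d then gives sd = 1.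
  have h2 : (s * d) • star (counitHom h) = (1 : F) • star (counitHom h) := by
    have h3 := congrArg (star (counitHom h) ≫ ·) h1
    simp only [Linear.comp_smul, Category.comp_id] at h3
    rw [← Category.assoc, hd, Linear.smul_comp, Category.id_comp, smul_smul] at h3
    rw [h3, one_smul]
  have h3 : s * d = 1 := by
    have h4 : (s * d - 1) • star (counitHom h) = 0 := by rw [sub_smul, h2, sub_self]
    rcases smul_eq_zero.1 h4 with h5 | h5
    · exact sub_eq_zero.1 h5
    · exact absurd h5 hs
  refine ⟨d, by rw [circHom_dualHom, hd], id_eq_recast_transpose h d ?_⟩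
  rw [← h1, smul_smul, mul_comm, h3, one_smul]

/-- The circle of `h` acts by zero on `k` if `h* k` is a zero object. -/
theorem circHom_comp2_eq_zero (F : Type x) [Field F] [∀ A B, Linear F (C.Hom1 A B)]
    [VectLinear F C.toMonTwoCat] {h : C.Hom1 W A} {k : C.Hom1 W B}
    (h0 : 𝟙 (C.comp1 (dualHom h) k) = 0) : C.comp2 (circHom h) (𝟙 k) = 0 := by
  have h1 : 𝟙 (C.comp1 (C.comp1 h (dualHom h)) k) = 0 := by
    rw [← recast_eq_zero_iff (comp1_assoc h (dualHom h) k) (comp1_assoc h (dualHom h) k)]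
    have h2 : C.comp2 (𝟙 h) (𝟙 (C.comp1 (dualHom h) k)) = 0 := by
      rw [h0, comp2_zero (C := C.toMonTwoCat) F]
    rw [C.comp2_id] at h2
    rw [← h2]
    exact hom_ext (congrArg C.idc (comp1_assoc h (dualHom h) k))
  have h3 : C.comp2 (circHom h) (𝟙 k) = C.comp2 (unitHom h) (𝟙 k) ≫
      𝟙 _ ≫ C.comp2 (star (unitHom h)) (𝟙 k) := by
    rw [Category.id_comp, ← C.comp2_comp, Category.comp_id]
    rfl
  rw [h3, h1, zero_comp, comp_zero]

theorem circHom_comp2_eq_zero_of_ne (hE : C.toMonTwoCat.IsHorizontalBasis F E) (hA : A ∈ E)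
    (hB : B ∈ E) (hAB : A ≠ B) (h : C.Hom1 W A) (k : C.Hom1 W B) :
    C.comp2 (circHom h) (𝟙 k) = 0 :=
  circHom_comp2_eq_zero F (id_eq_zero_of_ne hE hA hB hAB _)

/-- The identity of h*k factors through copies of `1_A`, but 2Hom(h*k, 1_A) embeds into 2Hom(k, h) =
0. -/
theorem circHom_comp2_eq_zero_of_hom (hE : C.toMonTwoCat.IsHorizontalBasis F E) (hA : A ∈ E)
    (h k : C.Hom1 W A) (hhk : ∀ φ : k ⟶ h, φ = 0) : C.comp2 (circHom h) (𝟙 k) = 0 := by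
  refine circHom_comp2_eq_zero F ?_
  obtain ⟨ι, _, p, q, hpq⟩ := exists_end_decomposition hE hA (C.comp1 (dualHom h) k)
  have hp : ∀ α : C.comp1 (dualHom h) k ⟶ C.one1 A, α = 0 := by
    intro α
    refine transpose_injective (F := F) _ _ _ ?_
    rw [map_zero, ← recast_eq_zero_iff rfl (comp1_one h)]
    exact hhk _
  rw [← hpq]
  exact Finset.sum_eq_zero fun a _ => by rw [hp (p a), zero_comp]

/-- An endomorphism of `1_W` vanishes if it acts by zero on all 1-morphisms from `W` to objects of
the horizontal basis. -/
theorem eq_zero_of_comp2_eq_zero (hE : C.toMonTwoCat.IsHorizontalBasis F E)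
    (z : C.one1 W ⟶ C.one1 W)
    (hz : ∀ X ∈ E, ∀ f : C.Hom1 W X, IsSplit F f → C.comp2 z (𝟙 f) = 0) : z = 0 := by
  have h1 : ∀ X ∈ E, ∀ f : C.Hom1 W X, C.comp2 z (𝟙 f) = 0 := by
    intro X hX f
    obtain ⟨n, S, hS⟩ := exists_splitFamily F (C := C.toMonTwoCat) W X
    obtain ⟨ι, _, k, p, q, hpq⟩ := hS.decomposition f
    rw [← hpq, comp2_sum (C := C.toMonTwoCat) F]
    refine Finset.sum_eq_zero fun a _ => ?_
    have h2 : C.comp2 z (p a ≫ q a) = C.comp2 (𝟙 _) (p a) ≫ C.comp2 z (𝟙 _) ≫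
        C.comp2 (𝟙 _) (q a) := by
      rw [← C.comp2_comp, ← C.comp2_comp]
      simp
    rw [h2, hz X hX _ (hS.split _), zero_comp, comp_zero]
  -- The identity of `1_W` factors through composites f_i g_i with f_i ending in E; z acts on these
  -- through f_i, hence by zero.
  obtain ⟨ι, _, X, hX, f, g, a, b, hab⟩ := exists_decomposition hE (C.one1 W)
  rw [← Category.comp_id z, ← hab, Preadditive.comp_sum]
  refine Finset.sum_eq_zero fun i _ => ?_
  have h2 : C.comp2 z (𝟙 (C.comp1 (f i) (g i))) = 0 := by
    have h3 : C.comp2 (C.comp2 z (𝟙 (f i))) (𝟙 (g i)) = 0 := by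
      rw [h1 _ (hX i), zero_comp2 (C := C.toMonTwoCat) F]
    rw [← recast_eq_zero_iff (comp1_assoc _ _ _) (comp1_assoc _ _ _)] at h3
    rw [← h3, ← C.comp2_id]
    refine hom_ext ?_
    have h4 : C.tgt (C.dom (C.cellOf z)) = C.src (f i).mor := by
      rw [(isCell_cellOf z).1, (f i).isMor.1]
      exact tgt_one _
    exact (hcomp_assoc (by simpa using h4)
      (by simpa using (f i).isMor.2.trans (g i).isMor.1.symm)).symm
  have h3 : z ≫ a i = recast (one_comp1 _) (one_comp1 _)
      (C.comp2 z (𝟙 (C.one1 W)) ≫ C.comp2 (𝟙 _) (a i)) := by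
    refine hom_ext ?_
    rw [cellOf_recast, cellOf_comp, cellOf_comp, cellOf_comp2_one, cellOf_one_comp2]
  have h4 : C.comp2 z (𝟙 (C.one1 W)) ≫ C.comp2 (𝟙 _) (a i) = C.comp2 (𝟙 _) (a i) ≫
      C.comp2 z (𝟙 (C.comp1 (f i) (g i))) := by
    rw [← C.comp2_comp, ← C.comp2_comp]
    simp
  have h5 : z ≫ a i = 0 := by
    rw [h3, recast_eq_zero_iff, h4, h2, comp_zero]
  rw [← Category.assoc, h5, zero_comp]

/-- The identity of `1_W` is a linear combination of circles, for any complete families of pairwise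
orthogonal split simple 1-morphisms from `W` to the objects of the horizontal basis. -/
theorem id_eq_sum_circHom (hE : C.toMonTwoCat.IsHorizontalBasis F E) {ι : C.Obj → Type*}
    (s : ∀ X, Finset (ι X)) (H : ∀ X, ι X → C.Hom1 W X)
    (horth : ∀ X, ∀ i ∈ s X, ∀ j ∈ s X, i ≠ j → ∀ φ : H X i ⟶ H X j, φ = 0)
    (hcompl : ∀ X, ∀ f : C.Hom1 W X, IsSplit F f → ∃ i ∈ s X, Nonempty (H X i ≅ f))
    (d : ∀ X, ι X → F)
    (hd : ∀ X ∈ E, ∀ i ∈ s X,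
      d X i • C.comp2 (circHom (H X i)) (𝟙 (H X i)) = 𝟙 (C.comp1 (C.one1 W) (H X i))) :
    𝟙 (C.one1 W) = ∑ X ∈ E, ∑ i ∈ s X, d X i • circHom (H X i) := by
  rw [← sub_eq_zero]
  refine eq_zero_of_comp2_eq_zero hE _ fun X hX f hf => ?_
  obtain ⟨i, hi, ⟨e⟩⟩ := hcompl X f hf
  set z := 𝟙 (C.one1 W) - ∑ X ∈ E, ∑ i ∈ s X, d X i • circHom (H X i) with hz
  have h1 : C.comp2 z (𝟙 f) = C.comp2 (𝟙 _) e.inv ≫ C.comp2 z (𝟙 (H X i)) ≫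
      C.comp2 (𝟙 _) e.hom := by
    rw [← C.comp2_comp, ← C.comp2_comp]
    simp
  -- Acting on one simple 1-morphism, only its own circle survives, and its coefficient normalises
  -- that action to the identity.
  have h2 : C.comp2 (∑ X ∈ E, ∑ i ∈ s X, d X i • circHom (H X i)) (𝟙 (H X i)) =
      𝟙 (C.comp1 (C.one1 W) (H X i)) := by
    rw [sum_comp2 (C := C.toMonTwoCat) F, Finset.sum_eq_single X, sum_comp2 (C := C.toMonTwoCat) F,
      Finset.sum_eq_single i]
    · rw [smul_comp2, hd X hX i hi]
    · intro j hj hji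
      rw [smul_comp2, circHom_comp2_eq_zero_of_hom hE hX _ _ (horth X i hi j hj hji.symm),
        smul_zero]
    · exact fun h => absurd hi h
    · intro Y hY hYX
      rw [sum_comp2 (C := C.toMonTwoCat) F]
      refine Finset.sum_eq_zero fun j _ => ?_
      rw [smul_comp2, circHom_comp2_eq_zero_of_ne hE hY hX hYX, smul_zero]
    · exact fun h => absurd hX h
  have h3 : C.comp2 z (𝟙 (H X i)) = 0 := by
    have h4 := (comp2Bilin F C.toMonTwoCat (C.one1 W) (C.one1 W) (H X i) (H X i)).map_sub₂ (𝟙 _)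
      (∑ X ∈ E, ∑ i ∈ s X, d X i • circHom (H X i)) (𝟙 (H X i))
    refine h4.trans ?_
    refine (congrArg₂ (· - ·) (C.comp2_id _ _) h2).trans (sub_self _)
  rw [h1, h3, zero_comp, comp_zero]

end Typed

end DualTwoCat

namespace DualTwoCat

open TwoCat MonTwoCat

/-! ## The trace on endomorphisms of identity 1-morphisms -/

section Trace

theorem cellOf_pairing_id (C : DualTwoCat.{u, v, w}) {A B : C.Obj} (f : C.Hom1 A B) :
    C.cellOf (C.pairing (𝟙 f) (𝟙 f)) = C.circR f.mor := by
  change C.pairCell (C.idc f.mor) (C.idc f.mor) = _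
  have h := f.isMor.1
  rw [pairCell, C.laws.dom_idc, idc_vcomp (by simp), idc_hcomp_idc (by simp), circR, circ]
  change C.capR f.mor ⬝₂ _ ⬝₂ C.cupR f.mor = C.capR f.mor ⬝₂ C.cupR f.mor
  congr 1
  have h2 : C.trRc (C.idc (f.mor ⬝₁ f.mor⁎₁)) = C.idc (C.dom (C.cupR f.mor)) := by
    simp (maxDischargeDepth := 9) [trRc, cupR, capR, C.monLaws.idc_rtensc, idc_hcomp_idc]
  rw [h2, idc_vcomp rfl]

theorem cellOf_pairing_id_one (C : DualTwoCat.{u, v, w}) {A : C.Obj} (β : C.one1 A ⟶ C.one1 A) :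
    C.cellOf (C.pairing (𝟙 (C.one1 A)) β) = C.surround (C.unit0 A) (C.cellOf β ▷₂ A⁎₀) := by
  change C.pairCell (C.idc (C.one A)) (C.cellOf β) = _
  obtain ⟨h1, h2⟩ := isCell_cellOf β
  replace h1 : C.dom (C.cellOf β) = C.one A := h1
  rw [pairCell, C.laws.dom_idc, idc_vcomp h1, dual1_one, hcomp_one (by simp [h1])]
  simp [surround, capR, cupR, trRc, h1]

theorem cellOf_smul_id {F : Type x} [Field F] {C : DualTwoCat.{u, v, w}}
    [∀ A B, Preadditive (C.Hom1 A B)] [∀ A B, Linear F (C.Hom1 A B)] {A B A' B' : C.Obj}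
    (f : C.Hom1 A B) (f' : C.Hom1 A' B') (h : f.mor = f'.mor) (c : F) :
    C.cellOf (c • 𝟙 f) = C.cellOf (c • 𝟙 f') := by
  obtain rfl : A = A' := by rw [← f.isMor.1, h, f'.isMor.1]
  obtain rfl : B = B' := by rw [← f.isMor.2, h, f'.isMor.2]
  obtain rfl := Hom1.ext h
  rfl

variable (F : Type x) [Field F] (C : DualTwoCat.{u, v, w})
  [∀ A B, Preadditive (C.Hom1 A B)] [∀ A B, Linear F (C.Hom1 A B)]

section Scalar

variable [UnitIsVect F C.toMonTwoCat]

theorem scalar_smul_id (z : C.one1 C.I ⟶ C.one1 C.I) : C.scalar F z • 𝟙 (C.one1 C.I) = z :=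
  (Equiv.ofBijective _ (UnitIsVect.scalar_bijective (F := F)
    (C := C.toMonTwoCat))).apply_symm_apply z

theorem scalar_eq {c : F} {z : C.one1 C.I ⟶ C.one1 C.I} (h : z = c • 𝟙 (C.one1 C.I)) :
    C.scalar F z = c :=
  (UnitIsVect.scalar_bijective (F := F) (C := C.toMonTwoCat)).1 ((scalar_smul_id F C z).trans h)

/-- The identification of `2End(1_I)` with the field `F`, as a linear map. -/
noncomputable def scalarMap : (C.one1 C.I ⟶ C.one1 C.I) →ₗ[F] F where
  toFun := C.scalar F
  map_add' z z' := scalar_eq F C (by rw [add_smul, scalar_smul_id, scalar_smul_id])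
  map_smul' c z := scalar_eq F C (by rw [RingHom.id_apply, smul_eq_mul, mul_smul, scalar_smul_id])

theorem qdim1_congr {A B A' B' : C.Obj} {f : C.Hom1 A B} {g : C.Hom1 A' B'}
    (h : C.circR f.mor = C.circR g.mor) : C.qdim1 F f = C.qdim1 F g := by
  refine congrArg (C.scalar F) (hom_ext ?_)
  rw [cellOf_pairing_id, cellOf_pairing_id, h]

theorem qdim_eq_scalar {A : C.Obj} {z : C.one1 C.I ⟶ C.one1 C.I}
    (hz : C.cellOf z = C.circ (C.unit0 A)) : C.qdim F A = C.scalar F z := by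
  refine congrArg (C.scalar F) (hom_ext ?_)
  rw [cellOf_pairing_id, hz]
  exact circR_one A

end Scalar

variable [VectLinear F C.toMonTwoCat]

/-- Surrounding an endomorphism of `1_B` by a 1-morphism `A → B`, as a linear map. -/
def surroundMap {A B : C.Obj} (f : C.Hom1 A B) :
    (C.one1 B ⟶ C.one1 B) →ₗ[F] (C.one1 A ⟶ C.one1 A) where
  toFun z := unitHom f ≫ C.comp2 (𝟙 f) (recastEquiv F (one_comp1 _) (one_comp1 _)
    (C.comp2 z (𝟙 (dualHom f)))) ≫ star (unitHom f)
  map_add' z z' := by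
    rw [VectLinear.add_comp2 (F := F) (C := C.toMonTwoCat), map_add,
      VectLinear.comp2_add (F := F) (C := C.toMonTwoCat), Preadditive.add_comp,
      Preadditive.comp_add]
  map_smul' c z := by
    rw [smul_comp2, map_smul, comp2_smul, Linear.smul_comp, Linear.comp_smul, RingHom.id_apply]

theorem cellOf_surroundMap {A B : C.Obj} (f : C.Hom1 A B) (z : C.one1 B ⟶ C.one1 B) :
    C.cellOf (surroundMap F C f z) = C.surround f.mor (C.cellOf z) := rfl

/-- Tensoring endomorphisms of `1_A` with an object on the right, as a linear map. -/
def rtensMap (A X : C.Obj) :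
    (C.one1 A ⟶ C.one1 A) →ₗ[F] (C.one1 (A ⊗₀ X) ⟶ C.one1 (A ⊗₀ X)) where
  toFun z := recast (one_rtens A X) (one_rtens A X) (C.rtens2 z X)
  map_add' z z' := by
    rw [VectLinear.rtens2_add (F := F) (C := C.toMonTwoCat)]
    exact (recastEquiv F (one_rtens A X) (one_rtens A X)).map_add _ _
  map_smul' c z := by
    rw [VectLinear.rtens2_smul (F := F) (C := C.toMonTwoCat)]
    exact (recastEquiv F (one_rtens A X) (one_rtens A X)).map_smul _ _

/-- The unit of an object, as a 1-morphism of `Hom(I, A ⊗ A*)`. -/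
def unitObj (A : C.Obj) : C.Hom1 C.I (A ⊗₀ A⁎₀) := ⟨C.unit0 A, src_unit0 A, tgt_unit0 A⟩

variable [UnitIsVect F C.toMonTwoCat]

/-- The trace of an endomorphism of `1_A`. -/
noncomputable def qtrace (A : C.Obj) : (C.one1 A ⟶ C.one1 A) →ₗ[F] F :=
  scalarMap F C ∘ₗ surroundMap F C (unitObj C A) ∘ₗ rtensMap F C A A⁎₀

theorem qtrace_apply {A : C.Obj} {z : C.one1 A ⟶ C.one1 A} {y : C.one1 C.I ⟶ C.one1 C.I}
    (h : C.cellOf y = C.surround (C.unit0 A) (C.cellOf z ▷₂ A⁎₀)) :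
    qtrace F C A z = C.scalar F y :=
  congrArg (C.scalar F) (hom_ext h.symm)

theorem qdim1_eq_qtrace {A B : C.Obj} (f : C.Hom1 A B) :
    C.qdim1 F f = qtrace F C A (circHom f) := by
  refine (qtrace_apply F C ?_).symm
  rw [cellOf_pairing_id, circR_eq_surround, cellOf_circHom, f.isMor.1]

theorem qtrace_id (A : C.Obj) : qtrace F C A (𝟙 (C.one1 A)) = C.qdim F A :=
  qtrace_apply F C (cellOf_pairing_id_one C _)

/-- Every 2-endomorphism of `1_A` is c · 1 and pairs with the identity to c · dim A. If dim A were
zero, the identity would lie in the radical of the pairing. -/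
theorem qdim_ne_zero (hC : C.NonDegenerate) {A : C.Obj} (hA : IsSplit F (C.one1 A)) :
    C.qdim F A ≠ 0 := by
  intro h0
  refine hA.id_ne_zero ((hC A A _ _).1 _ fun β => ?_)
  obtain ⟨c, rfl⟩ := hA.exists_smul β
  have h1 := qtrace_apply F C (cellOf_pairing_id_one C (c • 𝟙 (C.one1 A)))
  rw [map_smul, qtrace_id, h0, smul_zero] at h1
  rw [← scalar_smul_id F C (C.pairing _ _), ← h1, zero_smul]

end Trace

end DualTwoCat

/-! ### Quantum dimensions of duals and tensor products; the dimension formula. -/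

namespace SphericalTwoCat

open TwoCat MonTwoCat DualTwoCat

section Trace

variable (F : Type x) [Field F] (C : SphericalTwoCat.{u, v, w})
  [∀ A B, Preadditive (C.Hom1 A B)] [∀ A B, Linear F (C.Hom1 A B)] [UnitIsVect F C.toMonTwoCat]

theorem qdim_dual0 (A : C.Obj) : C.qdim F A⁎₀ = C.qdim F A := by
  refine congrArg (C.scalar F) (hom_ext ?_)
  rw [cellOf_pairing_id, cellOf_pairing_id]
  change C.circR (C.one A⁎₀) = C.circR (C.one A)
  rw [circR_eq_circL (C.one A), circL_one, circR_one]

theorem qdim1_dualHom {A B : C.Obj} (f : C.Hom1 A B) :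
    C.qdim1 F (dualHom (C := C.toDualTwoCat) f) = C.qdim1 F f :=
  qdim1_congr F C.toDualTwoCat (circR_dual1 f.mor)

variable [VectLinear F C.toMonTwoCat]

theorem qdim_tens (A B : C.Obj) : C.qdim F (A ⊗₀ B) = C.qdim F A * C.qdim F B := by
  set iB := unitObj C.toDualTwoCat B
  set iA := unitObj C.toDualTwoCat A
  have hB : C.qdim F B • 𝟙 (C.one1 C.I) = circHom iB := by
    rw [← scalar_smul_id F C.toDualTwoCat (circHom iB)]
    congr 1
    exact qdim_eq_scalar F C.toDualTwoCat rfl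
  have hA : C.qdim F A • 𝟙 (C.one1 C.I) = circHom iA := by
    rw [← scalar_smul_id F C.toDualTwoCat (circHom iA)]
    congr 1
    exact qdim_eq_scalar F C.toDualTwoCat rfl
  -- The circle of i_{A ⊗ B} is the circle of i_B inside that of i_A. The inner one is the scalar
  -- dim B, which linearity of ⊗ moves outside.
  have h1 : A ◁₂ C.circ (C.unit0 B) ▷₂ A⁎₀ =
      C.cellOf (C.qdim F B • 𝟙 (C.one1 (A ⊗₀ A⁎₀))) := by
    have h2 : C.circ (C.unit0 B) = C.cellOf (C.qdim F B • 𝟙 (C.one1 C.I)) := by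
      rw [hB]; rfl
    rw [h2]
    change C.cellOf (C.ltens2 A (C.rtens2 (C.qdim F B • 𝟙 (C.one1 C.I)) A⁎₀)) = _
    rw [VectLinear.rtens2_smul (F := F) (C := C.toMonTwoCat),
      VectLinear.ltens2_smul (F := F) (C := C.toMonTwoCat)]
    have h3 : C.ltens2 A (C.rtens2 (𝟙 (C.one1 C.I)) A⁎₀) =
        𝟙 (C.ltens1 A (C.rtens1 (C.one1 C.I) A⁎₀)) := by
      refine hom_ext ?_
      change A ◁₂ (C.idc (C.one C.I) ▷₂ A⁎₀) = C.idc (A ◁₁ (C.one C.I ▷₁ A⁎₀))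
      rw [C.monLaws.idc_rtensc, C.monLaws.ltensc_idc]
    rw [h3]
    refine cellOf_smul_id (C := C.toDualTwoCat) _ _ ?_ _
    change A ◁₁ (C.one C.I ▷₁ A⁎₀) = C.one (A ⊗₀ A⁎₀)
    simp
  have h4 : C.circ (C.unit0 (A ⊗₀ B)) =
      C.cellOf (surroundMap F C.toDualTwoCat iA (C.qdim F B • 𝟙 (C.one1 (A ⊗₀ A⁎₀)))) := by
    rw [unit0_tens, circ_comp (by simp), circ_ltens, circ_rtens, h1]
    rfl
  rw [qdim_eq_scalar F C.toDualTwoCat h4.symm]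
  refine scalar_eq F C.toDualTwoCat ?_
  rw [map_smul, mul_comm, mul_smul, hA]
  congr 1
  refine hom_ext ?_
  rw [cellOf_surroundMap, cellOf_circHom]
  change C.surround (C.unit0 A) (C.idc (C.one (A ⊗₀ A⁎₀))) = C.circ (C.unit0 A)
  rw [surround, circ]
  simp (maxDischargeDepth := 9) [idc_hcomp_idc, idc_vcomp]

/-- The quantum dimension of an object in terms of those of the simple 1-morphisms from it to
the horizontal basis. -/
theorem qdim_eq_sum (hC : C.NonDegenerate) {E : Finset C.Obj}
    (hE : C.toMonTwoCat.IsHorizontalBasis F E) {W : C.Obj} {ι : C.Obj → Type*}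
    (s : ∀ X, Finset (ι X)) (H : ∀ X, ι X → C.Hom1 W X)
    (hsplit : ∀ X, ∀ i ∈ s X, IsSplit F (H X i))
    (horth : ∀ X, ∀ i ∈ s X, ∀ j ∈ s X, i ≠ j → ∀ φ : H X i ⟶ H X j, φ = 0)
    (hcompl : ∀ X, ∀ f : C.Hom1 W X, IsSplit F f → ∃ i ∈ s X, Nonempty (H X i ≅ f)) :
    C.qdim F W = ∑ X ∈ E, ∑ i ∈ s X, (C.qdim F X)⁻¹ * C.qdim1 F (H X i) ^ 2 := by
  have hd : ∀ X ∈ E, ∀ i ∈ s X,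
      ((C.qdim F X)⁻¹ * C.qdim1 F (H X i)) •
        C.comp2 (circHom (C := C.toDualTwoCat) (H X i)) (𝟙 (H X i)) =
      𝟙 (C.comp1 (C.one1 W) (H X i)) := by
    intro X hX i hi
    obtain ⟨d, h1, h2⟩ := exists_smul_circHom (C := C.toDualTwoCat) hE hX (hsplit X i hi)
    have h3 := qdim_ne_zero F C.toDualTwoCat hC (isSplit_one_of_mem hE hX)
    -- Tracing circle(h*) = d · 1 gives dim h = dim h* = d · dim X, which identifies d with the
    -- coefficient in question.
    have h4 := qdim1_eq_qtrace F C.toDualTwoCat (dualHom (C := C.toDualTwoCat) (H X i))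
    rw [qdim1_dualHom, h1, map_smul, qtrace_id, smul_eq_mul] at h4
    rw [h4, mul_comm d, inv_mul_cancel_left₀ h3, h2]
  -- The trace of the circle of h is dim h once more; together with the coefficient this produces
  -- the square.
  have h := congrArg (qtrace F C.toDualTwoCat W)
    (id_eq_sum_circHom (C := C.toDualTwoCat) hE s H horth hcompl _ hd)
  rw [qtrace_id] at h
  simp only [map_sum, map_smul, ← qdim1_eq_qtrace, smul_eq_mul, mul_assoc, ← sq] at h
  exact h

end Trace

end SphericalTwoCat

namespace DualTwoCat

open TwoCat MonTwoCat

/-! ## Mates of 1-morphisms into tensor products -/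

section MateCells

variable {C : DualTwoCat.{u, v, w}}

/-- The 2-isomorphism `h ⇒ mate (comate h)`. -/
def toMateComate (C : DualTwoCat.{u, v, w}) (B A : C.Obj) (h : C.Mor) : C.Cell :=
  ((C.adj (C.triang B⁎₀) ▷₂ A) ∘₂ C.idc h) ⬝₂
    (C.idc (B⁎₀ ◁₁ C.unit0 B ▷₁ A) ∘₂ C.tor (C.counit0 B) h)

theorem isCell_toMateComate {A B D : C.Obj} {h : C.Mor} (hs : C.src h = B⁎₀ ⊗₀ A)
    (ht : C.tgt h = D) :
    C.IsCell (C.toMateComate B A h) h (C.mate B D (C.comate B A h)) := by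
  obtain ⟨h1, h2⟩ := isCell_adj_triang (C := C) B⁎₀
  constructor <;> simp (maxDischargeDepth := 9) [toMateComate, mate, comate, *]

theorem isUnitary_toMateComate {A B : C.Obj} {h : C.Mor} (hs : C.src h = B⁎₀ ⊗₀ A) :
    C.IsUnitary (C.toMateComate B A h) := by
  obtain ⟨h1, h2⟩ := isCell_adj_triang (C := C) B⁎₀
  refine isUnitary_vcomp (isUnitary_hcomp (isUnitary_rtensc (isUnitary_adj
    (C.dualLaws.triang_unitary B⁎₀) ⟨rfl, rfl⟩ ?_ ?_) A) (isUnitary_idc _) ?_)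
    (isUnitary_hcomp (isUnitary_idc _) (isUnitary_tor _ _) ?_) ?_
  all_goals simp (maxDischargeDepth := 9) [*]

/-- Naturality of the tensorator carries α across i_B, and interchange carries it past the
triangulator. -/
theorem comateMate_natural {A B D : C.Obj} {f g : C.Mor} {α : C.Cell} (hα : C.IsCell α f g)
    (hs : C.src f = A) (ht : C.tgt f = B ⊗₀ D) :
    (C.idc (C.unit0 B ▷₁ A) ∘₂ (B ◁₂ ((B⁎₀ ◁₂ α) ∘₂ C.idc (C.counit0 B ▷₁ D)))) ⬝₂
      C.comateMate B D g = C.comateMate B D f ⬝₂ α := by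
  have hn := C.monLaws.tor_natural (C.idc (C.unit0 B)) α
  have hs' : C.src g = A := by rw [← hs, ← hα.1, ← hα.2, C.laws.src_dom]
  have ht' : C.tgt g = B ⊗₀ D := by rw [← ht, ← hα.1, ← hα.2, C.laws.tgt_dom]
  obtain ⟨h1, h2⟩ := hα
  rw [C.monLaws.idc_rtensc, C.monLaws.idc_rtensc, dom_idc, cod_idc, h1, h2, hs, ht, tgt_unit0,
    src_unit0, C.monLaws.I_ltensc, C.monLaws.ltensc_ltensc] at hn
  rw [comateMate, comateMate, C.monLaws.ltensc_hcomp, C.monLaws.ltensc_idc, ← vcomp_assoc,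
    ← hcomp_assoc, ← vcomp_hcomp_idc, hn, vcomp_hcomp_idc, vcomp_assoc, vcomp_assoc, hcomp_assoc,
    idc_hcomp_idc, hcomp_eq_left_right,
    ← hcomp_eq_right_left (f := f) (g := C.one (B ⊗₀ D)) (α := α) (β := C.triang B ▷₂ D), hcomp_one]
  all_goals simp (maxDischargeDepth := 9) [*]

theorem toMateComate_natural {A B D : C.Obj} {h k : C.Mor} {β : C.Cell} (hβ : C.IsCell β h k)
    (hs : C.src h = B⁎₀ ⊗₀ A) (ht : C.tgt h = D) :
    β ⬝₂ C.toMateComate B A k = C.toMateComate B A h ⬝₂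
      ((B⁎₀ ◁₂ (C.idc (C.unit0 B ▷₁ A) ∘₂ (B ◁₂ β))) ∘₂ C.idc (C.counit0 B ▷₁ D)) := by
  have hn := C.monLaws.tor_natural (C.idc (C.counit0 B)) β
  have hs' : C.src k = B⁎₀ ⊗₀ A := by rw [← hs, ← hβ.1, ← hβ.2, C.laws.src_dom]
  have ht' : C.tgt k = D := by rw [← ht, ← hβ.1, ← hβ.2, C.laws.tgt_dom]
  obtain ⟨h1, h2⟩ := hβ
  obtain ⟨h3, h4⟩ := isCell_adj_triang (C := C) B⁎₀
  rw [C.monLaws.idc_rtensc, C.monLaws.idc_rtensc, dom_idc, cod_idc, h1, h2, hs, ht, tgt_counit0,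
    src_counit0, C.monLaws.I_ltensc, C.monLaws.ltensc_ltensc] at hn
  rw [toMateComate, toMateComate, C.monLaws.ltensc_hcomp, C.monLaws.ltensc_idc, vcomp_assoc,
    hcomp_assoc, ← idc_hcomp_vcomp, ← hn, idc_hcomp_vcomp, ← vcomp_assoc, ← vcomp_assoc,
    ← hcomp_assoc (α := C.idc (B⁎₀ ◁₁ C.unit0 B ▷₁ A)), idc_hcomp_idc, hcomp_eq_left_right,
    ← hcomp_eq_right_left (f := C.one (B⁎₀ ⊗₀ A)) (g := k) (β := β), one_hcomp]
  all_goals simp (maxDischargeDepth := 9) [*]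

end MateCells

section MateFunctor

variable (C : DualTwoCat.{u, v, w}) (B A D : C.Obj)

/-- The 1-morphism `e_B ⊗ D : B* ⊗ (B ⊗ D) → D`. -/
def counitTens : C.Hom1 (B⁎₀ ⊗₀ B ⊗₀ D) D := ⟨C.counit0 B ▷₁ D, by simp, by simp⟩

/-- The 1-morphism `i_B ⊗ A : A → B ⊗ (B* ⊗ A)`. -/
def unitTens : C.Hom1 A (B ⊗₀ B⁎₀ ⊗₀ A) := ⟨C.unit0 B ▷₁ A, by simp, by simp⟩

/-- The functor `f ↦ mate f` from `Hom(A, B ⊗ D)` to `Hom(B* ⊗ A, D)`. -/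
def mateFunctor : C.Hom1 A (B ⊗₀ D) ⥤ C.Hom1 (B⁎₀ ⊗₀ A) D where
  obj f := C.comp1 (C.ltens1 B⁎₀ f) (counitTens C B D)
  map α := C.comp2 (C.ltens2 B⁎₀ α) (𝟙 _)
  map_id f := by
    rw [← C.comp2_id]
    congr 1
    exact hom_ext (C.monLaws.ltensc_idc _ _)
  map_comp {f g h} α β := by
    rw [← C.comp2_comp, Category.comp_id]
    congr 1
    exact hom_ext (C.monLaws.ltensc_vcomp _ _ _
      ((isCell_cellOf α).2.trans (isCell_cellOf β).1.symm))

/-- The functor `h ↦ comate h` from `Hom(B* ⊗ A, D)` to `Hom(A, B ⊗ D)`. -/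
def comateFunctor : C.Hom1 (B⁎₀ ⊗₀ A) D ⥤ C.Hom1 A (B ⊗₀ D) where
  obj h := C.comp1 (unitTens C B A) (C.ltens1 B h)
  map β := C.comp2 (𝟙 _) (C.ltens2 B β)
  map_id f := by
    rw [← C.comp2_id]
    congr 1
    exact hom_ext (C.monLaws.ltensc_idc _ _)
  map_comp {f g h} α β := by
    rw [← C.comp2_comp, Category.comp_id]
    congr 1
    exact hom_ext (C.monLaws.ltensc_vcomp _ _ _
      ((isCell_cellOf α).2.trans (isCell_cellOf β).1.symm))

variable {C} in
/-- The isomorphism of `Hom(A, B)` given by a unitary 2-morphism. -/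
def isoOfIsUnitary {A B : C.Obj} {f g : C.Hom1 A B} {α : C.Cell} (h : C.IsUnitary α)
    (hα : C.IsCell α f.mor g.mor) : f ≅ g where
  hom := homMk α hα
  inv := homMk α⁎₂ ⟨(dom_dual2 _).trans hα.2, (cod_dual2 _).trans hα.1⟩
  hom_inv_id := hom_ext (h.2.1.trans (congrArg C.idc hα.1))
  inv_hom_id := hom_ext (h.2.2.trans (congrArg C.idc hα.2))

/-- The equivalence between `Hom(A, B ⊗ D)` and `Hom(B* ⊗ A, D)`. -/
def mateEquivalence : C.Hom1 A (B ⊗₀ D) ≌ C.Hom1 (B⁎₀ ⊗₀ A) D :=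
  CategoryTheory.Equivalence.mk (mateFunctor C B A D) (comateFunctor C B A D)
    (NatIso.ofComponents (F := mateFunctor C B A D ⋙ comateFunctor C B A D) (G := 𝟭 _)
      (fun f => isoOfIsUnitary (isUnitary_comateMate f.isMor.2)
        (isCell_comateMate f.isMor.1 f.isMor.2))
      (fun {f _} α => hom_ext (comateMate_natural (isCell_cellOf α) f.isMor.1 f.isMor.2))).symm
    (NatIso.ofComponents (F := 𝟭 _) (G := comateFunctor C B A D ⋙ mateFunctor C B A D)
      (fun h => isoOfIsUnitary (isUnitary_toMateComate h.isMor.1)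
        (isCell_toMateComate h.isMor.1 h.isMor.2))
      (fun {h _} β => hom_ext (toMateComate_natural (isCell_cellOf β) h.isMor.1 h.isMor.2))).symm

end MateFunctor

section MateLinear

variable {F : Type x} [Field F] {C : DualTwoCat.{u, v, w}} {A B D : C.Obj}
  [∀ A B, Preadditive (C.Hom1 A B)] [∀ A B, Linear F (C.Hom1 A B)]
  [VectLinear F C.toMonTwoCat]

theorem mateFunctor_map_smul {f g : C.Hom1 A (B ⊗₀ D)} (c : F) (α : f ⟶ g) :
    (mateFunctor C B A D).map (c • α) = c • (mateFunctor C B A D).map α := by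
  change C.comp2 (C.ltens2 B⁎₀ (c • α)) (𝟙 _) = c • C.comp2 (C.ltens2 B⁎₀ α) (𝟙 _)
  rw [VectLinear.ltens2_smul (F := F) (C := C.toMonTwoCat), smul_comp2]

instance : (mateFunctor C B A D).IsEquivalence :=
  (mateEquivalence C B A D).isEquivalence_functor

theorem isSplit_mateFunctor_iff {f : C.Hom1 A (B ⊗₀ D)} :
    IsSplit F ((mateFunctor C B A D).obj f) ↔ IsSplit F f := by
  have h : (fun c : F => c • 𝟙 ((mateFunctor C B A D).obj f)) =
      (mateFunctor C B A D).map ∘ fun c : F => c • 𝟙 f := by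
    funext c
    rw [Function.comp_apply, mateFunctor_map_smul, CategoryTheory.Functor.map_id]
  rw [IsSplit, IsSplit, h]
  exact Function.Bijective.of_comp_iff' ⟨(mateFunctor C B A D).map_injective,
    (mateFunctor C B A D).map_surjective⟩ _

/-- Fullness lifts the map; writing zero as `0 • 0` makes homogeneity of the functor suffice. -/
theorem mateFunctor_hom_eq_zero (F : Type x) [Field F] [∀ A B, Linear F (C.Hom1 A B)]
    [VectLinear F C.toMonTwoCat] {f g : C.Hom1 A (B ⊗₀ D)} (h : ∀ φ : f ⟶ g, φ = 0)
    (φ : (mateFunctor C B A D).obj f ⟶ (mateFunctor C B A D).obj g) : φ = 0 := by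
  obtain ⟨ψ, rfl⟩ := (mateFunctor C B A D).map_surjective φ
  rw [h ψ, ← zero_smul F (0 : f ⟶ g), mateFunctor_map_smul, zero_smul]

end MateLinear

end DualTwoCat

/-! ### Counting the simple objects. -/

namespace SphericalTwoCat

open TwoCat MonTwoCat DualTwoCat

section Counting

variable {F : Type x} [Field F] {C : SphericalTwoCat.{u, v, w}}
  [∀ A B, Preadditive (C.Hom1 A B)] [∀ A B, Linear F (C.Hom1 A B)]
  [UnitIsVect F C.toMonTwoCat]

theorem qdim1_mateFunctor {A B D : C.Obj} (f : C.Hom1 A (B ⊗₀ D)) :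
    C.qdim1 F ((mateFunctor C.toDualTwoCat B A D).obj f) = C.qdim1 F f :=
  qdim1_congr F C.toDualTwoCat (circR_mate f.isMor.1 f.isMor.2)

variable [VectLinear F C.toMonTwoCat]

theorem qdim_mul_qdim_eq_sum (hC : C.NonDegenerate) {E : Finset C.Obj}
    (hE : C.toMonTwoCat.IsHorizontalBasis F E) (A B : C.Obj)
    (S : ∀ D : C.Obj, Finset (C.Hom1 A (B ⊗₀ D))) (hS : ∀ D, IsTwoVectBasis (S D)) :
    C.qdim F B * C.qdim F A = ∑ D ∈ E, ∑ f ∈ S D, (C.qdim F D)⁻¹ * C.qdim1 F f ^ 2 := by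
  have hsimple : ∀ D (f : C.Hom1 A (B ⊗₀ D)), Simple f ↔ IsSplit F f := fun D f => by
    obtain ⟨n, T, hT⟩ := exists_splitFamily F (C := C.toMonTwoCat) A (B ⊗₀ D)
    exact hT.simple_iff_isSplit f
  have h := qdim_eq_sum F C hC hE (W := B⁎₀ ⊗₀ A) S
    (fun D f => (mateFunctor C.toDualTwoCat B A D).obj f)
    (fun D f hf => isSplit_mateFunctor_iff.2 ((hsimple D f).1 ((hS D).1 f hf))) ?_ ?_
  · rw [qdim_tens, qdim_dual0] at h
    simpa only [qdim1_mateFunctor] using h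
  · intro D f hf g hg hfg
    -- A non-zero map between two basis elements would make them isomorphic, against uniqueness of
    -- representatives.
    refine mateFunctor_hom_eq_zero (C := C.toDualTwoCat) F fun ψ => ?_
    by_contra hψ
    obtain ⟨n, T, hT⟩ := exists_splitFamily F (C := C.toMonTwoCat) A (B ⊗₀ D)
    have hf' := (hS D).1 f hf
    have hg' := (hS D).1 g hg
    obtain ⟨e⟩ := hT.iso_of_ne_zero ((hsimple D f).1 hf') ((hsimple D g).1 hg') ψ hψ
    exact hfg (((hS D).2 g hg').unique ⟨hf, ⟨e⟩⟩ ⟨hg, ⟨Iso.refl g⟩⟩)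
  · intro D h hh
    let e := (mateFunctor C.toDualTwoCat B A D).objObjPreimageIso h
    have hs := (hsimple D _).2 (isSplit_mateFunctor_iff.1 (hh.of_iso e.symm))
    obtain ⟨f, ⟨hf, ⟨e'⟩⟩, -⟩ := (hS D).2 _ hs
    exact ⟨f, hf, ⟨(mateFunctor C.toDualTwoCat B A D).mapIso e' ≪≫ e⟩⟩

theorem card_simpleClasses_eq (hC : C.NonDegenerate) {E : Finset C.Obj}
    (hE : C.toMonTwoCat.IsHorizontalBasis F E) (𝓕 : ∀ A B : C.Obj, Finset (C.Hom1 A B))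
    (h𝓕 : ∀ A B, IsTwoVectBasis (𝓕 A B)) {A : C.Obj} (hA : C.toMonTwoCat.IsSimpleObj F A) :
    (Nat.card (C.toMonTwoCat.SimpleClasses F) : F) =
      ∑ B ∈ E, ∑ D ∈ E, ∑ f ∈ 𝓕 A (C.tens B D),
        (C.qdim F A)⁻¹ * (C.qdim F B)⁻¹ * (C.qdim F D)⁻¹ * C.qdim1 F f ^ 2 := by
  obtain ⟨e⟩ := simpleClasses_equiv hE
  have hcard : Nat.card (C.toMonTwoCat.SimpleClasses F) = E.card := by
    rw [← Nat.card_congr e, Nat.card_eq_fintype_card, Fintype.card_coe]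
  have hA0 := qdim_ne_zero F C.toDualTwoCat hC (isSplit_one_of_isSimpleObj hA)
  rw [hcard, Finset.card_eq_sum_ones, Nat.cast_sum, Nat.cast_one]
  -- Writing |E| as a sum of ones, it remains to see that the inner sum belonging to each B is 1.
  refine Finset.sum_congr rfl fun B hB => ?_
  have hB0 := qdim_ne_zero F C.toDualTwoCat hC (isSplit_one_of_mem hE hB)
  have h := qdim_mul_qdim_eq_sum hC hE A B (fun D => 𝓕 A (B ⊗₀ D)) fun D => h𝓕 A _
  simp_rw [← Finset.mul_sum] at h
  simp_rw [mul_assoc, ← Finset.mul_sum]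
  rw [← h, inv_mul_cancel_left₀ hB0, inv_mul_cancel₀ hA0]

end Counting

end SphericalTwoCat

theorem lemma5p6 {F : Type x} [Field F] [CharZero F] (C : SphericalTwoCat.{u, v, w})
    [∀ A B, Preadditive (C.Hom1 A B)] [∀ A B, Linear F (C.Hom1 A B)]
    [VectLinear F C.toMonTwoCat] [UnitIsVect F C.toMonTwoCat]
    (hC : C.NonDegenerate)
    (E : Finset C.Obj) (hE : C.toMonTwoCat.IsHorizontalBasis F E)
    (𝓕 : ∀ A B : C.Obj, Finset (C.Hom1 A B)) (h𝓕 : ∀ A B, IsTwoVectBasis (𝓕 A B)) :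
    Finite (C.toMonTwoCat.SimpleClasses F) ∧
    (∀ A : C.Obj, C.toMonTwoCat.IsSimpleObj F A → C.qdim F A ≠ 0) ∧
    (∀ A : C.Obj, C.toMonTwoCat.IsSimpleObj F A →
      (Nat.card (C.toMonTwoCat.SimpleClasses F) : F) =
        ∑ B ∈ E, ∑ D ∈ E, ∑ f ∈ 𝓕 A (C.tens B D),
          (C.qdim F A)⁻¹ * (C.qdim F B)⁻¹ * (C.qdim F D)⁻¹ * C.qdim1 F f ^ 2) ∧
    (∀ A A' : C.Obj, C.toMonTwoCat.IsSimpleObj F A → C.toMonTwoCat.IsSimpleObj F A' →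
      ∑ B ∈ E, ∑ D ∈ E, ∑ f ∈ 𝓕 A (C.tens B D),
          (C.qdim F A)⁻¹ * (C.qdim F B)⁻¹ * (C.qdim F D)⁻¹ * C.qdim1 F f ^ 2 =
        ∑ B ∈ E, ∑ D ∈ E, ∑ f ∈ 𝓕 A' (C.tens B D),
          (C.qdim F A')⁻¹ * (C.qdim F B)⁻¹ * (C.qdim F D)⁻¹ * C.qdim1 F f ^ 2) := by
  obtain ⟨e⟩ := MonTwoCat.simpleClasses_equiv hE
  refine ⟨Finite.of_equiv _ e, fun A hA => ?_, fun A hA => ?_, fun A A' hA hA' => ?_⟩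
  · exact DualTwoCat.qdim_ne_zero F C.toDualTwoCat hC (MonTwoCat.isSplit_one_of_isSimpleObj hA)
  · exact SphericalTwoCat.card_simpleClasses_eq hC hE 𝓕 h𝓕 hA
  · rw [← SphericalTwoCat.card_simpleClasses_eq hC hE 𝓕 h𝓕 hA,
      ← SphericalTwoCat.card_simpleClasses_eq hC hE 𝓕 h𝓕 hA']
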